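/- **Pressure.** Let $p$ be a pressure law for which there are constants $\gamma\in(1,3)$, $\kappa,\rho_*,c_*>0$ and $M$ such that $p\in C^2((0,\infty))$ and * $p(\rho)=\kappa\rho^\gamma(1+P(\rho))$ for $0\le\rho\le\rho_*$, where $P\in C^3((0,\rho_*])$ and $|P^{(n)}(\rho)|\le M\rho^{\gamma-1-n}$ for $n=0,1,2,3$ and $0<\rho\le\rho_*$; * $p(\rho)=c_*\rho$ for $\rho\ge\rho_*$; * $p'(\rho)>0$ and $\rho p''(\rho)+2p'(\rho)>0$ for all $\rho>0$. Let $e(\rho)=\int_0^\rho p(s)s^{-2}\,ds$ and $e^*(\rho,r)=\rho e(\rho)-re(r)-(re'(r)+e(r))(\rho-r)$. **Entropy pairs.** The entropy kernel $\chi(\rho,u,s)$ is the solution, continuous in $(u,s)$ for each $\rho>0$, of $$\chi_{\rho\rho}-\frac{p'(\rho)}{\rho^2}\chi_{uu}=0\ (\rho>0),\qquad \chi|_{\rho=0}=0,\qquad \chi_\rho|_{\rho=0}=\delta_{u=s},$$ and the entropy flux kernel $\sigma(\rho,u,s)$, continuous in the same sense, is determined by the fact that $h=\sigma-u\chi$ solves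 $$h_{\rho\rho}-\frac{p'(\rho)}{\rho^2}h_{uu}=\frac{p''(\rho)}{\rho}\chi_u\ (\rho>0),\qquad h|_{\rho=0}=0,\qquad h_\rho|_{\rho=0}=0;$$ equations and initial conditions hold in the sense of distributions in $u$, for every $s$. A function $\psi\in C^2_c(\mathbb R)$ generates the weak entropy pair $$\eta^\psi(\rho,u)=\int_{\mathbb R}\psi(s)\chi(\rho,u,s)\,ds,\qquad q^\psi(\rho,u)=\int_{\mathbb R}\psi(s)\sigma(\rho,u,s)\,ds .$$ **Solutions.** Fix end states $(\rho_\pm,u_\pm)$ with $\rho_\pm>0$, and smooth monotone functions $\bar\rho,\bar u$ on $\mathbb R$ with $(\bar\rho,\bar u)(x)=(\rho_+,u_+)$ for $x\ge L_0$ and $(\bar\rho,\bar u)(x)=(\rho_-,u_-)$ for $x\le -L_0$, for some $L_0>1$. Let $\varepsilon_n>0$, $\varepsilon_n\to0$, and for each $n$ (with $\varepsilon=\varepsilon_n$) let $(\rho^\varepsilon,u^\varepsilon)$ be a classical solution, of class $C^2$ on $[0,\infty)\times\mathbb R$, of the Navier–Stokes equations $$\rho_t+(\rho u)_x=0,\qquad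 (\rho u)_t+(\rho u^2+p(\rho))_x=\varepsilon u_{xx},$$ such that: $\rho^\varepsilon(0,\cdot)-\bar\rho$ and $u^\varepsilon(0,\cdot)-\bar u$ are in $L^2(\mathbb R)$; for every $T>0$, $\rho^\varepsilon$ and $u^\varepsilon$ are bounded on $[0,T]\times\mathbb R$ and $\rho^\varepsilon$ is bounded below there by a positive constant (these bounds may depend on $\varepsilon$); $u^\varepsilon(t,\cdot)-\bar u\in H^1(\mathbb R)$ for all $t>0$; and $(\rho^\varepsilon,u^\varepsilon)(t,x)\to(\rho_\pm,u_\pm)$ as $x\to\pm\infty$ for all $t\ge0$. Assume that the initial data $(\rho_0^\varepsilon,u_0^\varepsilon)=(\rho^\varepsilon,u^\varepsilon)(0,\cdot)$ satisfy, with suprema over $\varepsilon\in\{\varepsilon_n\}$, $$\sup_\varepsilon\int_{\mathbb R}\Big(\tfrac12\rho_0^\varepsilon|u_0^\varepsilon-\bar u|^2+e^*(\rho_0^\varepsilon,\bar\rho)\Big)dx<\infty,\qquad \sup_\varepsilon\varepsilon^2\int_{\mathbb R}\frac{|\rho^\varepsilon_{0,x}|^2}{(\rho_0^\varepsilon)^3}\,dx<\infty,\qquad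 \sup_\varepsilon\int_{\mathbb R}\rho_0^\varepsilon|u_0^\varepsilon-\bar u|\,dx<\infty .$$ **Claim.** Let $\psi\in C^2_c(\mathbb R)$ and $q\in(1,2)$. Then the functions $\eta^\psi(\rho^\varepsilon,u^\varepsilon)$ and $q^\psi(\rho^\varepsilon,u^\varepsilon)$ are locally integrable on $\mathbb R^2_+=(0,\infty)\times\mathbb R$, and the set of distributions $$\eta^\psi(\rho^\varepsilon,u^\varepsilon)_t+q^\psi(\rho^\varepsilon,u^\varepsilon)_x,\qquad \varepsilon\in\{\varepsilon_n:n\in\mathbb N\},$$ is contained and precompact in $W^{-1,q}_{loc}(\mathbb R^2_+)$: every sequence in it has a subsequence and a limit $L\in W^{-1,q}_{loc}(\mathbb R^2_+)$ such that the subsequence converges to $L$ in $W^{-1,q}(U)=\big(W^{1,q'}_0(U)\big)^*$, $q'=q/(q-1)$, for every open $U$ whose closure is a compact subset of $\mathbb R^2_+$. -/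

import Mathlib

open Set Filter Topology MeasureTheory
open scoped ContDiff Distributions LineDeriv

/-! ### The gas: pressure law, internal energy, relative energy -/

/-- The pressure law of a barotropic gas which is an approximate `γ`-law with `γ ∈ (1,3)` at
densities below `ρs`, isothermal at densities above `ρs`, and for which the Euler equations are
strictly hyperbolic and genuinely nonlinear away from the vacuum. -/
structure IsPressureLaw (p : ℝ → ℝ) (γ κ ρs cs M : ℝ) : Prop where
  one_lt_gamma : 1 < γ
  gamma_lt_three : γ < 3
  kappa_pos : 0 < κ
  rho_star_pos : 0 < ρs
  c_star_pos : 0 < cs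
  /-- `p'` and `p''` exist and are continuous on `(0,∞)`. -/
  contDiffOn : ContDiffOn ℝ 2 p (Ioi 0)
  /-- `p = κ ρ^γ (1 + P(ρ))` with `|P⁽ⁿ⁾(ρ)| ≤ M ρ^(2θ - n)`, where `2θ = γ - 1`. -/
  low_density : ∃ P : ℝ → ℝ, ContDiffOn ℝ 3 P (Ioc 0 ρs) ∧
    (∀ ρ ∈ Icc 0 ρs, p ρ = κ * ρ ^ γ * (1 + P ρ)) ∧
    ∀ n : ℕ, n ≤ 3 → ∀ ρ ∈ Ioc 0 ρs,
      |iteratedDerivWithin n P (Ioc 0 ρs) ρ| ≤ M * ρ ^ (γ - 1 - (n : ℝ))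
  high_density : ∀ ρ, ρs ≤ ρ → p ρ = cs * ρ
  strictly_hyperbolic : ∀ ρ, 0 < ρ → 0 < deriv p ρ
  genuinely_nonlinear : ∀ ρ, 0 < ρ → 0 < ρ * deriv (deriv p) ρ + 2 * deriv p ρ

/-- The internal energy `e`, determined by `p(ρ) = ρ² e'(ρ)` and `e(0) = 0`.
(The additive constant plays no role in the relative energy.) -/
noncomputable def internalEnergy (p : ℝ → ℝ) (ρ : ℝ) : ℝ :=
  ∫ s in (0 : ℝ)..ρ, p s / s ^ 2

/-- `e*(ρ, r) = ρ e(ρ) - r e(r) - (r e'(r) + e(r)) (ρ - r)`. -/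
noncomputable def relativeInternalEnergy (p : ℝ → ℝ) (ρ r : ℝ) : ℝ :=
  ρ * internalEnergy p ρ - r * internalEnergy p r
    - (r * deriv (internalEnergy p) r + internalEnergy p r) * (ρ - r)

/-- The total relative mechanical energy
`E[ρ,u] = ∫ (½ ρ |u - ubar|² + e*(ρ, ρbar)) dx ∈ [0,∞]` of a state `(ρ,u)` on the line
(the integrand is nonnegative when `ρ, ρbar > 0`). -/
noncomputable def relativeEnergy (p ρbar ubar ρ u : ℝ → ℝ) : ENNReal :=
  ∫⁻ x, ENNReal.ofReal
    (1 / 2 * ρ x * (u x - ubar x) ^ 2 + relativeInternalEnergy p (ρ x) (ρbar x))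

/-- Smooth monotone reference functions, equal to the right end state for `x ≥ L₀` and
to the left end state for `x ≤ -L₀`, for some `L₀ > 1`. -/
structure IsReferencePair (ρl ul ρr ur : ℝ) (ρbar ubar : ℝ → ℝ) : Prop where
  contDiff_rho : ContDiff ℝ ∞ ρbar
  contDiff_u : ContDiff ℝ ∞ ubar
  monotone_rho : Monotone ρbar ∨ Antitone ρbar
  monotone_u : Monotone ubar ∨ Antitone ubar
  eq_end_states : ∃ L₀ : ℝ, 1 < L₀ ∧
    (∀ x, L₀ ≤ x → ρbar x = ρr ∧ ubar x = ur) ∧ (∀ x, x ≤ -L₀ → ρbar x = ρl ∧ ubar x = ul)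

/-! ### Solutions of the Navier-Stokes equations -/

/-- `(ρ,u)`, functions of `(t,x) ∈ [0,∞) × ℝ`, is the classical solution of
`ρ_t + (ρu)_x = 0`, `(ρu)_t + (ρu² + p(ρ))_x = ε u_xx`
with the end states `(ρl,ul)`, `(ρr,ur)`, in the standard global existence class: the initial data
are square integrable perturbations of the reference functions, density and velocity are bounded
and the density is bounded away from the vacuum on bounded time intervals (including `t = 0`),
`u(t,·) - ubar ∈ H¹(ℝ)` for `t > 0`, and the end states are attained at all times. -/
structure IsNavierStokesSolution (p : ℝ → ℝ) (ε ρl ul ρr ur : ℝ) (ρbar ubar : ℝ → ℝ)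
    (ρ u : ℝ → ℝ → ℝ) : Prop where
  contDiffOn_rho : ContDiffOn ℝ 2 (fun z : ℝ × ℝ => ρ z.1 z.2) (Ici 0 ×ˢ univ)
  contDiffOn_u : ContDiffOn ℝ 2 (fun z : ℝ × ℝ => u z.1 z.2) (Ici 0 ×ˢ univ)
  mass : ∀ t x, 0 < t →
    deriv (fun s => ρ s x) t + deriv (fun y => ρ t y * u t y) x = 0
  momentum : ∀ t x, 0 < t →
    deriv (fun s => ρ s x * u s x) t + deriv (fun y => ρ t y * u t y ^ 2 + p (ρ t y)) x
      = ε * iteratedDeriv 2 (u t) x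
  initial_rho : MemLp (fun x => ρ 0 x - ρbar x) 2 volume
  initial_u : MemLp (fun x => u 0 x - ubar x) 2 volume
  no_vacuum : ∀ T, 0 < T → ∃ c, 0 < c ∧ ∀ t ∈ Icc 0 T, ∀ x, c ≤ ρ t x
  bounded : ∀ T, 0 < T → ∃ C, ∀ t ∈ Icc 0 T, ∀ x, ρ t x ≤ C ∧ |u t x| ≤ C
  u_memLp : ∀ t, 0 < t → MemLp (fun x => u t x - ubar x) 2 volume
  u_deriv_memLp : ∀ t, 0 < t → MemLp (fun x => deriv (u t) x - deriv ubar x) 2 volume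
  tendsto_left : ∀ t, 0 ≤ t → Tendsto (ρ t) atBot (𝓝 ρl) ∧ Tendsto (u t) atBot (𝓝 ul)
  tendsto_right : ∀ t, 0 ≤ t → Tendsto (ρ t) atTop (𝓝 ρr) ∧ Tendsto (u t) atTop (𝓝 ur)

/-! ### Entropy kernel, entropy flux kernel and the weak entropy pair of a test function -/

/-- `χ(ρ,u,s)` is the entropy kernel: for every `s` it is the solution of
`χ_ρρ - k'(ρ)² χ_uu = 0` for `ρ > 0`, `χ|_{ρ=0} = 0`, `χ_ρ|_{ρ=0} = δ_{u=s}`,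
where `k'(ρ)² = p'(ρ)/ρ²`. It is a function, continuous in `(u,s)`; the equation and the initial
conditions hold in the sense of distributions in the variable `u`, i.e. after pairing with an
arbitrary test function `φ(u)`. -/
structure IsEntropyKernel (p : ℝ → ℝ) (χ : ℝ → ℝ → ℝ → ℝ) : Prop where
  continuous : ∀ ρ, 0 < ρ → Continuous fun z : ℝ × ℝ => χ ρ z.1 z.2
  differentiable : ∀ (s : ℝ) (φ : ℝ → ℝ), ContDiff ℝ ∞ φ → HasCompactSupport φ →
    ∀ ρ, 0 < ρ → DifferentiableAt ℝ (fun r => ∫ u, χ r u s * φ u) ρ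
  equation : ∀ (s : ℝ) (φ : ℝ → ℝ), ContDiff ℝ ∞ φ → HasCompactSupport φ →
    ∀ ρ, 0 < ρ → HasDerivAt (deriv fun r => ∫ u, χ r u s * φ u)
      (deriv p ρ / ρ ^ 2 * ∫ u, χ ρ u s * iteratedDeriv 2 φ u) ρ
  initial : ∀ (s : ℝ) (φ : ℝ → ℝ), ContDiff ℝ ∞ φ → HasCompactSupport φ →
    Tendsto (fun r => ∫ u, χ r u s * φ u) (𝓝[>] 0) (𝓝 0)
  initial_deriv : ∀ (s : ℝ) (φ : ℝ → ℝ), ContDiff ℝ ∞ φ → HasCompactSupport φ →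
    Tendsto (deriv fun r => ∫ u, χ r u s * φ u) (𝓝[>] 0) (𝓝 (φ s))

/-- `σ(ρ,u,s)` is the entropy flux kernel associated with the entropy kernel `χ`: for every `s`,
`h = σ - uχ` is the solution of `h_ρρ - k'(ρ)² h_uu = (p''(ρ)/ρ) χ_u` for `ρ > 0`,
`h|_{ρ=0} = 0`, `h_ρ|_{ρ=0} = 0`, in the same sense as for the entropy kernel. -/
structure IsEntropyFluxKernel (p : ℝ → ℝ) (χ σ : ℝ → ℝ → ℝ → ℝ) : Prop where
  continuous : ∀ ρ, 0 < ρ → Continuous fun z : ℝ × ℝ => σ ρ z.1 z.2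
  differentiable : ∀ (s : ℝ) (φ : ℝ → ℝ), ContDiff ℝ ∞ φ → HasCompactSupport φ →
    ∀ ρ, 0 < ρ → DifferentiableAt ℝ (fun r => ∫ u, (σ r u s - u * χ r u s) * φ u) ρ
  equation : ∀ (s : ℝ) (φ : ℝ → ℝ), ContDiff ℝ ∞ φ → HasCompactSupport φ →
    ∀ ρ, 0 < ρ → HasDerivAt (deriv fun r => ∫ u, (σ r u s - u * χ r u s) * φ u)
      (deriv p ρ / ρ ^ 2 * (∫ u, (σ ρ u s - u * χ ρ u s) * iteratedDeriv 2 φ u)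
        - deriv (deriv p) ρ / ρ * ∫ u, χ ρ u s * deriv φ u) ρ
  initial : ∀ (s : ℝ) (φ : ℝ → ℝ), ContDiff ℝ ∞ φ → HasCompactSupport φ →
    Tendsto (fun r => ∫ u, (σ r u s - u * χ r u s) * φ u) (𝓝[>] 0) (𝓝 0)
  initial_deriv : ∀ (s : ℝ) (φ : ℝ → ℝ), ContDiff ℝ ∞ φ → HasCompactSupport φ →
    Tendsto (deriv fun r => ∫ u, (σ r u s - u * χ r u s) * φ u) (𝓝[>] 0) (𝓝 0)

/-- The function `K^ψ(ρ,u) = ∫ ψ(s) K(ρ,u,s) ds` generated by `ψ`: the weak entropy `η^ψ` when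
`K` is the entropy kernel `χ`, and its entropy flux `q^ψ` when `K` is the flux kernel `σ`. -/
noncomputable def generatedFunction (K : ℝ → ℝ → ℝ → ℝ) (ψ : ℝ → ℝ) (ρ u : ℝ) : ℝ :=
  ∫ s, ψ s * K ρ u s

/-! ### Distributions on the half-plane and negative Sobolev spaces -/

/-- `ℝ²₊ = (0,∞) × ℝ`, the set of all `(t,x)` with `t > 0`. -/
def halfPlane : TopologicalSpace.Opens (ℝ × ℝ) where
  carrier := {z | 0 < z.1}
  is_open' := isOpen_lt continuous_const continuous_fst

/-- The distribution `φ ↦ ∫ φ f` on the half-plane given by a locally integrable function. -/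
noncomputable def toDistribution (f : ℝ × ℝ → ℝ) : 𝓓'(halfPlane, ℝ) :=
  UniformConvergenceCLM.ofFun (RingHom.id ℝ) ℝ _
    (TestFunction.integralAgainstBilinCLM (ContinuousLinearMap.mul ℝ ℝ) volume f)

/-- The distribution `η^ψ(ρ,u)_t + q^ψ(ρ,u)_x` on the half-plane. -/
noncomputable def entropyDissipation (χ σ : ℝ → ℝ → ℝ → ℝ) (ψ : ℝ → ℝ) (ρ u : ℝ → ℝ → ℝ) :
    𝓓'(halfPlane, ℝ) :=
  ∂_{((1, 0) : ℝ × ℝ)} (toDistribution fun z => generatedFunction χ ψ (ρ z.1 z.2) (u z.1 z.2))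
    + ∂_{((0, 1) : ℝ × ℝ)} (toDistribution fun z => generatedFunction σ ψ (ρ z.1 z.2) (u z.1 z.2))

/-- The `W^{1,r}` norm of a test function. -/
noncomputable def sobolevNorm (r : ENNReal) (φ : 𝓓(halfPlane, ℝ)) : ENNReal :=
  eLpNorm φ r volume + eLpNorm (∂_{((1, 0) : ℝ × ℝ)} φ : 𝓓(halfPlane, ℝ)) r volume
    + eLpNorm (∂_{((0, 1) : ℝ × ℝ)} φ : 𝓓(halfPlane, ℝ)) r volume

/-- The norm of (the restriction to the open set `U` of) a distribution in `W^{-1,q}(U)`, the dual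
of `W₀^{1,q'}(U)`, the closure of `C_c^∞(U)` in the `W^{1,q'}` norm, where `q' = q/(q-1)`.
It is infinite if the restriction is not in `W^{-1,q}(U)`. -/
noncomputable def negSobolevNorm (q : ℝ) (U : Set (ℝ × ℝ)) (T : 𝓓'(halfPlane, ℝ)) : ENNReal :=
  ⨆ (φ : 𝓓(halfPlane, ℝ)) (_ : tsupport φ ⊆ U)
    (_ : sobolevNorm (ENNReal.ofReal (q / (q - 1))) φ ≤ 1), ‖T φ‖ₑ

/-- `U` is open and its closure is a compact subset of the half-plane. -/
def CompactlyInside (U : Set (ℝ × ℝ)) : Prop :=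
  IsOpen U ∧ IsCompact (closure U) ∧ closure U ⊆ (halfPlane : Set (ℝ × ℝ))

/-- `T ∈ W^{-1,q}_loc(ℝ²₊)`. -/
def MemNegSobolevLoc (q : ℝ) (T : 𝓓'(halfPlane, ℝ)) : Prop :=
  ∀ U, CompactlyInside U → negSobolevNorm q U T < ⊤

/-- The set `S` of distributions is contained and precompact in `W^{-1,q}_loc(ℝ²₊)`: every sequence
in `S` has a subsequence that converges in `W^{-1,q}_loc(ℝ²₊)`. (The topology of
`W^{-1,q}_loc(ℝ²₊)` is metrizable, being given by countably many of the seminorms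
`‖·‖_{W^{-1,q}(U)}`.) -/
def IsPrecompactNegSobolevLoc (q : ℝ) (S : Set 𝓓'(halfPlane, ℝ)) : Prop :=
  (∀ T ∈ S, MemNegSobolevLoc q T) ∧
  ∀ T : ℕ → 𝓓'(halfPlane, ℝ), (∀ k, T k ∈ S) →
    ∃ j : ℕ → ℕ, StrictMono j ∧ ∃ L : 𝓓'(halfPlane, ℝ), MemNegSobolevLoc q L ∧
      ∀ U, CompactlyInside U →
        Tendsto (fun k => negSobolevNorm q U (T (j k) - L)) atTop (𝓝 0)

/-! Let `(η, q)` be the pair generated by `ψ` and put `β = η_u / ρ`. Multiplying the mass equation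
by `η_ρ` and the nonconservative momentum equation by `β` gives `η_t + q_x = ε (β u_x)_x - ε (β_ρ
ρ_x + β_u u_x) u_x`. Three facts make the right-hand side precompact.

(1) Kernel estimates: `|β|, |β_u| ≤ C` and `|β_ρ| ≤ C √p'(ρ)/ρ` for all `ρ > 0`, with `C` controlled
by the `C²` norm of `ψ`. If `ζ` solves the entropy equation, `w = ζ/ρ` satisfies `(ρ² w_ρ)_ρ = p'
w_uu`. The quantities `ρ w_ρ/√p' ± w_u` are damped along the two families of characteristics, at the
rate `(log (ρ√p'))'`, which is positive by genuine nonlinearity. A maximum principle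
(`abs_le_of_damped_characteristics`) therefore bounds them by the data at the vacuum
(`IsWaveFamily.abs_le_of_abs_data_le`). The same estimate gives uniqueness, hence Galilean
invariance of the kernels and the relations `h_ρ = p' χ_u/ρ`, `h_u = ρ χ_ρ - χ`, which say that `(η,
q)` is an entropy pair. The kernels solve their equations only in the sense of distributions in `u`,
so the argument runs on their mollifications; local uniformity in `u` comes from Banach-Steinhaus. A
`ψ` that is only `C²` is reached by approximation (`exists_dissipation_representation`).

(2) Energy: the effective velocity `u + ε ρ_x/ρ²` feels the same pressure force as `u`, but no
viscosity. Adding the energies of both velocities relative to `(ρbar, ubar)` produces the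
dissipation `ε (u_x² + p' ρ_x²/ρ²)`, which is thus bounded in `L¹_loc` uniformly in `ε`
(`exists_uniform_dissipation_bound`). The balance is integrated against a cut-off which decreases
along cones, so no decay at infinity enters; the cone speed depends on `ε`, but it drops out of the
final bound.

(3) Compactness: by (1) and (2) the source `ε (β_ρ ρ_x + β_u u_x) u_x` is bounded in `L¹_loc`, while
`ε β u_x` is `O(√ε)` in `L²_loc`. For `q < 2` the dual exponent exceeds `2`, so Morrey's inequality
and Arzelà-Ascoli embed `W₀^{1,q'}` compactly in the continuous functions. Hence bounded measures
are precompact in `W^{-1,q}_loc`, and the derivative of the flux tends to zero there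
(`isPrecompactNegSobolevLoc_of_source_flux`). -/

/-! ### Elementary analysis on the half-line -/

/-- A power bound near the origin of a function continuous on `(0,∞)` extends to `(0,R]`. -/
theorem ContinuousOn.exists_abs_le_mul_rpow {F : ℝ → ℝ} (hF : ContinuousOn F (Ioi 0)) {a r₁ C₁ : ℝ}
    (hr₁ : 0 < r₁) (h₁ : ∀ ρ ∈ Ioo 0 r₁, |F ρ| ≤ C₁ * ρ ^ a) (R : ℝ) :
    ∃ C, 0 ≤ C ∧ ∀ ρ ∈ Ioc 0 R, |F ρ| ≤ C * ρ ^ a := by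
  have hcont : ContinuousOn (fun ρ => |F ρ| / ρ ^ a) (Icc (r₁ / 2) R) := by
    refine ContinuousOn.div ?_ ?_ ?_
    · exact (hF.mono fun x hx => lt_of_lt_of_le (half_pos hr₁) hx.1).abs
    · exact fun x hx => (Real.continuousAt_rpow_const _ _
        (Or.inl (lt_of_lt_of_le (half_pos hr₁) hx.1).ne')).continuousWithinAt
    · exact fun x hx => (Real.rpow_pos_of_pos (lt_of_lt_of_le (half_pos hr₁) hx.1) _).ne'
  obtain ⟨C₂, hC₂⟩ := isCompact_Icc.exists_bound_of_continuousOn hcont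
  refine ⟨max 0 (max C₁ C₂), le_max_left _ _, fun ρ hρ => ?_⟩
  have hpos : 0 < ρ ^ a := Real.rpow_pos_of_pos hρ.1 _
  rcases lt_or_ge ρ r₁ with h | h
  · refine (h₁ ρ ⟨hρ.1, h⟩).trans (mul_le_mul_of_nonneg_right ?_ hpos.le)
    exact (le_max_left _ _).trans (le_max_right _ _)
  · have h2 := hC₂ ρ ⟨by linarith, hρ.2⟩
    rw [Real.norm_eq_abs] at h2
    have h3 := (div_le_iff₀ hpos).1 ((le_abs_self _).trans h2)
    refine h3.trans (mul_le_mul_of_nonneg_right ?_ hpos.le)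
    exact (le_max_right _ _).trans (le_max_right _ _)

/-- Integration of a power bound of the derivative from the origin. -/
theorem abs_sub_le_of_abs_deriv_le_rpow {g g' : ℝ → ℝ} {R C δ l : ℝ} (hδ : 0 < δ)
    (hg : ∀ r ∈ Ioc 0 R, HasDerivAt g (g' r) r) (hb : ∀ r ∈ Ioc 0 R, |g' r| ≤ C * r ^ (δ - 1))
    (hl : Tendsto g (𝓝[>] 0) (𝓝 l)) {r : ℝ} (hr : r ∈ Ioc 0 R) :
    |g r - l| ≤ C / δ * r ^ δ := by
  have hpow : ∀ s : ℝ, 0 < s → HasDerivAt (fun s => C / δ * s ^ δ) (C * s ^ (δ - 1)) s := by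
    intro s hs
    have := (Real.hasDerivAt_rpow_const (p := δ) (Or.inl hs.ne')).const_mul (C / δ)
    refine this.congr_deriv ?_
    rw [← mul_assoc, div_mul_cancel₀ _ hδ.ne']
  have hpow0 : Tendsto (fun s : ℝ => C / δ * s ^ δ) (𝓝[>] 0) (𝓝 0) := by
    have : Tendsto (fun s : ℝ => C / δ * s ^ δ) (𝓝 0) (𝓝 (C / δ * 0 ^ δ)) :=
      ((Real.continuousAt_rpow_const 0 δ (Or.inr hδ.le)).tendsto).const_mul _
    rw [Real.zero_rpow hδ.ne', mul_zero] at this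
    exact this.mono_left nhdsWithin_le_nhds
  have hev : ∀ᶠ s in 𝓝[>] (0 : ℝ), s ∈ Ioc 0 r :=
    Ioc_mem_nhdsGT hr.1
  have key : ∀ σ : ℝ, (σ = 1 ∨ σ = -1) → σ * (g r - l) ≤ C / δ * r ^ δ := by
    intro σ hσ
    -- Comparison with the primitive of the bound on `(0, r]` only; the value of `g` at `0` plays no
    -- role, just its right limit.
    have hmono : MonotoneOn (fun s => C / δ * s ^ δ - σ * g s) (Ioc 0 r) := by
      have hd : ∀ s ∈ Ioc 0 r, HasDerivAt (fun s => C / δ * s ^ δ - σ * g s)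
          (C * s ^ (δ - 1) - σ * g' s) s := fun s hs =>
        (hpow s hs.1).sub ((hg s ⟨hs.1, hs.2.trans hr.2⟩).const_mul σ)
      refine monotoneOn_of_deriv_nonneg (convex_Ioc 0 r)
        (fun s hs => (hd s hs).continuousAt.continuousWithinAt)
        (fun s hs => (hd s (interior_subset hs)).differentiableAt.differentiableWithinAt) ?_
      intro s hs
      have hs' := interior_subset hs
      rw [(hd s hs').deriv]
      have := abs_le.1 (hb s ⟨hs'.1, hs'.2.trans hr.2⟩)
      rcases hσ with rfl | rfl <;> linarith [this.1, this.2]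
    have hlim : Tendsto (fun s => C / δ * s ^ δ - σ * g s) (𝓝[>] 0) (𝓝 (0 - σ * l)) :=
      hpow0.sub (hl.const_mul σ)
    have hle : 0 - σ * l ≤ C / δ * r ^ δ - σ * g r := by
      refine le_of_tendsto hlim ?_
      filter_upwards [hev] with s hs
      exact hmono hs ⟨hr.1, le_rfl⟩ hs.2
    linarith
  rw [abs_le]
  constructor
  · linarith [key (-1) (Or.inr rfl)]
  · linarith [key 1 (Or.inl rfl)]

theorem tendsto_rpow_nhdsGT_zero {a : ℝ} (ha : 0 < a) :
    Tendsto (fun s : ℝ => s ^ a) (𝓝[>] 0) (𝓝 0) := by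
  have := (Real.continuousAt_rpow_const 0 a (Or.inr ha.le)).tendsto
  rw [Real.zero_rpow ha.ne'] at this
  exact this.mono_left nhdsWithin_le_nhds

namespace IsPressureLaw

variable {p : ℝ → ℝ} {γ κ ρs cs M : ℝ}

theorem contDiffAt (hp : IsPressureLaw p γ κ ρs cs M) {ρ : ℝ} (hρ : 0 < ρ) : ContDiffAt ℝ 2 p ρ :=
  hp.contDiffOn.contDiffAt (Ioi_mem_nhds hρ)

theorem hasDerivAt (hp : IsPressureLaw p γ κ ρs cs M) {ρ : ℝ} (hρ : 0 < ρ) :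
    HasDerivAt p (deriv p ρ) ρ :=
  ((hp.contDiffAt hρ).differentiableAt (by norm_num)).hasDerivAt

theorem contDiffOn_deriv (hp : IsPressureLaw p γ κ ρs cs M) :
    ContDiffOn ℝ 1 (deriv p) (Ioi 0) := by
  have := (contDiffOn_succ_iff_deriv_of_isOpen (n := 1) (f := p) isOpen_Ioi).1
    (by simpa [one_add_one_eq_two] using hp.contDiffOn)
  exact this.2.2

theorem hasDerivAt_deriv (hp : IsPressureLaw p γ κ ρs cs M) {ρ : ℝ} (hρ : 0 < ρ) :
    HasDerivAt (deriv p) (deriv (deriv p) ρ) ρ :=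
  ((hp.contDiffOn_deriv.contDiffAt (Ioi_mem_nhds hρ)).differentiableAt (by norm_num)).hasDerivAt

theorem continuousOn_deriv (hp : IsPressureLaw p γ κ ρs cs M) : ContinuousOn (deriv p) (Ioi 0) :=
  hp.contDiffOn_deriv.continuousOn

theorem continuousOn_deriv_deriv (hp : IsPressureLaw p γ κ ρs cs M) :
    ContinuousOn (deriv (deriv p)) (Ioi 0) :=
  ((contDiffOn_succ_iff_deriv_of_isOpen (n := 0) (f := deriv p) isOpen_Ioi).1
    (by simpa using hp.contDiffOn_deriv)).2.2.continuousOn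

theorem continuousOn (hp : IsPressureLaw p γ κ ρs cs M) : ContinuousOn p (Ioi 0) :=
  hp.contDiffOn.continuousOn

/-- Leibniz rule, arranged in the scale-invariant combinations `ρ P'` and `ρ² P''`, all of which are
`O(ρ^(γ-1))`. The interval is open at `ρs` because one-sided derivatives of `P` agree with two-sided
ones only in the interior. -/
theorem low_density_expansion (hp : IsPressureLaw p γ κ ρs cs M) :
    ∃ P P₁ P₂ : ℝ → ℝ, ∀ ρ ∈ Ioo 0 ρs,
      |P ρ| ≤ M * ρ ^ (γ - 1) ∧ |ρ * P₁ ρ| ≤ M * ρ ^ (γ - 1) ∧ |ρ ^ 2 * P₂ ρ| ≤ M * ρ ^ (γ - 1) ∧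
      p ρ = κ * ρ ^ γ * (1 + P ρ) ∧
      deriv p ρ = κ * ρ ^ (γ - 1) * (γ * (1 + P ρ) + ρ * P₁ ρ) ∧
      deriv (deriv p) ρ = κ * ρ ^ (γ - 2) *
        (γ * (γ - 1) * (1 + P ρ) + 2 * γ * (ρ * P₁ ρ) + ρ ^ 2 * P₂ ρ) := by
  obtain ⟨P, hP, hpP, hb⟩ := hp.low_density
  set s := Ioc 0 ρs
  have hs : UniqueDiffOn ℝ s := uniqueDiffOn_Ioc 0 ρs
  have hnhds : ∀ ρ ∈ Ioo 0 ρs, s ∈ 𝓝 ρ := fun ρ hρ => Ioc_mem_nhds hρ.1 hρ.2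
  have hPd : ∀ ρ ∈ Ioo 0 ρs, HasDerivAt P (derivWithin P s ρ) ρ := fun ρ hρ =>
    ((hP.differentiableOn (by norm_num)) ρ ⟨hρ.1, hρ.2.le⟩).hasDerivWithinAt.hasDerivAt (hnhds ρ hρ)
  have hPd2 : ∀ ρ ∈ Ioo 0 ρs,
      HasDerivAt (derivWithin P s) (derivWithin (derivWithin P s) s ρ) ρ := fun ρ hρ =>
    (((hP.derivWithin (m := 1) hs (by norm_num)).differentiableOn (by norm_num)) ρ
      ⟨hρ.1, hρ.2.le⟩).hasDerivWithinAt.hasDerivAt (hnhds ρ hρ)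
  have hpow : ∀ ρ : ℝ, 0 < ρ → ∀ a, HasDerivAt (fun ρ : ℝ => ρ ^ a) (a * ρ ^ (a - 1)) ρ :=
    fun ρ hρ a => Real.hasDerivAt_rpow_const (Or.inl hρ.ne')
  have e1 : ∀ ρ : ℝ, 0 < ρ → ∀ a : ℝ, ρ ^ a = ρ * ρ ^ (a - 1) := by
    intro ρ hρ a
    rw [Real.rpow_sub_one hρ.ne']; field_simp
  have hd1 : ∀ ρ ∈ Ioo 0 ρs,
      deriv p ρ = κ * ρ ^ (γ - 1) * (γ * (1 + P ρ) + ρ * derivWithin P s ρ) := by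
    intro ρ hρ
    have h1 : p =ᶠ[𝓝 ρ] fun ρ => κ * ρ ^ γ * (1 + P ρ) := by
      filter_upwards [Ioo_mem_nhds hρ.1 hρ.2] with r hr
      exact hpP r ⟨hr.1.le, hr.2.le⟩
    rw [h1.deriv_eq, (((hpow ρ hρ.1 γ).const_mul κ).fun_mul ((hPd ρ hρ).const_add 1)).deriv,
      e1 ρ hρ.1 γ]
    ring
  refine ⟨P, derivWithin P s, derivWithin (derivWithin P s) s, fun ρ hρ => ?_⟩
  have hρ' : ρ ∈ s := ⟨hρ.1, hρ.2.le⟩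
  have b0 := hb 0 (by norm_num) ρ hρ'
  have b1 := hb 1 (by norm_num) ρ hρ'
  have b2 := hb 2 (by norm_num) ρ hρ'
  simp only [iteratedDerivWithin_zero, iteratedDerivWithin_one] at b0 b1
  rw [iteratedDerivWithin_succ] at b2
  have h2 : derivWithin (iteratedDerivWithin 1 P s) s ρ
      = derivWithin (derivWithin P s) s ρ := by
    congr 1
    exact iteratedDerivWithin_one
  rw [h2] at b2
  refine ⟨by simpa using b0, ?_, ?_, hpP ρ ⟨hρ.1.le, hρ.2.le⟩, hd1 ρ hρ, ?_⟩
  · rw [abs_mul, abs_of_pos hρ.1]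
    calc ρ * |derivWithin P s ρ| ≤ ρ * (M * ρ ^ (γ - 1 - (1 : ℕ))) :=
          mul_le_mul_of_nonneg_left b1 hρ.1.le
      _ = M * ρ ^ (γ - 1) := by
          rw [e1 ρ hρ.1 (γ - 1)]; push_cast; ring
  · rw [abs_mul, abs_of_pos (pow_pos hρ.1 2)]
    calc ρ ^ 2 * |derivWithin (derivWithin P s) s ρ| ≤ ρ ^ 2 * (M * ρ ^ (γ - 1 - (2 : ℕ))) :=
          mul_le_mul_of_nonneg_left b2 (pow_pos hρ.1 2).le
      _ = M * ρ ^ (γ - 1) := by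
          rw [e1 ρ hρ.1 (γ - 1), e1 ρ hρ.1 (γ - 1 - 1)]; push_cast
          rw [show γ - 1 - 1 - 1 = γ - 1 - 2 by ring]; ring
  · have h1 : deriv p =ᶠ[𝓝 ρ]
        fun ρ => κ * ρ ^ (γ - 1) * (γ * (1 + P ρ) + ρ * derivWithin P s ρ) := by
      filter_upwards [Ioo_mem_nhds hρ.1 hρ.2] with r hr
      exact hd1 r hr
    have := ((hpow ρ hρ.1 (γ - 1)).const_mul κ).fun_mul
      ((((hPd ρ hρ).const_add 1).const_mul γ).fun_add ((hasDerivAt_id' ρ).fun_mul (hPd2 ρ hρ)))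
    rw [h1.deriv_eq, this.deriv, e1 ρ hρ.1 (γ - 1)]
    rw [show γ - 1 - 1 = γ - 2 by ring]
    ring

theorem abs_le_rpow (hp : IsPressureLaw p γ κ ρs cs M) (R : ℝ) :
    ∃ C, 0 ≤ C ∧ ∀ ρ ∈ Ioc 0 R, |p ρ| ≤ C * ρ ^ γ ∧ |deriv p ρ| ≤ C * ρ ^ (γ - 1) ∧
      |deriv (deriv p) ρ| ≤ C * ρ ^ (γ - 2) := by
  obtain ⟨P, P₁, P₂, h⟩ := hp.low_density_expansion
  set M' := |M| * ρs ^ (γ - 1)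
  have hM' : ∀ ρ ∈ Ioo 0 ρs, M * ρ ^ (γ - 1) ≤ M' := by
    intro ρ hρ
    refine mul_le_mul (le_abs_self M) ?_ (Real.rpow_nonneg hρ.1.le _) (abs_nonneg M)
    exact Real.rpow_le_rpow hρ.1.le hρ.2.le (by linarith [hp.one_lt_gamma])
  have hγ := hp.one_lt_gamma
  have hκ := hp.kappa_pos
  obtain ⟨C₀, hC₀, h₀⟩ := hp.continuousOn.exists_abs_le_mul_rpow (a := γ) (C₁ := κ * (1 + M'))
    hp.rho_star_pos (by
      intro ρ hρ
      obtain ⟨h0, -, -, h1, -, -⟩ := h ρ hρ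
      have hr := Real.rpow_pos_of_pos hρ.1 γ
      rw [h1, abs_mul, abs_of_pos (by positivity)]
      have : |1 + P ρ| ≤ 1 + M' := (abs_add_le _ _).trans (by
        rw [abs_one]; linarith [hM' ρ hρ])
      calc κ * ρ ^ γ * |1 + P ρ| ≤ κ * ρ ^ γ * (1 + M') := by gcongr
        _ = _ := by ring) R
  obtain ⟨C₁, hC₁, h₁⟩ := hp.continuousOn_deriv.exists_abs_le_mul_rpow (a := γ - 1)
    (C₁ := κ * (γ * (1 + M') + M')) hp.rho_star_pos (by
      intro ρ hρ
      obtain ⟨h0, h2, -, -, h1, -⟩ := h ρ hρ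
      have hr := Real.rpow_pos_of_pos hρ.1 (γ - 1)
      rw [h1, abs_mul, abs_of_pos (by positivity)]
      have h4 := abs_le.1 h0
      have h5 := abs_le.1 h2
      have h6 := hM' ρ hρ
      have : |γ * (1 + P ρ) + ρ * P₁ ρ| ≤ γ * (1 + M') + M' := by
        rw [abs_le]; constructor <;> nlinarith [h4.1, h4.2, h5.1, h5.2]
      calc κ * ρ ^ (γ - 1) * |γ * (1 + P ρ) + ρ * P₁ ρ|
          ≤ κ * ρ ^ (γ - 1) * (γ * (1 + M') + M') := by gcongr
        _ = _ := by ring) R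
  obtain ⟨C₂, hC₂, h₂⟩ := hp.continuousOn_deriv_deriv.exists_abs_le_mul_rpow (a := γ - 2)
    (C₁ := κ * (γ * (γ - 1) * (1 + M') + 2 * γ * M' + M')) hp.rho_star_pos (by
      intro ρ hρ
      obtain ⟨h0, h2, h3, -, -, h1⟩ := h ρ hρ
      have hr := Real.rpow_pos_of_pos hρ.1 (γ - 2)
      rw [h1, abs_mul, abs_of_pos (by positivity)]
      have h6 := hM' ρ hρ
      have hg : 0 < γ * (γ - 1) := by nlinarith
      have h7 : |γ * (γ - 1) * (1 + P ρ)| ≤ γ * (γ - 1) * (1 + M') := by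
        rw [abs_mul, abs_of_pos hg]
        refine mul_le_mul_of_nonneg_left ((abs_add_le _ _).trans ?_) hg.le
        rw [abs_one]; linarith
      have h8 : |2 * γ * (ρ * P₁ ρ)| ≤ 2 * γ * M' := by
        rw [abs_mul, abs_of_pos (show 0 < 2 * γ by linarith)]
        exact mul_le_mul_of_nonneg_left (by linarith) (by linarith)
      have : |γ * (γ - 1) * (1 + P ρ) + 2 * γ * (ρ * P₁ ρ) + ρ ^ 2 * P₂ ρ|
          ≤ γ * (γ - 1) * (1 + M') + 2 * γ * M' + M' :=
        (abs_add_le _ _).trans (add_le_add ((abs_add_le _ _).trans (add_le_add h7 h8))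
          (h3.trans h6))
      calc κ * ρ ^ (γ - 2) * |γ * (γ - 1) * (1 + P ρ) + 2 * γ * (ρ * P₁ ρ) + ρ ^ 2 * P₂ ρ|
          ≤ κ * ρ ^ (γ - 2) * (γ * (γ - 1) * (1 + M') + 2 * γ * M' + M') := by gcongr
        _ = _ := by ring) R
  refine ⟨max C₀ (max C₁ C₂), le_max_of_le_left hC₀, fun ρ hρ => ⟨(h₀ ρ hρ).trans ?_,
    (h₁ ρ hρ).trans ?_, (h₂ ρ hρ).trans ?_⟩⟩ <;>
  · refine mul_le_mul_of_nonneg_right ?_ (Real.rpow_nonneg hρ.1.le _)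
    simp

/-- The lower bound permits division by `√p'` near the vacuum, where the invariant `ρ w_ρ / √p'` has
to be shown to tend to zero. -/
theorem exists_rpow_le_deriv (hp : IsPressureLaw p γ κ ρs cs M) :
    ∃ c r₀, 0 < c ∧ 0 < r₀ ∧ ∀ ρ ∈ Ioc 0 r₀, c * ρ ^ (γ - 1) ≤ deriv p ρ := by
  obtain ⟨P, P₁, P₂, h⟩ := hp.low_density_expansion
  have hγ := hp.one_lt_gamma
  have hκ := hp.kappa_pos
  -- `γ |P| + |ρ P'| ≤ (γ + 1) M ρ^(γ-1)`, so half of the leading coefficient `γ` survives as soon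
  -- as this is below `γ / 2`.
  have ht : Tendsto (fun s : ℝ => (γ + 1) * (M * s ^ (γ - 1))) (𝓝[>] 0) (𝓝 ((γ + 1) * (M * 0))) :=
    ((tendsto_rpow_nhdsGT_zero (by linarith)).const_mul M).const_mul _
  rw [mul_zero, mul_zero] at ht
  have hev : ∀ᶠ s in 𝓝[>] (0 : ℝ), (γ + 1) * (M * s ^ (γ - 1)) < γ / 2 ∧ s < ρs :=
    (ht.eventually (gt_mem_nhds (by linarith))).and
      (nhdsWithin_le_nhds (Iio_mem_nhds hp.rho_star_pos))
  obtain ⟨r, hr, hsub⟩ := (mem_nhdsGT_iff_exists_Ioo_subset).1 hev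
  rw [mem_Ioi] at hr
  refine ⟨κ * (γ / 2), r / 2, by positivity, by positivity, fun ρ hρ => ?_⟩
  obtain ⟨h1, h2⟩ := hsub (show ρ ∈ Ioo 0 r from ⟨hρ.1, by linarith [hρ.2]⟩)
  obtain ⟨b0, b1, -, -, h4, -⟩ := h ρ ⟨hρ.1, h2⟩
  rw [h4]
  have hrp := Real.rpow_pos_of_pos hρ.1 (γ - 1)
  have : γ / 2 ≤ γ * (1 + P ρ) + ρ * P₁ ρ := by
    nlinarith [(abs_le.1 b0).1, (abs_le.1 b1).1]
  calc κ * (γ / 2) * ρ ^ (γ - 1) = κ * ρ ^ (γ - 1) * (γ / 2) := by ring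
    _ ≤ _ := by gcongr

theorem tendsto_zero (hp : IsPressureLaw p γ κ ρs cs M) : Tendsto p (𝓝[>] 0) (𝓝 0) := by
  obtain ⟨C, -, hC⟩ := hp.abs_le_rpow 1
  refine squeeze_zero_norm' (a := fun s : ℝ => C * s ^ γ) ?_ ?_
  · filter_upwards [Ioc_mem_nhdsGT one_pos] with s hs using (hC s hs).1
  · simpa using (tendsto_rpow_nhdsGT_zero (by linarith [hp.one_lt_gamma] : 0 < γ)).const_mul C

theorem strictMonoOn (hp : IsPressureLaw p γ κ ρs cs M) : StrictMonoOn p (Ioi 0) :=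
  strictMonoOn_of_deriv_pos (convex_Ioi 0) hp.continuousOn (by
    intro x hx
    rw [interior_Ioi] at hx
    exact hp.strictly_hyperbolic x hx)

theorem nonneg (hp : IsPressureLaw p γ κ ρs cs M) {ρ : ℝ} (hρ : 0 < ρ) : 0 ≤ p ρ := by
  refine le_of_tendsto hp.tendsto_zero ?_
  filter_upwards [Ioc_mem_nhdsGT hρ] with s hs
  exact hp.strictMonoOn.monotoneOn hs.1 hρ hs.2

/-- The isothermal law at high density makes the pressure grow no faster than the density, hence no
faster than the relative energy. -/
theorem le_linear (hp : IsPressureLaw p γ κ ρs cs M) {ρ : ℝ} (hρ : 0 < ρ) :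
    p ρ ≤ cs * ρs + cs * ρ := by
  have h1 := hp.rho_star_pos
  have h2 := hp.c_star_pos
  rcases le_total ρ ρs with h | h
  · have := hp.strictMonoOn.monotoneOn hρ h1 h
    rw [hp.high_density ρs le_rfl] at this
    nlinarith
  · rw [hp.high_density ρ h]; nlinarith

/-- `ρ √p'(ρ)`, the square root of the weight in `(ρ² w_ρ)_ρ = p' w_uu`, is increasing by genuine
nonlinearity. -/
theorem hasDerivAt_mul_sqrt (hp : IsPressureLaw p γ κ ρs cs M) {ρ : ℝ} (hρ : 0 < ρ) :
    ∃ d, 0 < d ∧ HasDerivAt (fun r => r * √(deriv p r)) d ρ := by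
  have h1 := hp.strictly_hyperbolic ρ hρ
  have h2 := hp.genuinely_nonlinear ρ hρ
  have h3 := Real.sqrt_pos.2 h1
  refine ⟨_, ?_, (hasDerivAt_id ρ).mul ((hp.hasDerivAt_deriv hρ).sqrt h1.ne')⟩
  simp only [id]
  have : 1 * √(deriv p ρ) + ρ * (deriv (deriv p) ρ / (2 * √(deriv p ρ)))
      = (ρ * deriv (deriv p) ρ + 2 * deriv p ρ) / (2 * √(deriv p ρ)) := by
    field_simp
    rw [Real.sq_sqrt h1.le]; ring
  rw [this]
  positivity

/-- The antiderivative of `k'(ρ) = √p'(ρ) / ρ` vanishing at the vacuum. -/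
theorem exists_antideriv (hp : IsPressureLaw p γ κ ρs cs M) :
    ∃ k : ℝ → ℝ, (∀ ρ, 0 < ρ → 0 ≤ k ρ) ∧
      (∀ ρ, 0 < ρ → HasDerivAt k (√(deriv p ρ) / ρ) ρ) ∧ Tendsto k (𝓝[>] 0) (𝓝 0) := by
  have hγ := hp.one_lt_gamma
  have hcont : ContinuousOn (fun ρ => √(deriv p ρ) / ρ) (Ioi 0) :=
    (hp.continuousOn_deriv.sqrt).div continuousOn_id fun x hx => (mem_Ioi.1 hx).ne'
  have hint : ∀ R, 0 < R → IntervalIntegrable (fun ρ => √(deriv p ρ) / ρ) volume 0 R := by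
    intro R hR
    -- The integrand is `O(ρ^((γ-3)/2))`, and `(γ-3)/2 > -1` because `γ > 1`.
    obtain ⟨C, hC, hb⟩ := hp.abs_le_rpow R
    have h1 : IntervalIntegrable (fun ρ : ℝ => √C * ρ ^ ((γ - 3) / 2)) volume 0 R :=
      (intervalIntegral.intervalIntegrable_rpow' (by linarith)).const_mul _
    refine h1.mono_fun ?_ ?_
    · rw [uIoc_of_le hR.le]
      exact (hcont.mono Ioc_subset_Ioi_self).aestronglyMeasurable measurableSet_Ioc
    · rw [uIoc_of_le hR.le]
      refine (ae_restrict_mem measurableSet_Ioc).mono fun ρ hρ => ?_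
      have hpos := hρ.1
      beta_reduce
      rw [Real.norm_of_nonneg (by positivity), Real.norm_of_nonneg (by positivity)]
      have h2 : √(deriv p ρ) ≤ √C * ρ ^ ((γ - 1) / 2) := by
        rw [Real.sqrt_le_left (by positivity), mul_pow, Real.sq_sqrt hC, ← Real.rpow_natCast,
          ← Real.rpow_mul hpos.le]
        refine ((le_abs_self _).trans (hb ρ hρ).2.1).trans (le_of_eq ?_)
        congr 2; push_cast; ring
      calc √(deriv p ρ) / ρ ≤ √C * ρ ^ ((γ - 1) / 2) / ρ := by gcongr
        _ = √C * ρ ^ ((γ - 3) / 2) := by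
          rw [mul_div_assoc, ← Real.rpow_sub_one hpos.ne']; congr 2; ring
  refine ⟨fun r => ∫ s in (0 : ℝ)..r, √(deriv p s) / s, fun ρ hρ => ?_, fun ρ hρ => ?_, ?_⟩
  · refine intervalIntegral.integral_nonneg hρ.le fun s hs => ?_
    have := hs.1
    positivity
  · exact intervalIntegral.integral_hasDerivAt_right (hint ρ hρ)
      (hcont.stronglyMeasurableAtFilter isOpen_Ioi ρ hρ)
      (hcont.continuousAt (Ioi_mem_nhds hρ))
  · have := intervalIntegral.continuousOn_primitive_interval
      (f := fun s => √(deriv p s) / s) (a := 0) (b := 1) (μ := volume)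
      (by rw [uIcc_of_le zero_le_one, integrableOn_Icc_iff_integrableOn_Ioc]
          exact (intervalIntegrable_iff_integrableOn_Ioc_of_le zero_le_one).1 (hint 1 one_pos))
    have h2 := this 0 left_mem_uIcc
    have h3 : Tendsto _ (𝓝[uIcc 0 1] (0 : ℝ)) _ := h2
    simp only [intervalIntegral.integral_same] at h3
    refine h3.mono_left ?_
    rw [uIcc_of_le zero_le_one]
    exact (nhdsWithin_le_iff).2 (mem_of_superset (Ioc_mem_nhdsGT one_pos) Ioc_subset_Icc_self)

end IsPressureLaw

/-! ### Uniform boundedness of mollified functions -/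

theorem ContDiff.exists_bound_iteratedFDeriv {φ : ℝ → ℝ} (hφ : ContDiff ℝ ∞ φ)
    (hc : HasCompactSupport φ) (k : ℕ) : ∃ B, 0 ≤ B ∧ ∀ x, ‖iteratedFDeriv ℝ k φ x‖ ≤ B := by
  have h1 : Continuous (iteratedFDeriv ℝ k φ) :=
    hφ.continuous_iteratedFDeriv (by exact_mod_cast le_top)
  obtain ⟨B, hB⟩ := h1.bounded_above_of_compact_support (hc.iteratedFDeriv (𝕜 := ℝ) k)
  exact ⟨B, (norm_nonneg _).trans (hB 0), hB⟩

theorem HasCompactSupport.exists_abs_le {φ : ℝ → ℝ} (hc : HasCompactSupport φ) :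
    ∃ R, 0 < R ∧ ∀ x, φ x ≠ 0 → |x| ≤ R := by
  obtain ⟨R, hR, h⟩ := hc.isCompact.isBounded.exists_pos_norm_le
  exact ⟨R, hR, fun x hx => h x (subset_tsupport _ hx)⟩

/-- The superposition of translates `∑ cₙ φ(· - uₙ)` with `c ∈ ℓ¹` and bounded `u` is a
test function. -/
theorem ContDiff.tsum_translates {φ : ℝ → ℝ} (hφ : ContDiff ℝ ∞ φ) (hc : HasCompactSupport φ)
    {u : ℕ → ℝ} {R : ℝ} (hu : ∀ n, |u n| ≤ R) {c : ℕ → ℝ} (hs : Summable fun n => |c n|) :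
    ContDiff ℝ ∞ (fun v => ∑' n, c n * φ (v - u n)) ∧
      HasCompactSupport (fun v => ∑' n, c n * φ (v - u n)) := by
  choose B hB0 hB using hφ.exists_bound_iteratedFDeriv hc
  constructor
  · refine contDiff_tsum (v := fun k n => |c n| * B k) (N := (⊤ : ℕ∞)) ?_ ?_ ?_
    · intro n
      exact contDiff_const.mul (hφ.comp (contDiff_id.sub contDiff_const))
    · intro k _
      exact hs.mul_right _
    · intro k n x _
      have h1 : iteratedFDeriv ℝ k (fun v => c n * φ (v - u n)) x
          = c n • iteratedFDeriv ℝ k (fun v => φ (v - u n)) x := by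
        have h2 : ContDiff ℝ ∞ (fun v => φ (v - u n)) :=
          hφ.comp (contDiff_id.sub contDiff_const)
        exact iteratedFDeriv_const_smul_apply (a := c n)
          ((h2.of_le (by exact_mod_cast le_top)).contDiffAt)
      rw [h1, norm_smul, iteratedFDeriv_comp_sub, Real.norm_eq_abs]
      exact mul_le_mul_of_nonneg_left (hB k _) (abs_nonneg _)
  · obtain ⟨r, hr, h⟩ := hc.exists_abs_le
    refine HasCompactSupport.intro (isCompact_Icc (a := -(R + r)) (b := R + r)) fun v hv => ?_
    have : ∀ n, c n * φ (v - u n) = 0 := by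
      intro n
      by_contra hne
      have h1 := abs_le.1 (h _ (right_ne_zero_of_mul hne))
      have h2 := abs_le.1 (hu n)
      exact hv ⟨by linarith [h1.1, h2.1], by linarith [h1.2, h2.2]⟩
    simp [this]

/-- All translates by `|u n| ≤ R` live on one compact interval, so a single integrable function
dominates them and sum and integral may be exchanged. -/
theorem integral_mul_tsum_translates {D φ : ℝ → ℝ} (hD : Continuous D) (hφ : Continuous φ)
    (hc : HasCompactSupport φ) {u : ℕ → ℝ} {R : ℝ} (hu : ∀ n, |u n| ≤ R) :
    (∃ C, 0 ≤ C ∧ ∀ n, |∫ v, D v * φ (v - u n)| ≤ C) ∧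
    ∀ c : ℕ → ℝ, Summable (fun n => |c n|) →
      ∫ v, D v * ∑' n, c n * φ (v - u n) = ∑' n, c n * ∫ v, D v * φ (v - u n) := by
  obtain ⟨r, hr, h⟩ := hc.exists_abs_le
  obtain ⟨B, hB⟩ := hφ.bounded_above_of_compact_support hc
  have hB0 : 0 ≤ B := (norm_nonneg _).trans (hB 0)
  set K := Icc (-(R + r)) (R + r)
  have hz : ∀ n v, v ∉ K → D v * φ (v - u n) = 0 := by
    intro n v hv
    by_contra hne
    have h1 := abs_le.1 (h _ (right_ne_zero_of_mul hne))
    have h2 := abs_le.1 (hu n)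
    exact hv ⟨by linarith [h1.1, h2.1], by linarith [h1.2, h2.2]⟩
  have hI : IntegrableOn (fun v => |D v| * B) K :=
    ((hD.abs).mul continuous_const).continuousOn.integrableOn_compact isCompact_Icc
  have hbd : ∀ n v, ‖D v * φ (v - u n)‖ ≤ K.indicator (fun v => |D v| * B) v := by
    intro n v
    by_cases hv : v ∈ K
    · rw [indicator_of_mem hv, norm_mul, Real.norm_eq_abs]
      exact mul_le_mul_of_nonneg_left (hB _) (abs_nonneg _)
    · rw [indicator_of_notMem hv, hz n v hv, norm_zero]
  have hI' : Integrable (K.indicator fun v => |D v| * B) := hI.integrable_indicator measurableSet_Icc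
  have hint : ∀ n, Integrable fun v => D v * φ (v - u n) := fun n =>
    hI'.mono' (hD.mul (hφ.comp (continuous_id.sub continuous_const))).aestronglyMeasurable
      (Eventually.of_forall (hbd n))
  set C := ∫ v, K.indicator (fun v => |D v| * B) v
  have hnorm : ∀ n, ∫ v, ‖D v * φ (v - u n)‖ ≤ C := fun n =>
    integral_mono (hint n).norm hI' (hbd n)
  refine ⟨⟨C, (integral_nonneg fun v => norm_nonneg _).trans (hnorm 0), fun n =>
    (norm_integral_le_integral_norm _).trans (hnorm n)⟩, fun c hs => ?_⟩
  have h1 : ∀ n, Integrable fun v => c n * (D v * φ (v - u n)) := fun n => (hint n).const_mul _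
  have h2 : Summable fun n => ∫ v, ‖c n * (D v * φ (v - u n))‖ := by
    refine Summable.of_nonneg_of_le (fun n => integral_nonneg fun v => norm_nonneg _) (fun n => ?_)
      (hs.mul_right C)
    simp_rw [norm_mul (c n)]
    rw [integral_const_mul]
    exact mul_le_mul_of_nonneg_left (hnorm n) (abs_nonneg _)
  have h3 := integral_tsum_of_summable_integral_norm h1 h2
  simp_rw [integral_const_mul] at h3
  rw [h3]
  congr 1
  ext v
  rw [← tsum_mul_left]
  congr 1
  ext n
  ring

/-- Bounds for each fixed test function become uniform over bounded translations by
Banach-Steinhaus. If they failed along translations `u n`, the functionals `c ↦ ∫ D i · ∑ cₙ φ(· -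
uₙ)` on `ℓ¹` would still be pointwise bounded, since each superposition is itself a test function;
but their norms would be unbounded. -/
theorem exists_bound_integral_mul_translate {I : Type*} {D : I → ℝ → ℝ}
    (hD : ∀ i, Continuous (D i))
    (hb : ∀ Φ : ℝ → ℝ, ContDiff ℝ ∞ Φ → HasCompactSupport Φ → ∃ C, ∀ i, |∫ v, D i v * Φ v| ≤ C)
    {φ : ℝ → ℝ} (hφ : ContDiff ℝ ∞ φ) (hc : HasCompactSupport φ) (R : ℝ) :
    ∃ C, ∀ i, ∀ u, |u| ≤ R → |∫ v, D i v * φ (u - v)| ≤ C := by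
  by_contra! hcon
  choose i u hu hlarge using fun n : ℕ => hcon n
  set φ' : ℝ → ℝ := fun x => φ (-x)
  have hφ' : ContDiff ℝ ∞ φ' := hφ.comp contDiff_neg
  have hc' : HasCompactSupport φ' := hc.comp_homeomorph (Homeomorph.neg ℝ)
  have hflip : ∀ j v, φ (u j - v) = φ' (v - u j) := fun j v => by simp [φ']
  simp_rw [hflip] at hlarge
  have hE : ∀ c : lp (fun _ : ℕ => ℝ) 1, Summable fun n => |c n| := fun c =>
    by simpa using (lp.memℓp c).summable (by simp)
  have hnorm : ∀ c : lp (fun _ : ℕ => ℝ) 1, ‖c‖ = ∑' n, |c n| := fun c => by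
    simp [lp.norm_eq_tsum_rpow (p := 1) (by simp)]
  have key := fun j => integral_mul_tsum_translates (hD j) hφ'.continuous hc' hu
  choose B hB0 hB using fun j => (key j).1
  have hsum : ∀ j, ∀ c : lp (fun _ : ℕ => ℝ) 1,
      Summable fun n => c n * ∫ v, D j v * φ' (v - u n) := fun j c =>
    Summable.of_norm_bounded ((hE c).mul_right (B j)) fun n => by
      rw [norm_mul]; exact mul_le_mul_of_nonneg_left (hB j n) (norm_nonneg _)
  let g : I → lp (fun _ : ℕ => ℝ) 1 →L[ℝ] ℝ := fun j =>
    LinearMap.mkContinuous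
      { toFun := fun c => ∑' n, c n * ∫ v, D j v * φ' (v - u n)
        map_add' := fun c d => by
          rw [← (hsum j c).tsum_add (hsum j d)]
          congr 1; ext n
          simp [add_mul]
        map_smul' := fun a c => by
          rw [RingHom.id_apply, smul_eq_mul, ← tsum_mul_left]
          congr 1; ext n
          simp [mul_assoc] } (B j) (by
      intro c
      rw [hnorm, ← tsum_mul_left]
      refine tsum_of_norm_bounded ((hE c).mul_left (B j)).hasSum fun n => ?_
      rw [norm_mul, mul_comm]
      exact mul_le_mul_of_nonneg_right (hB j n) (norm_nonneg _))
  have hg : ∀ j c, g j c = ∑' n, c n * ∫ v, D j v * φ' (v - u n) := fun j c => rfl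
  obtain ⟨C, hC⟩ := banach_steinhaus (g := g) (fun c => by
    obtain ⟨h1, h2⟩ := hφ'.tsum_translates hc' hu (hE c)
    obtain ⟨C, hC⟩ := hb _ h1 h2
    refine ⟨C, fun j => ?_⟩
    rw [hg, ← (key j).2 c (hE c)]
    exact hC j)
  -- The unit sequence at `n` recovers the single translate by `u n`, whose pairing with `D (i n)`
  -- exceeds `n`.
  obtain ⟨n, hn⟩ := exists_nat_gt C
  have h1 := (g (i n)).le_opNorm (lp.single 1 n (1 : ℝ))
  rw [lp.norm_single (by norm_num), norm_one, mul_one, hg, tsum_eq_single n, lp.single_apply_self,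
    one_mul] at h1
  · exact absurd ((hlarge n).trans_le (h1.trans (hC _))) (not_lt.2 hn.le)
  · intro m hm
    rw [lp.single_apply_ne _ _ _ hm, zero_mul]

/-! ### Functions of two variables from their partial derivatives -/

theorem hasFDerivAt_of_partial {F F₁ F₂ : ℝ → ℝ → ℝ} {q : ℝ × ℝ} (hq : 0 < q.1)
    (h₁ : ∀ ρ u, 0 < ρ → HasDerivAt (fun r => F r u) (F₁ ρ u) ρ)
    (h₂ : ∀ ρ u, 0 < ρ → HasDerivAt (F ρ) (F₂ ρ u) u)
    (c₁ : ContinuousAt (fun q : ℝ × ℝ => F₁ q.1 q.2) q)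
    (c₂ : ContinuousAt (fun q : ℝ × ℝ => F₂ q.1 q.2) q) :
    HasFDerivAt (fun q : ℝ × ℝ => F q.1 q.2)
      (F₁ q.1 q.2 • ContinuousLinearMap.fst ℝ ℝ ℝ + F₂ q.1 q.2 • ContinuousLinearMap.snd ℝ ℝ ℝ)
      q := by
  have hev : ∀ᶠ v : ℝ × ℝ in 𝓝 q, 0 < v.1 :=
    (continuous_fst.tendsto q).eventually (lt_mem_nhds hq)
  have c : Continuous fun a : ℝ => ContinuousLinearMap.toSpanSingleton ℝ a :=
    (ContinuousLinearMap.toSpanSingletonCLE (𝕜 := ℝ) (E := ℝ)).continuous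
  have := (hasStrictFDerivAt_uncurry_coprod (𝕜 := ℝ) (u := q) (f := F)
    (f₁ := fun ρ u => ContinuousLinearMap.toSpanSingleton ℝ (F₁ ρ u))
    (f₂ := fun ρ u => ContinuousLinearMap.toSpanSingleton ℝ (F₂ ρ u))
    (hev.mono fun v hv => (h₁ v.1 v.2 hv).hasFDerivAt)
    (hev.mono fun v hv => (h₂ v.1 v.2 hv).hasFDerivAt)
    (c.continuousAt.comp c₁) (c.continuousAt.comp c₂)).hasFDerivAt
  refine this.congr_fderiv ?_
  ext <;> simp [Function.HasUncurry.uncurry]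

/-- Joint continuity is not part of the notion of a kernel; it is recovered from continuity in `ρ`
and a Lipschitz bound in `u` that is uniform in nearby `ρ`. -/
theorem continuousAt_of_continuousAt_of_lipschitz {F : ℝ → ℝ → ℝ} {ρ u C δ : ℝ} (hδ : 0 < δ)
    (h₁ : ContinuousAt (fun r => F r u) ρ)
    (h₂ : ∀ r v, |r - ρ| < δ → |v - u| < δ → |F r v - F r u| ≤ C * |v - u|) :
    ContinuousAt (fun q : ℝ × ℝ => F q.1 q.2) (ρ, u) := by
  have e : (fun q : ℝ × ℝ => F q.1 q.2) = fun q => (F q.1 q.2 - F q.1 u) + F q.1 u := by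
    ext q; ring
  have h3 : Tendsto (fun q : ℝ × ℝ => F q.1 q.2 - F q.1 u) (𝓝 (ρ, u)) (𝓝 0) := by
    refine squeeze_zero_norm' (a := fun q : ℝ × ℝ => C * |q.2 - u|) ?_ ?_
    · filter_upwards [(continuous_fst.tendsto (ρ, u)).eventually (Metric.ball_mem_nhds ρ hδ),
        (continuous_snd.tendsto (ρ, u)).eventually (Metric.ball_mem_nhds u hδ)] with q hq1 hq2
      exact h₂ q.1 q.2 (by simpa [Real.dist_eq] using hq1) (by simpa [Real.dist_eq] using hq2)
    · have : Continuous fun q : ℝ × ℝ => C * |q.2 - u| := by fun_prop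
      simpa using this.tendsto (ρ, u)
  have h4 : Tendsto (fun q : ℝ × ℝ => F q.1 u) (𝓝 (ρ, u)) (𝓝 (F ρ u)) :=
    h₁.tendsto.comp (continuous_fst.tendsto (ρ, u))
  rw [ContinuousAt, e]
  simpa using h3.add h4

/-- A function with bounded derivative on `[-R,R]` is Lipschitz there. -/
theorem abs_sub_le_of_abs_deriv_le {g g' : ℝ → ℝ} {R C : ℝ} (hg : ∀ u, HasDerivAt g (g' u) u)
    (hb : ∀ u, |u| ≤ R → |g' u| ≤ C) {u v : ℝ} (hu : |u| ≤ R) (hv : |v| ≤ R) :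
    |g v - g u| ≤ C * |v - u| :=
  (convex_Icc (-R) R).norm_image_sub_le_of_norm_hasDerivWithin_le
    (fun x _ => (hg x).hasDerivWithinAt) (fun x hx => hb x (abs_le.2 hx)) (abs_le.1 hu) (abs_le.1 hv)

theorem abs_taylor_le_of_abs_deriv_le {g g' g'' : ℝ → ℝ} {R C : ℝ}
    (hg : ∀ u, HasDerivAt g (g' u) u) (hg' : ∀ u, HasDerivAt g' (g'' u) u)
    (hb : ∀ u, |u| ≤ R → |g'' u| ≤ C) {u v : ℝ} (hu : |u| ≤ R) (hv : |v| ≤ R) :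
    |g v - g u - (v - u) * g' u| ≤ C * |v - u| ^ 2 := by
  have hC : 0 ≤ C := (abs_nonneg _).trans (hb u hu)
  have h1 : ∀ x ∈ uIcc u v, HasDerivWithinAt (fun x => g x - (x - u) * g' u) (g' x - g' u)
      (uIcc u v) x := fun x _ => by
    have := (hg x).fun_sub (((hasDerivAt_id' x).sub_const u).mul_const (g' u))
    simpa using this.hasDerivWithinAt
  have h2 : ∀ x ∈ uIcc u v, ‖g' x - g' u‖ ≤ C * |v - u| := fun x hx => by
    have hx1 : |x - u| ≤ |v - u| := abs_sub_left_of_mem_uIcc hx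
    have hxR : |x| ≤ R := by
      have := uIcc_subset_Icc (abs_le.1 hu) (abs_le.1 hv) hx
      exact abs_le.2 this
    exact (abs_sub_le_of_abs_deriv_le hg' hb hu hxR).trans (mul_le_mul_of_nonneg_left hx1 hC)
  have := (convex_uIcc u v).norm_image_sub_le_of_norm_hasDerivWithin_le h1 h2 left_mem_uIcc
    right_mem_uIcc
  rw [Real.norm_eq_abs, Real.norm_eq_abs] at this
  calc |g v - g u - (v - u) * g' u| = |g v - (v - u) * g' u - (g u - (u - u) * g' u)| := by
        congr 1; ring
    _ ≤ C * |v - u| * |v - u| := this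
    _ = _ := by ring

/-! ### Smooth solutions of the entropy equation -/

/-- `z j = ∂ᵤʲ ζ` and `z' j = ∂ᵨ ∂ᵤʲ ζ` for a solution `ζ`, smooth in `u`, of
`ζ_ρρ = p'(ρ) ρ⁻² ζ_uu` for `ρ > 0` with `ζ = 0` and `ζ_ρ = f 0` at `ρ = 0`. -/
structure IsWaveFamily (p : ℝ → ℝ) (f : ℕ → ℝ → ℝ) (z z' : ℕ → ℝ → ℝ → ℝ) : Prop where
  deriv_u : ∀ j ρ u, 0 < ρ → HasDerivAt (z j ρ) (z (j + 1) ρ u) u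
  deriv_rho : ∀ j ρ u, 0 < ρ → HasDerivAt (fun r => z j r u) (z' j ρ u) ρ
  deriv_rho' : ∀ j ρ u, 0 < ρ →
    HasDerivAt (fun r => z' j r u) (deriv p ρ / ρ ^ 2 * z (j + 2) ρ u) ρ
  bound : ∀ j R, ∃ C, 0 ≤ C ∧ ∀ ρ ∈ Ioc 0 R, ∀ u, |u| ≤ R → |z j ρ u| ≤ C * ρ
  init : ∀ j u, Tendsto (fun r => z' j r u) (𝓝[>] 0) (𝓝 (f j u))
  deriv_data : ∀ j u, HasDerivAt (f j) (f (j + 1) u) u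

namespace IsWaveFamily

variable {p : ℝ → ℝ} {γ κ ρs cs M : ℝ} {f : ℕ → ℝ → ℝ} {z z' : ℕ → ℝ → ℝ → ℝ}

theorem shift (hz : IsWaveFamily p f z z') :
    IsWaveFamily p (fun j => f (j + 1)) (fun j => z (j + 1)) (fun j => z' (j + 1)) where
  deriv_u j := hz.deriv_u (j + 1)
  deriv_rho j := hz.deriv_rho (j + 1)
  deriv_rho' j := hz.deriv_rho' (j + 1)
  bound j := hz.bound (j + 1)
  init j := hz.init (j + 1)
  deriv_data j := hz.deriv_data (j + 1)

theorem sub {f₂ : ℕ → ℝ → ℝ} {z₂ z₂' : ℕ → ℝ → ℝ → ℝ} (hz : IsWaveFamily p f z z')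
    (hz₂ : IsWaveFamily p f₂ z₂ z₂') :
    IsWaveFamily p (fun j u => f j u - f₂ j u) (fun j ρ u => z j ρ u - z₂ j ρ u)
      (fun j ρ u => z' j ρ u - z₂' j ρ u) where
  deriv_u j ρ u hρ := (hz.deriv_u j ρ u hρ).fun_sub (hz₂.deriv_u j ρ u hρ)
  deriv_rho j ρ u hρ := (hz.deriv_rho j ρ u hρ).fun_sub (hz₂.deriv_rho j ρ u hρ)
  deriv_rho' j ρ u hρ := by
    rw [mul_sub]; exact (hz.deriv_rho' j ρ u hρ).fun_sub (hz₂.deriv_rho' j ρ u hρ)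
  bound j R := by
    obtain ⟨C, hC, h⟩ := hz.bound j R
    obtain ⟨C₂, hC₂, h₂⟩ := hz₂.bound j R
    refine ⟨C + C₂, add_nonneg hC hC₂, fun ρ hρ u hu => (abs_sub _ _).trans ?_⟩
    rw [add_mul]
    exact add_le_add (h ρ hρ u hu) (h₂ ρ hρ u hu)
  init j u := (hz.init j u).sub (hz₂.init j u)
  deriv_data j u := (hz.deriv_data j u).fun_sub (hz₂.deriv_data j u)

variable (hp : IsPressureLaw p γ κ ρs cs M) (hz : IsWaveFamily p f z z')
include hp hz

/-- Since `z = O(ρ)`, the singular coefficient `p'/ρ²` leaves `z_ρρ = O(ρ^(γ-2))`, which is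
integrable up to the vacuum. The exponent is written as `δ - 1` with `δ = γ - 1`, ready for
`abs_sub_le_of_abs_deriv_le_rpow`. -/
theorem abs_deriv_rho'_le (j : ℕ) (R : ℝ) : ∃ C, 0 ≤ C ∧ ∀ ρ ∈ Ioc 0 R, ∀ u, |u| ≤ R →
    |deriv p ρ / ρ ^ 2 * z j ρ u| ≤ C * ρ ^ (γ - 1 - 1) := by
  obtain ⟨C, hC, h⟩ := hz.bound j R
  obtain ⟨C₁, hC₁, h₁⟩ := hp.abs_le_rpow R
  refine ⟨C₁ * C, by positivity, fun ρ hρ u hu => ?_⟩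
  have h2 := (h₁ ρ hρ).2.1
  have hpos := hρ.1
  rw [abs_mul, abs_div, abs_of_pos (pow_pos hpos 2), Real.rpow_sub_one hpos.ne']
  calc |deriv p ρ| / ρ ^ 2 * |z j ρ u| ≤ C₁ * ρ ^ (γ - 1) / ρ ^ 2 * (C * ρ) := by
        gcongr
        exact h ρ hρ u hu
    _ = C₁ * C * (ρ ^ (γ - 1) / ρ) := by field_simp

theorem abs_deriv_rho_sub_le (j : ℕ) (R : ℝ) : ∃ C, 0 ≤ C ∧ ∀ ρ ∈ Ioc 0 R, ∀ u, |u| ≤ R →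
    |z' j ρ u - f j u| ≤ C * ρ ^ (γ - 1) := by
  obtain ⟨C, hC, h⟩ := abs_deriv_rho'_le hp hz (j + 2) R
  have hγ : 0 < γ - 1 := by linarith [hp.one_lt_gamma]
  refine ⟨C / (γ - 1), by positivity, fun ρ hρ u hu => ?_⟩
  exact abs_sub_le_of_abs_deriv_le_rpow hγ (fun r hr => hz.deriv_rho' j r u hr.1)
    (fun r hr => h r hr u hu) (hz.init j u) hρ

theorem abs_deriv_rho_le (j : ℕ) (R : ℝ) : ∃ C, 0 ≤ C ∧ ∀ ρ ∈ Ioc 0 R, ∀ u, |u| ≤ R →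
    |z' j ρ u| ≤ C := by
  obtain ⟨C, hC, h⟩ := abs_deriv_rho_sub_le hp hz j R
  obtain ⟨B, hB⟩ := isCompact_Icc.exists_bound_of_continuousOn (s := Icc (-R) R)
    (f := f j) (fun u _ => (hz.deriv_data j u).continuousAt.continuousWithinAt)
  refine ⟨|B| + C * R ^ (γ - 1) + |C * R ^ (γ - 1)|, ?_, fun ρ hρ u hu => ?_⟩
  · have := neg_abs_le (C * R ^ (γ - 1))
    linarith [abs_nonneg B]
  · have h1 := h ρ hρ u hu
    have h2 := hB u (abs_le.1 hu)
    have h3 : C * ρ ^ (γ - 1) ≤ C * R ^ (γ - 1) :=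
      mul_le_mul_of_nonneg_left (Real.rpow_le_rpow hρ.1.le hρ.2 (by linarith [hp.one_lt_gamma])) hC
    have h4 := abs_sub_abs_le_abs_sub (z' j ρ u) (f j u)
    rw [Real.norm_eq_abs] at h2
    linarith [le_abs_self B, abs_nonneg (C * R ^ (γ - 1))]

/-- The first-order Taylor remainder of `z' j` in `u`, minus that of the data `f j`, vanishes at `ρ
= 0` and has `ρ`-derivative `O(|v - u|² ρ^(γ-2))`. Integrating in `ρ` makes it `O(|v - u|²)`, so
differentiability is inherited from the data. -/
theorem deriv_u' (j : ℕ) (ρ u : ℝ) (hρ : 0 < ρ) : HasDerivAt (z' j ρ) (z' (j + 1) ρ u) u := by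
  set R := max ρ (|u| + 1)
  have hρR : ρ ∈ Ioc 0 R := ⟨hρ, le_max_left _ _⟩
  have huR : |u| ≤ R := (by linarith : |u| ≤ |u| + 1).trans (le_max_right _ _)
  have hγ : 0 < γ - 1 := by linarith [hp.one_lt_gamma]
  obtain ⟨C, hC, h⟩ := abs_deriv_rho'_le hp hz (j + 2 + 2) R
  have key : ∀ v, |v| ≤ R → |z' j ρ v - z' j ρ u - (v - u) * z' (j + 1) ρ u
      - (f j v - f j u - (v - u) * f (j + 1) u)| ≤ C * |v - u| ^ 2 / (γ - 1) * ρ ^ (γ - 1) := by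
    intro v hv
    refine abs_sub_le_of_abs_deriv_le_rpow (R := R) (C := C * |v - u| ^ 2)
      (g := fun r => z' j r v - z' j r u - (v - u) * z' (j + 1) r u) hγ
      (fun r hr => ((hz.deriv_rho' j r v hr.1).fun_sub (hz.deriv_rho' j r u hr.1)).fun_sub
        ((hz.deriv_rho' (j + 1) r u hr.1).const_mul (v - u))) (fun r hr => ?_)
      (((hz.init j v).sub (hz.init j u)).sub ((hz.init (j + 1) u).const_mul _)) hρR
    have hpos := hr.1
    have h1 := abs_taylor_le_of_abs_deriv_le (g := fun v => deriv p r / r ^ 2 * z (j + 2) r v)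
      (g' := fun v => deriv p r / r ^ 2 * z (j + 2 + 1) r v)
      (g'' := fun v => deriv p r / r ^ 2 * z (j + 2 + 1 + 1) r v)
      (fun w => (hz.deriv_u (j + 2) r w hr.1).const_mul _)
      (fun w => (hz.deriv_u (j + 2 + 1) r w hr.1).const_mul _)
      (fun w hw => h r hr w hw) huR hv
    calc _ = _ := by rfl
      _ ≤ _ := h1
      _ = _ := by ring
  rw [hasDerivAt_iff_isLittleO]
  have hf := (hasDerivAt_iff_isLittleO).1 (hz.deriv_data j u)
  have hbig : (fun v => z' j ρ v - z' j ρ u - (v - u) • z' (j + 1) ρ u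
      - (f j v - f j u - (v - u) • f (j + 1) u)) =o[𝓝 u] fun v => v - u := by
    have h1 : (fun v => z' j ρ v - z' j ρ u - (v - u) • z' (j + 1) ρ u
      - (f j v - f j u - (v - u) • f (j + 1) u)) =O[𝓝 u] fun v => (v - u) ^ 2 := by
      refine Asymptotics.IsBigO.of_bound (C / (γ - 1) * ρ ^ (γ - 1)) ?_
      filter_upwards [Metric.ball_mem_nhds u one_pos] with v hv
      have hv' : |v| ≤ R := by
        have : |v - u| < 1 := by simpa [Real.dist_eq] using hv
        have h2 := abs_sub_abs_le_abs_sub v u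
        exact (by linarith : |v| ≤ |u| + 1).trans (le_max_right _ _)
      have := key v hv'
      simp only [smul_eq_mul, Real.norm_eq_abs, abs_pow] at this ⊢
      calc _ ≤ _ := this
        _ = _ := by ring
    refine h1.trans_isLittleO ?_
    simpa using! (Asymptotics.isLittleO_pow_sub_sub u one_lt_two).congr_left
      (f₂ := fun v => (v - u) ^ 2) fun v => by rw [Real.norm_eq_abs, sq_abs]
  simpa using hbig.add hf

omit hp in
theorem continuousAt (j : ℕ) {q : ℝ × ℝ} (hq : 0 < q.1) :
    ContinuousAt (fun q : ℝ × ℝ => z j q.1 q.2) q := by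
  obtain ⟨C, hC, h⟩ := hz.bound (j + 1) (max (q.1 + 1) (|q.2| + 1))
  refine continuousAt_of_continuousAt_of_lipschitz (ρ := q.1) (u := q.2)
    (C := C * (q.1 + 1)) (δ := min q.1 1) (lt_min hq one_pos)
    (hz.deriv_rho j q.1 q.2 hq).continuousAt fun r v hr hv => ?_
  have hr' := abs_lt.1 hr
  have hr0 : 0 < r := by linarith [min_le_left q.1 1, hr'.1]
  have hr1 : r ≤ q.1 + 1 := by linarith [min_le_right q.1 1, hr'.2]
  have hv1 : |v| ≤ |q.2| + 1 := by
    have h2 := abs_sub_abs_le_abs_sub v q.2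
    linarith [min_le_right q.1 1]
  have hle : C * r ≤ C * (q.1 + 1) := mul_le_mul_of_nonneg_left hr1 hC
  exact abs_sub_le_of_abs_deriv_le (R := max (q.1 + 1) (|q.2| + 1)) (hz.deriv_u j r · hr0)
    (fun w hw => (h r ⟨hr0, hr1.trans (le_max_left _ _)⟩ w hw).trans hle)
    ((by linarith : |q.2| ≤ |q.2| + 1).trans (le_max_right _ _)) (hv1.trans (le_max_right _ _))

theorem continuousAt' (j : ℕ) {q : ℝ × ℝ} (hq : 0 < q.1) :
    ContinuousAt (fun q : ℝ × ℝ => z' j q.1 q.2) q := by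
  obtain ⟨C, hC, h⟩ := abs_deriv_rho_le hp hz (j + 1) (max (q.1 + 1) (|q.2| + 1))
  refine continuousAt_of_continuousAt_of_lipschitz (ρ := q.1) (u := q.2)
    (C := C) (δ := min q.1 1) (lt_min hq one_pos)
    (hz.deriv_rho' j q.1 q.2 hq).continuousAt fun r v hr hv => ?_
  have hr' := abs_lt.1 hr
  have hr0 : 0 < r := by linarith [min_le_left q.1 1, hr'.1]
  have hr1 : r ≤ q.1 + 1 := by linarith [min_le_right q.1 1, hr'.2]
  have hv1 : |v| ≤ |q.2| + 1 := by
    have h2 := abs_sub_abs_le_abs_sub v q.2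
    linarith [min_le_right q.1 1]
  exact abs_sub_le_of_abs_deriv_le (R := max (q.1 + 1) (|q.2| + 1))
    (fun w => deriv_u' hp hz j r w hr0)
    (fun w hw => h r ⟨hr0, hr1.trans (le_max_left _ _)⟩ w hw)
    ((by linarith : |q.2| ≤ |q.2| + 1).trans (le_max_right _ _)) (hv1.trans (le_max_right _ _))

theorem hasFDerivAt (j : ℕ) {q : ℝ × ℝ} (hq : 0 < q.1) :
    HasFDerivAt (fun q : ℝ × ℝ => z j q.1 q.2) (z' j q.1 q.2 • ContinuousLinearMap.fst ℝ ℝ ℝ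
      + z (j + 1) q.1 q.2 • ContinuousLinearMap.snd ℝ ℝ ℝ) q :=
  hasFDerivAt_of_partial hq (hz.deriv_rho j) (hz.deriv_u j) (continuousAt' hp hz j hq)
    (continuousAt hz (j + 1) hq)

-- In terms of `w = z/ρ`, the quantity `ρ z_ρ - z` equals `ρ² w_ρ`; this is the equation `(ρ² w_ρ)_ρ
-- = p' w_uu`. Below, `alpha` refers to `ρ² w_ρ` and `beta` to `w`.
omit hp in
theorem hasDerivAt_alpha (j : ℕ) {ρ : ℝ} (u : ℝ) (hρ : 0 < ρ) :
    HasDerivAt (fun r => r * z' j r u - z j r u) (deriv p ρ / ρ * z (j + 2) ρ u) ρ := by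
  have := ((hasDerivAt_id' ρ).fun_mul (hz.deriv_rho' j ρ u hρ)).fun_sub (hz.deriv_rho j ρ u hρ)
  refine this.congr_deriv ?_
  field_simp
  ring

theorem hasFDerivAt_alpha (j : ℕ) {q : ℝ × ℝ} (hq : 0 < q.1) :
    HasFDerivAt (fun q : ℝ × ℝ => q.1 * z' j q.1 q.2 - z j q.1 q.2)
      ((deriv p q.1 / q.1 * z (j + 2) q.1 q.2) • ContinuousLinearMap.fst ℝ ℝ ℝ
      + (q.1 * z' (j + 1) q.1 q.2 - z (j + 1) q.1 q.2) • ContinuousLinearMap.snd ℝ ℝ ℝ) q := by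
  refine hasFDerivAt_of_partial hq (F := fun r u => r * z' j r u - z j r u)
    (F₁ := fun r u => deriv p r / r * z (j + 2) r u)
    (F₂ := fun r u => r * z' (j + 1) r u - z (j + 1) r u)
    (fun ρ u hρ => hasDerivAt_alpha hz j u hρ)
    (fun ρ u hρ => ((deriv_u' hp hz j ρ u hρ).const_mul ρ).fun_sub (hz.deriv_u j ρ u hρ)) ?_ ?_
  · refine ContinuousAt.mul (ContinuousAt.div ?_ continuousAt_fst hq.ne')
      (continuousAt hz (j + 2) hq)
    exact (hp.continuousOn_deriv.continuousAt (Ioi_mem_nhds hq)).comp continuousAt_fst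
  · exact (continuousAt_fst.mul (continuousAt' hp hz (j + 1) hq)).sub
      (continuousAt hz (j + 1) hq)

theorem hasFDerivAt_beta (j : ℕ) {q : ℝ × ℝ} (hq : 0 < q.1) :
    HasFDerivAt (fun q : ℝ × ℝ => z j q.1 q.2 / q.1)
      (((q.1 * z' j q.1 q.2 - z j q.1 q.2) / q.1 ^ 2) • ContinuousLinearMap.fst ℝ ℝ ℝ
      + (z (j + 1) q.1 q.2 / q.1) • ContinuousLinearMap.snd ℝ ℝ ℝ) q := by
  refine hasFDerivAt_of_partial hq (F := fun r u => z j r u / r)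
    (F₁ := fun r u => (r * z' j r u - z j r u) / r ^ 2)
    (F₂ := fun r u => z (j + 1) r u / r)
    (fun ρ u hρ => ?_) (fun ρ u hρ => (hz.deriv_u j ρ u hρ).div_const ρ) ?_ ?_
  · refine ((hz.deriv_rho j ρ u hρ).fun_div (hasDerivAt_id' ρ) hρ.ne').congr_deriv ?_
    ring
  · refine ContinuousAt.div ((continuousAt_fst.mul (continuousAt' hp hz j hq)).sub
      (continuousAt hz j hq)) (continuousAt_fst.pow 2) (pow_pos hq 2).ne'
  · exact ContinuousAt.div (continuousAt hz (j + 1) hq) continuousAt_fst hq.ne'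

omit hp in
theorem tendsto_zero (j : ℕ) (u : ℝ) : Tendsto (fun r => z j r u) (𝓝[>] 0) (𝓝 0) := by
  obtain ⟨C, hC, h⟩ := hz.bound j (max 1 |u|)
  refine squeeze_zero_norm' (a := fun r => C * r) ?_ ?_
  · filter_upwards [Ioc_mem_nhdsGT one_pos] with r hr
    exact h r ⟨hr.1, hr.2.trans (le_max_left _ _)⟩ u (le_max_right _ _)
  · have : Tendsto (fun r : ℝ => C * r) (𝓝 0) (𝓝 (C * 0)) := tendsto_id.const_mul C
    rw [mul_zero] at this
    exact this.mono_left nhdsWithin_le_nhds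

/-- `ρ² w_ρ` vanishes at the vacuum and its derivative is `O(ρ^(γ-1))`. -/
theorem abs_alpha_le (j : ℕ) (R : ℝ) : ∃ C, 0 ≤ C ∧ ∀ ρ ∈ Ioc 0 R, ∀ u, |u| ≤ R →
    |ρ * z' j ρ u - z j ρ u| ≤ C * ρ ^ γ := by
  obtain ⟨C, hC, h⟩ := abs_deriv_rho'_le hp hz (j + 2) R
  have hγ : 0 < γ := by linarith [hp.one_lt_gamma]
  refine ⟨C / γ, by positivity, fun ρ hρ u hu => ?_⟩
  have hlim : Tendsto (fun r => r * z' j r u - z j r u) (𝓝[>] 0) (𝓝 0) := by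
    have h1 : Tendsto (fun r : ℝ => r) (𝓝[>] 0) (𝓝 0) := tendsto_id.mono_left nhdsWithin_le_nhds
    simpa using (h1.mul (hz.init j u)).sub (hz.tendsto_zero j u)
  have := abs_sub_le_of_abs_deriv_le_rpow (R := R) (C := C) hγ
    (fun r hr => hasDerivAt_alpha hz j u hr.1) (fun r hr => ?_) hlim hρ
  · simpa using this
  · have h1 := h r hr u hu
    have hpos := hr.1
    calc |deriv p r / r * z (j + 2) r u| = |deriv p r / r ^ 2 * z (j + 2) r u| * r := by
          rw [show deriv p r / r * z (j + 2) r u = deriv p r / r ^ 2 * z (j + 2) r u * r by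
            field_simp, abs_mul _ r, abs_of_pos hpos]
      _ ≤ C * r ^ (γ - 1 - 1) * r := by gcongr
      _ = C * r ^ (γ - 1) := by
          rw [Real.rpow_sub_one hpos.ne' (γ - 1)]; field_simp

theorem abs_beta_sub_le (j : ℕ) (R : ℝ) : ∃ C, 0 ≤ C ∧ ∀ ρ ∈ Ioc 0 R, ∀ u, |u| ≤ R →
    |z j ρ u / ρ - f j u| ≤ C * ρ ^ (γ - 1) := by
  obtain ⟨C, hC, h⟩ := abs_deriv_rho_sub_le hp hz j R
  have hγ : 0 < γ := by linarith [hp.one_lt_gamma]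
  refine ⟨C / γ, by positivity, fun ρ hρ u hu => ?_⟩
  have hpos := hρ.1
  have hlim : Tendsto (fun r => z j r u - r * f j u) (𝓝[>] 0) (𝓝 0) := by
    have h1 : Tendsto (fun r : ℝ => r) (𝓝[>] 0) (𝓝 0) := tendsto_id.mono_left nhdsWithin_le_nhds
    simpa using (hz.tendsto_zero j u).sub (h1.mul_const (f j u))
  have h2 := abs_sub_le_of_abs_deriv_le_rpow (R := R) hγ
    (fun r hr => (hz.deriv_rho j r u hr.1).fun_sub ((hasDerivAt_id' r).mul_const (f j u)))
    (fun r hr => by simpa using h r hr u hu) hlim hρ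
  rw [sub_zero] at h2
  have e : z j ρ u / ρ - f j u = (z j ρ u - ρ * f j u) / ρ := by field_simp
  rw [e, abs_div, abs_of_pos hpos, div_le_iff₀ hpos, mul_assoc, Real.rpow_sub_one hpos.ne',
    div_mul_cancel₀ _ hpos.ne']
  exact h2

end IsWaveFamily

/-! ### The maximum principle for the damped Riemann invariants -/

theorem HasDerivAt.nonneg_of_le_left {g : ℝ → ℝ} {d a b : ℝ} (hd : HasDerivAt g d b) (hab : a < b)
    (h : ∀ r ∈ Icc a b, g r ≤ g b) : 0 ≤ d := by
  have h1 : Tendsto (slope g b) (𝓝[<] b) (𝓝 d) :=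
    hd.tendsto_slope.mono_left (nhdsWithin_mono _ fun x hx => (ne_of_lt hx))
  refine ge_of_tendsto h1 ?_
  filter_upwards [Ico_mem_nhdsLT hab] with r hr
  rw [slope_def_field]
  exact div_nonneg_of_nonpos (sub_nonpos.2 (h r ⟨hr.1, hr.2.le⟩)) (sub_nonpos.2 hr.2.le)

/-- Let `a ± b` be damped along the characteristics `u = c ∓ k(r)` at the same rate `-l a`. Then
the maximum of `|a + b|` and `|a - b|` over a backward characteristic triangle is attained at its
base. -/
theorem abs_le_of_damped_characteristics {a b : ℝ → ℝ → ℝ} {k l : ℝ → ℝ}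
    (ha : ∀ q : ℝ × ℝ, 0 < q.1 → ContinuousAt (fun q : ℝ × ℝ => a q.1 q.2) q)
    (hb : ∀ q : ℝ × ℝ, 0 < q.1 → ContinuousAt (fun q : ℝ × ℝ => b q.1 q.2) q)
    (hk : ContinuousOn k (Ioi 0)) (hkm : MonotoneOn k (Ioi 0)) (hl : ∀ r, 0 < r → 0 ≤ l r)
    (hd : ∀ σ : ℝ, (σ = 1 ∨ σ = -1) → ∀ c r, 0 < r →
      HasDerivAt (fun r => a r (c - σ * k r) + σ * b r (c - σ * k r))
        (-(l r * a r (c - σ * k r))) r)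
    {r₀ ρ u B : ℝ} (hr₀ : 0 < r₀) (hρ : r₀ ≤ ρ)
    (hB : ∀ v, |v - u| ≤ k ρ - k r₀ → |a r₀ v + b r₀ v| ≤ B ∧ |a r₀ v - b r₀ v| ≤ B) :
    |a ρ u + b ρ u| ≤ B ∧ |a ρ u - b ρ u| ≤ B := by
  set Δ : Set (ℝ × ℝ) := {q | q ∈ Icc r₀ ρ ×ˢ Icc (u - (k ρ - k r₀)) (u + (k ρ - k r₀)) ∧
    |q.2 - u| + k q.1 ∈ Iic (k ρ)}
  have hrect : IsCompact (Icc r₀ ρ ×ˢ Icc (u - (k ρ - k r₀)) (u + (k ρ - k r₀))) :=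
    isCompact_Icc.prod isCompact_Icc
  have hΔc : IsCompact Δ := by
    refine hrect.of_isClosed_subset ?_ fun q hq => hq.1
    refine ContinuousOn.preimage_isClosed_of_isClosed (f := fun q : ℝ × ℝ => |q.2 - u| + k q.1)
      (t := Iic (k ρ)) ?_ hrect.isClosed isClosed_Iic
    refine ContinuousOn.add (f := fun q : ℝ × ℝ => |q.2 - u|) (by fun_prop) (hk.comp continuousOn_fst fun q hq => ?_)
    exact lt_of_lt_of_le hr₀ hq.1.1
  have hmem : ∀ r ∈ Icc r₀ ρ, ∀ v, |v - u| ≤ k ρ - k r → (r, v) ∈ Δ := by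
    intro r hr v hv
    have h1 := hkm hr₀ (lt_of_lt_of_le hr₀ hr.1) hr.1
    have h2 := abs_le.1 hv
    exact ⟨⟨hr, by linarith [h2.1], by linarith [h2.2]⟩, by simp only [mem_Iic]; linarith⟩
  have hpos : ∀ q ∈ Δ, 0 < q.1 := fun q hq => lt_of_lt_of_le hr₀ hq.1.1.1
  have hcone : ∀ q ∈ Δ, |q.2 - u| ≤ k ρ - k q.1 := fun q hq => by
    have := hq.2; simp only [mem_Iic] at this; linarith
  -- The term `δ (r - r₀)` turns weak decay into strict decay, which excludes a maximum off the
  -- base; `δ → 0` at the end.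
  suffices key : ∀ δ > 0, ∀ q ∈ Δ,
      max |a q.1 q.2 + b q.1 q.2| |a q.1 q.2 - b q.1 q.2| - δ * (q.1 - r₀) ≤ B by
    have h0 : (ρ, u) ∈ Δ := hmem ρ ⟨hρ, le_rfl⟩ u (by simp)
    have h1 : ∀ δ > 0, max |a ρ u + b ρ u| |a ρ u - b ρ u| ≤ B + δ * (ρ - r₀) := fun δ hδ => by
      have := key δ hδ _ h0; simp only at this; linarith
    have h2 : max |a ρ u + b ρ u| |a ρ u - b ρ u| ≤ B := by
      have hlim : Tendsto (fun δ : ℝ => B + δ * (ρ - r₀)) (𝓝[>] 0) (𝓝 (B + 0 * (ρ - r₀))) :=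
        (Continuous.tendsto (by fun_prop) 0).mono_left nhdsWithin_le_nhds
      rw [zero_mul, add_zero] at hlim
      exact ge_of_tendsto hlim (eventually_mem_nhdsWithin.mono fun δ hδ => h1 δ hδ)
    exact max_le_iff.1 h2
  intro δ hδ q hq
  set N : ℝ × ℝ → ℝ := fun q =>
    max |a q.1 q.2 + b q.1 q.2| |a q.1 q.2 - b q.1 q.2| - δ * (q.1 - r₀) with hN
  have hNc : ContinuousOn N Δ := fun q hq => by
    have h1 := ha q (hpos q hq)
    have h2 := hb q (hpos q hq)
    exact ContinuousAt.continuousWithinAt (((h1.add h2).abs.max (h1.sub h2).abs).sub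
      (continuousAt_const.mul (continuousAt_fst.sub continuousAt_const)))
  obtain ⟨P, hP, hmax⟩ := hΔc.exists_isMaxOn ⟨q, hq⟩ hNc
  refine (hmax hq).trans ?_
  obtain ⟨r, v⟩ := P
  have hr0 : 0 < r := hpos _ hP
  have hrr : r₀ ≤ r := hP.1.1.1
  rcases hrr.eq_or_lt with heq | hlt
  · subst heq
    obtain ⟨h1, h2⟩ := hB v (hcone _ hP)
    simp only [hN, sub_self, mul_zero, sub_zero]
    exact max_le h1 h2
  exfalso
  -- Signs for which the maximum of the two moduli at `(r, v)` is the single smooth expression `τ (a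
  -- + σ b)`.
  obtain ⟨τ, σ, hτ, hσ, hτσ⟩ : ∃ τ σ : ℝ, (τ = 1 ∨ τ = -1) ∧ (σ = 1 ∨ σ = -1) ∧
      max |a r v + b r v| |a r v - b r v| = τ * (a r v + σ * b r v) := by
    rcases max_choice |a r v + b r v| |a r v - b r v| with h | h <;> rw [h]
    · rcases abs_choice (a r v + b r v) with h' | h' <;> rw [h']
      · exact ⟨1, 1, by simp, by simp, by ring⟩
      · exact ⟨-1, 1, by simp, by simp, by ring⟩
    · rcases abs_choice (a r v - b r v) with h' | h' <;> rw [h']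
      · exact ⟨1, -1, by simp, by simp, by ring⟩
      · exact ⟨-1, -1, by simp, by simp, by ring⟩
  have hle : ∀ q : ℝ × ℝ, τ * (a q.1 q.2 + σ * b q.1 q.2) ≤
      max |a q.1 q.2 + b q.1 q.2| |a q.1 q.2 - b q.1 q.2| := by
    intro q
    have h1 := le_abs_self (a q.1 q.2 + b q.1 q.2)
    have h2 := neg_abs_le (a q.1 q.2 + b q.1 q.2)
    have h3 := le_abs_self (a q.1 q.2 - b q.1 q.2)
    have h4 := neg_abs_le (a q.1 q.2 - b q.1 q.2)
    rcases hτ with rfl | rfl <;> rcases hσ with rfl | rfl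
    · exact le_max_of_le_left (by linarith)
    · exact le_max_of_le_right (by linarith)
    · exact le_max_of_le_left (by linarith)
    · exact le_max_of_le_right (by linarith)
  -- `τ (a + σ b)` dominates `|a - σ b|`; adding `τ (a - σ b) ≥ 0 - τ (a + σ b)` leaves `τ a ≥ 0`,
  -- so the damping has the favourable sign.
  have hτa : 0 ≤ τ * a r v := by
    have h1 := le_max_left |a r v + b r v| |a r v - b r v|
    have h2 := le_max_right |a r v + b r v| |a r v - b r v|
    rw [hτσ] at h1 h2
    have h3 := abs_le.1 h1
    have h4 := abs_le.1 h2
    rcases hτ with rfl | rfl <;> rcases hσ with rfl | rfl <;> linarith [h3.1, h3.2, h4.1, h4.2]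
  set c := v + σ * k r
  have hv : c - σ * k r = v := by simp [c]
  have hder := ((hd σ hσ c r hr0).const_mul τ).fun_sub
    (((hasDerivAt_id' r).sub_const r₀).const_mul δ)
  rw [hv] at hder
  -- Followed backwards, the characteristic through the maximum point stays in the triangle, so the
  -- derivative along it is nonnegative; yet it equals `-l τ a - δ < 0`.
  have hnn := hder.nonneg_of_le_left hlt (fun s hs => by
    have hs0 : 0 < s := lt_of_lt_of_le hr₀ hs.1
    have hks := hkm hs0 hr0 hs.2
    have hsΔ : (s, c - σ * k s) ∈ Δ := by
      refine hmem s ⟨hs.1, hs.2.trans hP.1.1.2⟩ _ ?_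
      have h1 := hcone _ hP
      have h2 : c - σ * k s - u = (v - u) + σ * (k r - k s) := by simp only [c]; ring
      rw [h2]
      refine (abs_add_le _ _).trans ?_
      have h3 : |σ * (k r - k s)| = k r - k s := by
        rw [abs_mul, abs_of_nonneg (sub_nonneg.2 hks)]
        rcases hσ with rfl | rfl <;> simp
      rw [h3]
      simp only at h1
      linarith
    have h1 := hmax hsΔ
    have h2 := hle (s, c - σ * k s)
    simp only [hN, mem_ofPred_eq] at h1
    rw [hτσ] at h1
    simp only [hv] at h2 ⊢
    linarith)
  have h5 : 0 ≤ l r * (τ * a r v) := mul_nonneg (hl r hr0) hτa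
  nlinarith

namespace IsWaveFamily

variable {p : ℝ → ℝ} {γ κ ρs cs M : ℝ} {f : ℕ → ℝ → ℝ} {z z' : ℕ → ℝ → ℝ → ℝ}

/-- The normalized derivatives of `w = ζ/ρ` are controlled by the data on the vacuum line:
`|w_u| ≤ sup |f'|` and `|w_ρ| ≤ k'(ρ) sup |f'|`. -/
theorem abs_le_of_abs_data_le (hp : IsPressureLaw p γ κ ρs cs M) (hz : IsWaveFamily p f z z')
    {B : ℝ} (hB : ∀ u, |f 1 u| ≤ B) {ρ : ℝ} (hρ : 0 < ρ) (u : ℝ) :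
    |z 1 ρ u / ρ| ≤ B ∧ |(ρ * z' 0 ρ u - z 0 ρ u) / ρ ^ 2| ≤ √(deriv p ρ) / ρ * B := by
  have hγ := hp.one_lt_gamma
  obtain ⟨k, hk0, hkd, -⟩ := hp.exists_antideriv
  -- For `w = z 0 / ρ` these are `a = ρ w_ρ / √p'` and `b = w_u`. The damping rate is `(ρ√p')' /
  -- (ρ√p')`.
  set a : ℝ → ℝ → ℝ := fun r v => (r * z' 0 r v - z 0 r v) / (r * √(deriv p r)) with ha_def
  set b : ℝ → ℝ → ℝ := fun r v => z 1 r v / r with hb_def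
  have hsq : ∀ r, 0 < r → 0 < √(deriv p r) := fun r hr => Real.sqrt_pos.2 (hp.strictly_hyperbolic r hr)
  have hkm : MonotoneOn k (Ioi 0) := by
    refine monotoneOn_of_deriv_nonneg (convex_Ioi 0)
      (fun r hr => (hkd r hr).continuousAt.continuousWithinAt)
      (fun r hr => (hkd r (interior_subset hr)).differentiableAt.differentiableWithinAt) ?_
    intro r hr
    have hr' : 0 < r := interior_subset hr
    rw [(hkd r hr').deriv]
    have := hsq r hr'
    positivity
  choose! d hd0 hdd using fun r (hr : 0 < r) => hp.hasDerivAt_mul_sqrt hr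
  have hchar : ∀ σ : ℝ, (σ = 1 ∨ σ = -1) → ∀ c r, 0 < r →
      HasDerivAt (fun r => a r (c - σ * k r) + σ * b r (c - σ * k r))
        (-(d r / (r * √(deriv p r)) * a r (c - σ * k r))) r := by
    intro σ hσ c r hr
    have hcurve : HasDerivAt (fun r => (r, c - σ * k r)) (1, -(σ * (√(deriv p r) / r))) r := by
      refine (hasDerivAt_id' r).prodMk ?_
      simpa using ((hkd r hr).const_mul σ).const_sub c
    have hα := (hasFDerivAt_alpha hp hz 0 (q := (r, c - σ * k r)) hr).comp_hasDerivAt r hcurve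
    have hβ := (hasFDerivAt_beta hp hz 1 (q := (r, c - σ * k r)) hr).comp_hasDerivAt r hcurve
    have hs := hsq r hr
    have hss : √(deriv p r) ^ 2 = deriv p r := Real.sq_sqrt (hp.strictly_hyperbolic r hr).le
    have hσσ : σ ^ 2 = 1 := by rcases hσ with rfl | rfl <;> norm_num
    have := (hα.fun_div (hdd r hr) (by positivity)).fun_add (hβ.const_mul σ)
    refine this.congr_deriv ?_
    simp only [Function.comp, add_apply, smul_apply,
      ContinuousLinearMap.coe_fst', ContinuousLinearMap.coe_snd', smul_eq_mul, ha_def, zero_add,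
      Nat.reduceAdd]
    generalize z 1 r (c - σ * k r) = z1
    generalize z 2 r (c - σ * k r) = z2
    generalize z' 1 r (c - σ * k r) = z1'
    generalize z' 0 r (c - σ * k r) = z0'
    generalize z 0 r (c - σ * k r) = z0
    generalize √(deriv p r) = s at *
    rw [← hss]
    field_simp
    linear_combination (-(s ^ 3 * z2)) * hσσ
  have hac : ∀ q : ℝ × ℝ, 0 < q.1 → ContinuousAt (fun q : ℝ × ℝ => a q.1 q.2) q := by
    intro q hq
    refine ((hasFDerivAt_alpha hp hz 0 hq).continuousAt).div ?_ (mul_pos hq (hsq _ hq)).ne'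
    exact ContinuousAt.comp (f := Prod.fst) (g := fun r : ℝ => r * √(deriv p r))
      (hdd q.1 hq).continuousAt continuousAt_fst
  have hbc : ∀ q : ℝ × ℝ, 0 < q.1 → ContinuousAt (fun q : ℝ × ℝ => b q.1 q.2) q :=
    fun q hq => (hasFDerivAt_beta hp hz 1 hq).continuousAt
  set R := max ρ (|u| + k ρ)
  obtain ⟨C₁, hC₁, h₁⟩ := abs_alpha_le hp hz 0 R
  obtain ⟨C₂, hC₂, h₂⟩ := abs_beta_sub_le hp hz 1 R
  obtain ⟨c, r₁, hc, hr₁, hlow⟩ := hp.exists_rpow_le_deriv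
  -- The maximum principle is started at a small density `r > 0`, where `a = O(r^((γ-1)/2))` and `b`
  -- is within `O(r^(γ-1))` of the data, locally uniformly in `u`.
  have key : ∀ δ > 0, |a ρ u + b ρ u| ≤ B + δ ∧ |a ρ u - b ρ u| ≤ B + δ := by
    intro δ hδ
    have hlim : Tendsto (fun r : ℝ => C₁ / √c * r ^ ((γ - 1) / 2) + C₂ * r ^ (γ - 1)) (𝓝[>] 0)
        (𝓝 (C₁ / √c * 0 + C₂ * 0)) :=
      ((tendsto_rpow_nhdsGT_zero (by linarith)).const_mul _).add
        ((tendsto_rpow_nhdsGT_zero (by linarith)).const_mul _)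
    rw [mul_zero, mul_zero, add_zero] at hlim
    have hev := (hlim.eventually (gt_mem_nhds hδ)).and
      ((show ∀ᶠ r in 𝓝[>] (0 : ℝ), r ∈ Ioc 0 r₁ from Ioc_mem_nhdsGT hr₁).and
        (show ∀ᶠ r in 𝓝[>] (0 : ℝ), r ∈ Ioc 0 ρ from Ioc_mem_nhdsGT hρ))
    obtain ⟨r, hr, hrr₁, hrρ⟩ := hev.exists
    have hr0 : 0 < r := hrρ.1
    refine abs_le_of_damped_characteristics hac hbc
      (fun r hr => (hkd r hr).continuousAt.continuousWithinAt) hkm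
      (fun r hr => (div_pos (hd0 r hr) (mul_pos hr (hsq r hr))).le) hchar hr0 hrρ.2 ?_
    intro v hv
    have hvR : |v| ≤ R := by
      have := abs_sub_abs_le_abs_sub v u
      exact (by linarith [hk0 r hr0] : |v| ≤ |u| + k ρ).trans (le_max_right _ _)
    have hrR : r ∈ Ioc 0 R := ⟨hr0, hrρ.2.trans (le_max_left _ _)⟩
    have ha' : |a r v| ≤ C₁ / √c * r ^ ((γ - 1) / 2) := by
      have hs := hsq r hr0
      have hlow' : √c * r ^ ((γ - 1) / 2) ≤ √(deriv p r) := by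
        refine Real.le_sqrt_of_sq_le ?_
        rw [mul_pow, Real.sq_sqrt hc.le, ← Real.rpow_natCast, ← Real.rpow_mul hr0.le]
        refine le_trans (le_of_eq ?_) (hlow r hrr₁)
        congr 2; push_cast; ring
      rw [ha_def]
      simp only
      rw [abs_div, abs_of_pos (mul_pos hr0 hs), div_le_iff₀ (mul_pos hr0 hs)]
      refine (h₁ r hrR v hvR).trans ?_
      have hx : 0 < r ^ ((γ - 1) / 2) := Real.rpow_pos_of_pos hr0 _
      have hsc := Real.sqrt_pos.2 hc
      calc C₁ * r ^ γ = C₁ / √c * r ^ ((γ - 1) / 2) * (r * (√c * r ^ ((γ - 1) / 2))) := by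
            have : r ^ γ = r * (r ^ ((γ - 1) / 2) * r ^ ((γ - 1) / 2)) := by
              rw [← Real.rpow_add hr0, ← Real.rpow_one_add' hr0.le (by linarith)]
              congr 1; ring
            rw [this]; field_simp
        _ ≤ _ := by gcongr
    have hb' : |b r v| ≤ B + C₂ * r ^ (γ - 1) := by
      have h3 := h₂ r hrR v hvR
      have h4 := abs_sub_abs_le_abs_sub (z 1 r v / r) (f 1 v)
      have h5 := hB v
      simp only [hb_def]
      linarith
    constructor
    · exact (abs_add_le _ _).trans (by linarith)
    · exact (abs_sub _ _).trans (by linarith)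
  have hfin : |a ρ u + b ρ u| ≤ B ∧ |a ρ u - b ρ u| ≤ B :=
    ⟨le_of_forall_pos_le_add fun δ hδ => (key δ hδ).1,
      le_of_forall_pos_le_add fun δ hδ => (key δ hδ).2⟩
  obtain ⟨h1, h2⟩ := hfin
  rw [abs_le] at h1 h2
  refine ⟨abs_le.2 ⟨by linarith [h1.1, h2.2], by linarith [h1.2, h2.1]⟩, ?_⟩
  have h3 : |a ρ u| ≤ B := abs_le.2 ⟨by linarith [h1.1, h2.1], by linarith [h1.2, h2.2]⟩
  have hs := hsq ρ hρ
  have h4 : (ρ * z' 0 ρ u - z 0 ρ u) / ρ ^ 2 = √(deriv p ρ) / ρ * a ρ u := by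
    simp only [ha_def]
    field_simp
  rw [h4, abs_mul, abs_of_pos (by positivity : 0 < √(deriv p ρ) / ρ)]
  exact mul_le_mul_of_nonneg_left h3 (by positivity)

/-- The entropy equation has no nonzero solution with vanishing data. -/
theorem eq_zero_of_data_eq_zero (hp : IsPressureLaw p γ κ ρs cs M) (hz : IsWaveFamily p f z z')
    (hf : ∀ j u, f j u = 0) {ρ : ℝ} (hρ : 0 < ρ) (u : ℝ) : z 0 ρ u = 0 := by
  have h0 : ∀ r, 0 < r → r * z' 0 r u - z 0 r u = 0 := by
    intro r hr
    have := (abs_le_of_abs_data_le hp hz (B := 0) (fun u => by simp [hf]) hr u).2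
    rw [mul_zero, abs_nonpos_iff, div_eq_zero_iff] at this
    exact this.resolve_right (pow_pos hr 2).ne'
  obtain ⟨C, hC, h⟩ := abs_beta_sub_le hp hz 0 (max ρ |u|)
  have hd : ∀ r, 0 < r → HasDerivAt (fun r => z 0 r u / r) 0 r := by
    intro r hr
    refine ((hz.deriv_rho 0 r u hr).fun_div (hasDerivAt_id' r) hr.ne').congr_deriv ?_
    have := h0 r hr
    field_simp
    linarith
  have hlim : Tendsto (fun r => z 0 r u / r) (𝓝[>] 0) (𝓝 0) := by
    refine squeeze_zero_norm' (a := fun r => C * r ^ (γ - 1)) ?_ ?_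
    · filter_upwards [Ioc_mem_nhdsGT hρ] with r hr
      have := h r ⟨hr.1, hr.2.trans (le_max_left _ _)⟩ u (le_max_right _ _)
      rwa [hf, sub_zero] at this
    · simpa using (tendsto_rpow_nhdsGT_zero (by linarith [hp.one_lt_gamma])).const_mul C
  have := abs_sub_le_of_abs_deriv_le_rpow (R := ρ) (C := 0) (δ := 1) one_pos
    (fun r hr => hd r hr.1) (by simp) hlim ⟨hρ, le_rfl⟩
  rw [sub_zero, zero_div, zero_mul, abs_nonpos_iff, div_eq_zero_iff] at this
  exact this.resolve_right hρ.ne'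

end IsWaveFamily

/-! ### Mollification of the kernels -/

theorem ContDiff.iteratedDeriv_infty {φ : ℝ → ℝ} (hφ : ContDiff ℝ ∞ φ) (j : ℕ) :
    ContDiff ℝ ∞ (iteratedDeriv j φ) := by
  rw [iteratedDeriv_eq_iterate]
  exact ContDiff.iterate_deriv j hφ

theorem HasCompactSupport.iteratedDeriv_real {φ : ℝ → ℝ} (hc : HasCompactSupport φ) (j : ℕ) :
    HasCompactSupport (iteratedDeriv j φ) := by
  induction j with
  | zero => simpa using hc
  | succ j ih => rw [iteratedDeriv_succ]; exact ih.deriv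

/-- The convolution in `u` of `D(ρ,·)` with `φ`. -/
noncomputable def mollify (D : ℝ → ℝ → ℝ) (φ : ℝ → ℝ) (ρ u : ℝ) : ℝ :=
  ∫ v, D ρ v * φ (u - v)

/-- `D` is a solution, in the sense of distributions in `u`, of `D_ρρ = p'(ρ) ρ⁻² D_uu + S` for
`ρ > 0`, with `D = 0` and `D_ρ = c δ_s` at `ρ = 0`. -/
structure IsWeakKernel (p : ℝ → ℝ) (s c : ℝ) (S : (ℝ → ℝ) → ℝ → ℝ) (D : ℝ → ℝ → ℝ) : Prop where
  continuous : ∀ ρ, 0 < ρ → Continuous (D ρ)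
  differentiable : ∀ φ : ℝ → ℝ, ContDiff ℝ ∞ φ → HasCompactSupport φ →
    ∀ ρ, 0 < ρ → DifferentiableAt ℝ (fun r => ∫ u, D r u * φ u) ρ
  equation : ∀ φ : ℝ → ℝ, ContDiff ℝ ∞ φ → HasCompactSupport φ →
    ∀ ρ, 0 < ρ → HasDerivAt (deriv fun r => ∫ u, D r u * φ u)
      (deriv p ρ / ρ ^ 2 * (∫ u, D ρ u * iteratedDeriv 2 φ u) + S φ ρ) ρ
  initial : ∀ φ : ℝ → ℝ, ContDiff ℝ ∞ φ → HasCompactSupport φ →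
    Tendsto (fun r => ∫ u, D r u * φ u) (𝓝[>] 0) (𝓝 0)
  initial_deriv : ∀ φ : ℝ → ℝ, ContDiff ℝ ∞ φ → HasCompactSupport φ →
    Tendsto (deriv fun r => ∫ u, D r u * φ u) (𝓝[>] 0) (𝓝 (c * φ s))

theorem IsEntropyKernel.isWeakKernel {p : ℝ → ℝ} {χ : ℝ → ℝ → ℝ → ℝ} (hχ : IsEntropyKernel p χ)
    (s : ℝ) : IsWeakKernel p s 1 (fun _ _ => 0) (fun ρ u => χ ρ u s) where
  continuous ρ hρ := (hχ.continuous ρ hρ).comp (continuous_id.prodMk continuous_const)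
  differentiable := hχ.differentiable s
  equation φ h1 h2 ρ hρ := by simpa using hχ.equation s φ h1 h2 ρ hρ
  initial := hχ.initial s
  initial_deriv φ h1 h2 := by simpa using hχ.initial_deriv s φ h1 h2

theorem IsEntropyFluxKernel.isWeakKernel {p : ℝ → ℝ} {χ σ : ℝ → ℝ → ℝ → ℝ}
    (hχ : IsEntropyKernel p χ) (hσ : IsEntropyFluxKernel p χ σ) (s : ℝ) :
    IsWeakKernel p s 0 (fun φ ρ => -(deriv (deriv p) ρ / ρ * ∫ u, χ ρ u s * deriv φ u))
      (fun ρ u => σ ρ u s - u * χ ρ u s) where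
  continuous ρ hρ := ((hσ.continuous ρ hρ).comp (continuous_id.prodMk continuous_const)).sub
    (continuous_id.mul ((hχ.continuous ρ hρ).comp (continuous_id.prodMk continuous_const)))
  differentiable := hσ.differentiable s
  equation φ h1 h2 ρ hρ := by simpa [sub_eq_add_neg] using hσ.equation s φ h1 h2 ρ hρ
  initial := hσ.initial s
  initial_deriv φ h1 h2 := by simpa using hσ.initial_deriv s φ h1 h2

theorem ContDiff.comp_const_sub {φ : ℝ → ℝ} (hφ : ContDiff ℝ ∞ φ) (u : ℝ) :
    ContDiff ℝ ∞ fun v => φ (u - v) := hφ.comp (contDiff_const.sub contDiff_id)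

theorem HasCompactSupport.comp_const_sub {φ : ℝ → ℝ} (hc : HasCompactSupport φ) (u : ℝ) :
    HasCompactSupport fun v => φ (u - v) :=
  hc.comp_homeomorph (Homeomorph.subLeft u)

namespace IsWeakKernel

variable {p : ℝ → ℝ} {s c : ℝ} {S : (ℝ → ℝ) → ℝ → ℝ} {D : ℝ → ℝ → ℝ}
  (hD : IsWeakKernel p s c S D) {φ : ℝ → ℝ} (hφ : ContDiff ℝ ∞ φ) (hc : HasCompactSupport φ)
include hD hφ hc

theorem mollify_deriv_u {ρ : ℝ} (hρ : 0 < ρ) (u : ℝ) :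
    HasDerivAt (mollify D φ ρ) (mollify D (deriv φ) ρ u) u := by
  have := hc.hasDerivAt_convolution_right (ContinuousLinearMap.mul ℝ ℝ)
    (hD.continuous ρ hρ).locallyIntegrable (μ := volume) (hφ.of_le (by simp)) u
  exact this

theorem mollify_deriv_rho {ρ : ℝ} (hρ : 0 < ρ) (u : ℝ) :
    HasDerivAt (fun r => mollify D φ r u) (deriv (fun r => mollify D φ r u) ρ) ρ :=
  (hD.differentiable _ (hφ.comp_const_sub u) (hc.comp_const_sub u) ρ hρ).hasDerivAt

theorem mollify_deriv_rho' {ρ : ℝ} (hρ : 0 < ρ) (u : ℝ) :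
    HasDerivAt (fun r => deriv (fun r => mollify D φ r u) r)
      (deriv p ρ / ρ ^ 2 * mollify D (iteratedDeriv 2 φ) ρ u + S (fun v => φ (u - v)) ρ) ρ := by
  have := hD.equation _ (hφ.comp_const_sub u) (hc.comp_const_sub u) ρ hρ
  refine this.congr_deriv ?_
  rw [iteratedDeriv_comp_const_sub]
  simp [mollify]

theorem mollify_init (u : ℝ) :
    Tendsto (fun r => deriv (fun r => mollify D φ r u) r) (𝓝[>] 0) (𝓝 (c * φ (u - s))) :=
  hD.initial_deriv _ (hφ.comp_const_sub u) (hc.comp_const_sub u)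

theorem mollify_tendsto_zero (u : ℝ) : Tendsto (fun r => mollify D φ r u) (𝓝[>] 0) (𝓝 0) :=
  hD.initial _ (hφ.comp_const_sub u) (hc.comp_const_sub u)

theorem abs_integral_le (R : ℝ) : ∃ C, ∀ ρ ∈ Ioc 0 R, |∫ v, D ρ v * φ v| ≤ C * ρ := by
  set g := fun r => ∫ v, D r v * φ v
  -- The `ρ`-derivative converges at the vacuum, so it is eventually bounded by its limit plus `1`;
  -- integration from `0` then gives linear growth.
  have hev : ∀ᶠ r in 𝓝[>] (0 : ℝ), |deriv g r| < |c * φ s| + 1 :=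
    (hD.initial_deriv φ hφ hc).abs.eventually (gt_mem_nhds (by linarith))
  obtain ⟨r₁, hr₁, hsub⟩ := mem_nhdsGT_iff_exists_Ioo_subset.1 hev
  rw [mem_Ioi] at hr₁
  have hcont : ContinuousOn g (Ioi 0) := fun r hr =>
    (hD.differentiable φ hφ hc r hr).continuousAt.continuousWithinAt
  have hb : ∀ ρ ∈ Ioo 0 (r₁ / 2), |g ρ| ≤ (|c * φ s| + 1) * ρ ^ (1 : ℝ) := by
    intro ρ hρ
    have := abs_sub_le_of_abs_deriv_le_rpow (R := r₁ / 2) (C := |c * φ s| + 1) (δ := 1) one_pos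
      (fun r hr => (hD.differentiable φ hφ hc r hr.1).hasDerivAt)
      (fun r hr => by
        have h1 : r ∈ Ioo 0 r₁ := ⟨hr.1, by linarith [hr.2]⟩
        rw [sub_self, Real.rpow_zero, mul_one]
        exact le_of_lt (hsub h1))
      (hD.initial φ hφ hc) ⟨hρ.1, hρ.2.le⟩
    simpa using this
  obtain ⟨C, hC, h⟩ := hcont.exists_abs_le_mul_rpow (a := 1) (r₁ := r₁ / 2)
    (C₁ := |c * φ s| + 1) (by positivity) hb R
  exact ⟨C, fun ρ hρ => by simpa using h ρ hρ⟩

/-- Uniform boundedness applied to the family `D ρ / ρ`, `0 < ρ ≤ R`, whose pairing with each fixed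
test function is bounded. -/
theorem mollify_bound (R : ℝ) : ∃ C, 0 ≤ C ∧ ∀ ρ ∈ Ioc 0 R, ∀ u, |u| ≤ R →
    |mollify D φ ρ u| ≤ C * ρ := by
  have h1 : ∀ (ρ : ℝ) (Φ : ℝ → ℝ), ∫ v, D ρ v / ρ * Φ v = (∫ v, D ρ v * Φ v) / ρ := by
    intro ρ Φ
    rw [← integral_div]; congr 1; ext v; ring
  obtain ⟨C, hC⟩ := exists_bound_integral_mul_translate (I := Ioc (0 : ℝ) R)
    (D := fun ρ v => D ρ v / ρ) (fun ρ => (hD.continuous ρ ρ.2.1).div_const _)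
    (fun Φ h2 h3 => by
      obtain ⟨C, hC⟩ := hD.abs_integral_le h2 h3 R
      refine ⟨C, fun ρ => ?_⟩
      have hpos : 0 < (ρ : ℝ) := ρ.2.1
      rw [h1, abs_div, abs_of_pos hpos, div_le_iff₀ hpos]
      exact hC ρ ρ.2) hφ hc R
  refine ⟨max C 0, le_max_right _ _, fun ρ hρ u hu => ?_⟩
  have := hC ⟨ρ, hρ⟩ u hu
  simp only at this
  rw [h1 ρ fun v => φ (u - v), abs_div, abs_of_pos hρ.1, div_le_iff₀ hρ.1] at this
  exact this.trans (mul_le_mul_of_nonneg_right (le_max_left _ _) hρ.1.le)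

end IsWeakKernel

theorem IsWeakKernel.isWaveFamily {p : ℝ → ℝ} {s c : ℝ} {D : ℝ → ℝ → ℝ}
    (hD : IsWeakKernel p s c (fun _ _ => 0) D) {φ : ℝ → ℝ} (hφ : ContDiff ℝ ∞ φ)
    (hc : HasCompactSupport φ) :
    IsWaveFamily p (fun j u => c * iteratedDeriv j φ (u - s))
      (fun j => mollify D (iteratedDeriv j φ))
      (fun j ρ u => deriv (fun r => mollify D (iteratedDeriv j φ) r u) ρ) where
  deriv_u j ρ u hρ := by
    rw [iteratedDeriv_succ]
    exact hD.mollify_deriv_u (hφ.iteratedDeriv_infty j) (hc.iteratedDeriv_real j) hρ u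
  deriv_rho j ρ u hρ :=
    hD.mollify_deriv_rho (hφ.iteratedDeriv_infty j) (hc.iteratedDeriv_real j) hρ u
  deriv_rho' j ρ u hρ := by
    have := hD.mollify_deriv_rho' (hφ.iteratedDeriv_infty j) (hc.iteratedDeriv_real j) hρ u
    rw [add_zero] at this
    have e1 : iteratedDeriv 2 (iteratedDeriv j φ) = iteratedDeriv (j + 2) φ := by
      rw [iteratedDeriv_eq_iterate, iteratedDeriv_eq_iterate, iteratedDeriv_eq_iterate,
        ← Function.iterate_add_apply, add_comm]
    rw [e1] at this
    exact this
  bound j R := hD.mollify_bound (hφ.iteratedDeriv_infty j) (hc.iteratedDeriv_real j) R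
  init j u := hD.mollify_init (hφ.iteratedDeriv_infty j) (hc.iteratedDeriv_real j) u
  deriv_data j u := by
    have h1 := ((hφ.iteratedDeriv_infty j).differentiable (by simp) (u - s)).hasDerivAt
    rw [← iteratedDeriv_succ] at h1
    have h2 := (h1.comp u ((hasDerivAt_id' u).sub_const s)).const_mul c
    simpa using! h2

theorem IsWaveFamily.comp_sub {p : ℝ → ℝ} {f : ℕ → ℝ → ℝ} {z z' : ℕ → ℝ → ℝ → ℝ}
    (hz : IsWaveFamily p f z z') (s : ℝ) :
    IsWaveFamily p (fun j u => f j (u - s)) (fun j ρ u => z j ρ (u - s))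
      (fun j ρ u => z' j ρ (u - s)) where
  deriv_u j ρ u hρ := by
    simpa using! (hz.deriv_u j ρ (u - s) hρ).comp u ((hasDerivAt_id' u).sub_const s)
  deriv_rho j ρ u hρ := hz.deriv_rho j ρ (u - s) hρ
  deriv_rho' j ρ u hρ := hz.deriv_rho' j ρ (u - s) hρ
  bound j R := by
    obtain ⟨C, hC, h⟩ := hz.bound j (R + |s|)
    refine ⟨C, hC, fun ρ hρ u hu => h ρ ⟨hρ.1, hρ.2.trans (by linarith [abs_nonneg s])⟩ _ ?_⟩
    exact (abs_sub _ _).trans (by linarith)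
  init j u := hz.init j (u - s)
  deriv_data j u := by
    simpa using! (hz.deriv_data j (u - s)).comp u ((hasDerivAt_id' u).sub_const s)

theorem eq_of_integral_mul_eq {g₁ g₂ : ℝ → ℝ} (h₁ : Continuous g₁) (h₂ : Continuous g₂)
    (h : ∀ φ : ℝ → ℝ, ContDiff ℝ ∞ φ → HasCompactSupport φ →
      ∫ v, g₁ v * φ v = ∫ v, g₂ v * φ v) : g₁ = g₂ := by
  refine (h₁.ae_eq_iff_eq (μ := volume) h₂).1 ?_
  refine ae_eq_of_integral_contDiff_smul_eq h₁.locallyIntegrable h₂.locallyIntegrable ?_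
  intro φ hφ hc
  simpa [mul_comm] using h φ hφ hc

theorem mollify_translate (D : ℝ → ℝ → ℝ) (φ : ℝ → ℝ) (ρ u s : ℝ) :
    mollify (fun ρ v => D ρ (v - s)) φ ρ u = mollify D φ ρ (u - s) := by
  unfold mollify
  rw [← integral_sub_right_eq_self (fun v => D ρ v * φ (u - s - v)) s]
  congr 1; ext v; congr 2; ring

section Kernels

variable {p : ℝ → ℝ} {γ κ ρs cs M : ℝ} (hp : IsPressureLaw p γ κ ρs cs M) {χ σ : ℝ → ℝ → ℝ → ℝ}
  (hχ : IsEntropyKernel p χ)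
include hp hχ

/-- Both sides solve the entropy equation with the same data `φ(u - s)` at the vacuum, and such
solutions are unique. -/
theorem IsEntropyKernel.mollify_translate {φ : ℝ → ℝ} (hφ : ContDiff ℝ ∞ φ)
    (hc : HasCompactSupport φ) (s : ℝ) {ρ : ℝ} (hρ : 0 < ρ) (u : ℝ) :
    mollify (fun ρ v => χ ρ v s) φ ρ u = mollify (fun ρ v => χ ρ v 0) φ ρ (u - s) := by
  have h1 := (hχ.isWeakKernel s).isWaveFamily hφ hc
  have h2 := ((hχ.isWeakKernel 0).isWaveFamily hφ hc).comp_sub s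
  have := (h1.sub h2).eq_zero_of_data_eq_zero hp (fun j u => by simp) hρ u
  simp only [iteratedDeriv_zero] at this
  linarith

/-- Galilean invariance of the entropy kernel. -/
theorem IsEntropyKernel.eq_translate {ρ : ℝ} (hρ : 0 < ρ) (u s : ℝ) : χ ρ u s = χ ρ (u - s) 0 := by
  have c1 := (hχ.isWeakKernel s).continuous ρ hρ
  have c2 : Continuous fun v => χ ρ (v - s) 0 :=
    ((hχ.isWeakKernel 0).continuous ρ hρ).comp (continuous_id.sub continuous_const)
  refine congrFun (eq_of_integral_mul_eq c1 c2 fun φ hφ hc => ?_) u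
  -- With the reflected test function, the mollification at `u = 0` is the plain pairing with `φ`.
  have h := IsEntropyKernel.mollify_translate hp hχ (φ := fun v => φ (0 - v)) (hφ.comp_const_sub 0)
    (hc.comp_const_sub 0) s hρ 0
  rw [← _root_.mollify_translate (fun ρ v => χ ρ v 0)] at h
  simpa [mollify] using h

/-- By Galilean invariance the generated entropy is a convolution with `ψ`, so its `u`-derivatives
fall on `ψ`. -/
theorem IsEntropyKernel.generatedFunction_eq (ψ : ℝ → ℝ) {ρ : ℝ} (hρ : 0 < ρ) (u : ℝ) :
    generatedFunction χ ψ ρ u = mollify (fun ρ v => χ ρ v 0) ψ ρ u := by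
  unfold generatedFunction mollify
  simp_rw [fun s => IsEntropyKernel.eq_translate hp hχ hρ u s]
  rw [← integral_sub_left_eq_self (fun v => χ ρ v 0 * ψ (u - v)) volume u]
  congr 1; ext s
  rw [sub_sub_cancel, mul_comm]

variable (hσ : IsEntropyFluxKernel p χ σ)
include hσ

/-- The derivatives of the mollified `h = σ - uχ` in terms of the mollified entropy kernel. -/
theorem IsEntropyFluxKernel.mollify_deriv {φ : ℝ → ℝ} (hφ : ContDiff ℝ ∞ φ)
    (hc : HasCompactSupport φ) (s : ℝ) {ρ : ℝ} (hρ : 0 < ρ) (u : ℝ) :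
    HasDerivAt (fun r => mollify (fun ρ u => σ ρ u s - u * χ ρ u s) φ r u)
      (deriv p ρ / ρ * mollify (fun ρ v => χ ρ v s) (deriv φ) ρ u) ρ ∧
    HasDerivAt (mollify (fun ρ u => σ ρ u s - u * χ ρ u s) φ ρ)
      (ρ * deriv (fun r => mollify (fun ρ v => χ ρ v s) φ r u) ρ
        - mollify (fun ρ v => χ ρ v s) φ ρ u) u := by
  have hD := IsEntropyFluxKernel.isWeakKernel hχ hσ s
  have hγ := hp.one_lt_gamma
  set D := fun ρ u => σ ρ u s - u * χ ρ u s
  have hz := (hχ.isWeakKernel s).isWaveFamily hφ hc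
  set z : ℕ → ℝ → ℝ → ℝ := fun j => mollify (fun ρ v => χ ρ v s) (iteratedDeriv j φ) with hz_def
  set z' : ℕ → ℝ → ℝ → ℝ := fun j ρ u => deriv (fun r => z j r u) ρ with hz'_def
  set H : ℕ → ℝ → ℝ → ℝ := fun j => mollify D (iteratedDeriv j φ) with hH_def
  set H' : ℕ → ℝ → ℝ → ℝ := fun j ρ u => deriv (fun r => H j r u) ρ with hH'_def
  have hHρ' : ∀ j ρ u, 0 < ρ → HasDerivAt (fun r => H' j r u)
      (deriv p ρ / ρ ^ 2 * H (j + 2) ρ u + deriv (deriv p) ρ / ρ * z (j + 1) ρ u) ρ := by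
    intro j ρ u hρ
    refine (hD.mollify_deriv_rho' (hφ.iteratedDeriv_infty j) (hc.iteratedDeriv_real j) hρ u
      ).congr_deriv ?_
    have e1 : iteratedDeriv 2 (iteratedDeriv j φ) = iteratedDeriv (j + 2) φ := by
      rw [iteratedDeriv_eq_iterate, iteratedDeriv_eq_iterate, iteratedDeriv_eq_iterate,
        ← Function.iterate_add_apply, add_comm]
    have e2 : ∀ v, deriv (fun v => iteratedDeriv j φ (u - v)) v
        = -iteratedDeriv (j + 1) φ (u - v) := by
      intro v
      rw [iteratedDeriv_succ, deriv_comp_const_sub]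
    rw [e1]
    simp only [e2, mul_neg, integral_neg, neg_neg, hH_def, hz_def, mollify]
  -- `ρ z_ρ - z` satisfies the same inhomogeneous equation as `H_u`: its second `ρ`-derivative
  -- produces exactly the source `p'' z_uu / ρ`. The difference is a homogeneous solution with zero
  -- data.
  have hfam : IsWaveFamily p (fun _ _ => 0) (fun j ρ u => H (j + 1) ρ u - (ρ * z' j ρ u - z j ρ u))
      (fun j ρ u => H' (j + 1) ρ u - deriv p ρ / ρ * z (j + 2) ρ u) :=
    { deriv_u := fun j ρ u hρ => by
        have h1 := hD.mollify_deriv_u (hφ.iteratedDeriv_infty (j + 1))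
          (hc.iteratedDeriv_real (j + 1)) hρ u
        rw [← iteratedDeriv_succ] at h1
        exact h1.fun_sub (((IsWaveFamily.deriv_u' hp hz j ρ u hρ).const_mul ρ).fun_sub
          (hz.deriv_u j ρ u hρ))
      deriv_rho := fun j ρ u hρ =>
        (hD.mollify_deriv_rho (hφ.iteratedDeriv_infty (j + 1)) (hc.iteratedDeriv_real (j + 1)) hρ
          u).fun_sub (hz.hasDerivAt_alpha j u hρ)
      deriv_rho' := fun j ρ u hρ => by
        refine ((hHρ' (j + 1) ρ u hρ).fun_sub (((hp.hasDerivAt_deriv hρ).fun_div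
          (hasDerivAt_id' ρ) hρ.ne').fun_mul (hz.deriv_rho (j + 2) ρ u hρ))).congr_deriv ?_
        simp only [hz'_def]
        field_simp
        ring
      bound := fun j R => by
        obtain ⟨C₁, hC₁, h₁⟩ := hD.mollify_bound (hφ.iteratedDeriv_infty (j + 1))
          (hc.iteratedDeriv_real (j + 1)) R
        obtain ⟨C₂, hC₂, h₂⟩ := IsWaveFamily.abs_alpha_le hp hz j R
        refine ⟨C₁ + C₂ * |R| ^ (γ - 1), by positivity, fun ρ hρ u hu => ?_⟩
        refine (abs_sub _ _).trans ?_
        rw [add_mul]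
        refine add_le_add (h₁ ρ hρ u hu) ((h₂ ρ hρ u hu).trans ?_)
        have e : ρ ^ γ = ρ ^ (γ - 1) * ρ := by
          rw [Real.rpow_sub_one hρ.1.ne', div_mul_cancel₀ _ hρ.1.ne']
        have h3 : ρ ^ (γ - 1) ≤ |R| ^ (γ - 1) :=
          Real.rpow_le_rpow hρ.1.le (hρ.2.trans (le_abs_self R)) (by linarith)
        rw [e, mul_assoc]
        have := hρ.1
        gcongr
      init := fun j u => by
        have h1 := hD.mollify_init (hφ.iteratedDeriv_infty (j + 1))
          (hc.iteratedDeriv_real (j + 1)) u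
        rw [zero_mul] at h1
        have h2 : Tendsto (fun r => deriv p r / r * z (j + 2) r u) (𝓝[>] 0) (𝓝 0) := by
          obtain ⟨C, hC, h⟩ := IsWaveFamily.abs_deriv_rho'_le hp hz (j + 2) (max 1 |u|)
          refine squeeze_zero_norm' (a := fun r : ℝ => C * r ^ (γ - 1)) ?_ ?_
          · filter_upwards [Ioc_mem_nhdsGT one_pos] with r hr
            have hr0 := hr.1
            have h3 := h r ⟨hr.1, hr.2.trans (le_max_left _ _)⟩ u (le_max_right _ _)
            rw [Real.rpow_sub_one hr0.ne'] at h3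
            have e : deriv p r / r * z (j + 2) r u
                = deriv p r / r ^ 2 * z (j + 2) r u * r := by field_simp
            rw [e, norm_mul, Real.norm_eq_abs, Real.norm_eq_abs, abs_of_pos hr0]
            calc _ ≤ C * (r ^ (γ - 1) / r) * r := by gcongr
              _ = _ := by field_simp
          · simpa using (tendsto_rpow_nhdsGT_zero (by linarith)).const_mul C
        have h3 := h1.sub h2
        rw [sub_zero] at h3
        exact h3
      deriv_data := fun j u => hasDerivAt_const u 0 }
  have hα : ∀ j ρ u, 0 < ρ → H (j + 1) ρ u = ρ * z' j ρ u - z j ρ u := by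
    intro j ρ u hρ
    -- Shifting the index by `j` places the wanted identity at index `0`, where uniqueness is
    -- stated.
    have hfam' : IsWaveFamily p (fun _ _ => 0)
        (fun i ρ u => H (i + j + 1) ρ u - (ρ * z' (i + j) ρ u - z (i + j) ρ u))
        (fun i ρ u => H' (i + j + 1) ρ u - deriv p ρ / ρ * z (i + j + 2) ρ u) :=
      { deriv_u := fun i ρ u hρ => by
          have := hfam.deriv_u (i + j) ρ u hρ
          rwa [show i + j + 1 = i + 1 + j by ring] at this ⊢
        deriv_rho := fun i => hfam.deriv_rho (i + j)
        deriv_rho' := fun i ρ u hρ => by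
          have := hfam.deriv_rho' (i + j) ρ u hρ
          rwa [show i + j + 2 = i + 2 + j by ring] at this ⊢
        bound := fun i => hfam.bound (i + j)
        init := fun i => hfam.init (i + j)
        deriv_data := fun i => hfam.deriv_data (i + j) }
    have := hfam'.eq_zero_of_data_eq_zero hp (fun _ _ => rfl) hρ u
    simp only [zero_add] at this
    linarith
  constructor
  · have hd : ∀ r, 0 < r → HasDerivAt (fun r => H' 0 r u - deriv p r / r * z 1 r u) 0 r := by
      intro r hr
      refine ((hHρ' 0 r u hr).fun_sub (((hp.hasDerivAt_deriv hr).fun_div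
          (hasDerivAt_id' r) hr.ne').fun_mul (hz.deriv_rho 1 r u hr))).congr_deriv ?_
      have := hα 1 r u hr
      simp only [Nat.reduceAdd, zero_add] at this ⊢
      rw [this]
      simp only [hz'_def]
      field_simp
      ring
    have hlim : Tendsto (fun r => H' 0 r u - deriv p r / r * z 1 r u) (𝓝[>] 0) (𝓝 0) := by
      have h1 := hD.mollify_init (hφ.iteratedDeriv_infty 0) (hc.iteratedDeriv_real 0) u
      rw [zero_mul] at h1
      have h2 : Tendsto (fun r => deriv p r / r * z 1 r u) (𝓝[>] 0) (𝓝 0) := by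
        obtain ⟨C, hC, h⟩ := IsWaveFamily.abs_deriv_rho'_le hp hz 1 (max 1 |u|)
        refine squeeze_zero_norm' (a := fun r : ℝ => C * r ^ (γ - 1)) ?_ ?_
        · filter_upwards [Ioc_mem_nhdsGT one_pos] with r hr
          have hr0 := hr.1
          have h3 := h r ⟨hr.1, hr.2.trans (le_max_left _ _)⟩ u (le_max_right _ _)
          rw [Real.rpow_sub_one hr0.ne'] at h3
          have e : deriv p r / r * z 1 r u = deriv p r / r ^ 2 * z 1 r u * r := by field_simp
          rw [e, norm_mul, Real.norm_eq_abs, Real.norm_eq_abs, abs_of_pos hr0]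
          calc _ ≤ C * (r ^ (γ - 1) / r) * r := by gcongr
            _ = _ := by field_simp
        · simpa using (tendsto_rpow_nhdsGT_zero (by linarith)).const_mul C
      have h3 := h1.sub h2
      rw [sub_zero] at h3
      exact h3
    have h3 := abs_sub_le_of_abs_deriv_le_rpow (R := ρ) (C := 0) (δ := 1) one_pos
      (fun r hr => hd r hr.1) (by simp) hlim ⟨hρ, le_rfl⟩
    rw [sub_zero, zero_div, zero_mul, abs_nonpos_iff, sub_eq_zero] at h3
    have h4 := hD.mollify_deriv_rho hφ hc hρ u
    refine h4.congr_deriv ?_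
    simpa [hz_def, hH'_def, hH_def, iteratedDeriv_one] using h3
  · have h1 := hD.mollify_deriv_u hφ hc hρ u
    refine h1.congr_deriv ?_
    simpa [hz_def, hz'_def, hH_def, iteratedDeriv_one] using hα 0 ρ u hρ

/-- It is `h = σ - uχ`, not `σ`, that is Galilean invariant: after mollification, the
`ρ`-derivatives of the two sides agree by invariance of `χ`, and both sides vanish at the vacuum. -/
theorem IsEntropyFluxKernel.eq_translate {ρ : ℝ} (hρ : 0 < ρ) (u s : ℝ) :
    σ ρ u s - u * χ ρ u s = σ ρ (u - s) 0 - (u - s) * χ ρ (u - s) 0 := by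
  have hDs := IsEntropyFluxKernel.isWeakKernel hχ hσ s
  have hD0 := IsEntropyFluxKernel.isWeakKernel hχ hσ 0
  have c2 : Continuous fun v => (fun u => σ ρ u 0 - u * χ ρ u 0) (v - s) :=
    (hD0.continuous ρ hρ).comp (continuous_id.sub continuous_const)
  refine congrFun (eq_of_integral_mul_eq (hDs.continuous ρ hρ) c2 fun φ hφ hc => ?_) u
  have hφ' := hφ.comp_const_sub 0
  have hc' := hc.comp_const_sub 0
  set φ' := fun v => φ (0 - v)
  have hd : ∀ r, 0 < r → HasDerivAt
      (fun r => mollify (fun ρ u => σ ρ u s - u * χ ρ u s) φ' r 0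
        - mollify (fun ρ u => σ ρ u 0 - u * χ ρ u 0) φ' r (0 - s)) 0 r := by
    intro r hr
    refine ((IsEntropyFluxKernel.mollify_deriv hp hχ hσ hφ' hc' s hr 0).1.fun_sub
      (IsEntropyFluxKernel.mollify_deriv hp hχ hσ hφ' hc' 0 hr (0 - s)).1).congr_deriv ?_
    have hd1 : ContDiff ℝ ∞ (deriv φ') := by simpa using hφ'.iteratedDeriv_infty 1
    rw [IsEntropyKernel.mollify_translate hp hχ hd1 hc'.deriv s hr 0]
    ring
  have hlim := (hDs.mollify_tendsto_zero hφ' hc' 0).sub (hD0.mollify_tendsto_zero hφ' hc' (0 - s))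
  rw [sub_zero] at hlim
  have h3 := abs_sub_le_of_abs_deriv_le_rpow (R := ρ) (C := 0) (δ := 1) one_pos
    (fun r hr => hd r hr.1) (by simp) hlim ⟨hρ, le_rfl⟩
  rw [sub_zero, zero_div, zero_mul, abs_nonpos_iff, sub_eq_zero,
    ← _root_.mollify_translate (fun ρ u => σ ρ u 0 - u * χ ρ u 0)] at h3
  simpa [mollify, φ'] using h3

theorem IsEntropyFluxKernel.generatedFunction_eq {ψ : ℝ → ℝ} (hψ : Continuous ψ)
    (hψc : HasCompactSupport ψ) {ρ : ℝ} (hρ : 0 < ρ) (u : ℝ) :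
    generatedFunction σ ψ ρ u = mollify (fun ρ u => σ ρ u 0 - u * χ ρ u 0) ψ ρ u
      + u * generatedFunction χ ψ ρ u := by
  have e : ∀ s, ψ s * σ ρ u s
      = (σ ρ (u - s) 0 - (u - s) * χ ρ (u - s) 0) * ψ s + u * (ψ s * χ ρ u s) := by
    intro s
    rw [← IsEntropyFluxKernel.eq_translate hp hχ hσ hρ u s]; ring
  have c1 : Continuous fun s => σ ρ (u - s) 0 - (u - s) * χ ρ (u - s) 0 :=
    ((IsEntropyFluxKernel.isWeakKernel hχ hσ 0).continuous ρ hρ).comp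
      (continuous_const.sub continuous_id)
  have c2 : Continuous fun s => χ ρ u s :=
    (hχ.continuous ρ hρ).comp (continuous_const.prodMk continuous_id)
  unfold generatedFunction mollify
  simp_rw [e]
  rw [integral_add, integral_const_mul,
    ← integral_sub_left_eq_self (fun v => (σ ρ v 0 - v * χ ρ v 0) * ψ (u - v)) volume u]
  · simp
  · exact (c1.mul hψ).integrable_of_hasCompactSupport hψc.mul_left
  · exact ((hψ.mul c2).integrable_of_hasCompactSupport hψc.mul_right).const_mul u

end Kernels

/-! ### Weak entropy pairs generated by test functions -/

theorem abs_sub_le_of_abs_deriv_le_deriv {F F' K K' : ℝ → ℝ} {l : ℝ}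
    (hF : ∀ r, 0 < r → HasDerivAt F (F' r) r) (hK : ∀ r, 0 < r → HasDerivAt K (K' r) r)
    (hb : ∀ r, 0 < r → |F' r| ≤ K' r) (hl : Tendsto F (𝓝[>] 0) (𝓝 l))
    (hK0 : Tendsto K (𝓝[>] 0) (𝓝 0)) {ρ : ℝ} (hρ : 0 < ρ) : |F ρ - l| ≤ K ρ := by
  have key : ∀ (G G' : ℝ → ℝ) (m : ℝ), (∀ r, 0 < r → HasDerivAt G (G' r) r) →
      (∀ r, 0 < r → 0 ≤ G' r) → Tendsto G (𝓝[>] 0) (𝓝 m) → m ≤ G ρ := by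
    intro G G' m hG hG' hm
    have hmono : MonotoneOn G (Ioi 0) := by
      refine monotoneOn_of_deriv_nonneg (convex_Ioi 0)
        (fun r hr => (hG r hr).continuousAt.continuousWithinAt) ?_ ?_
      · rw [interior_Ioi]
        exact fun r hr => (hG r hr).differentiableAt.differentiableWithinAt
      · rw [interior_Ioi]
        intro r hr
        rw [(hG r hr).deriv]
        exact hG' r hr
    refine le_of_tendsto hm ?_
    filter_upwards [Ioc_mem_nhdsGT hρ] with r hr
    exact hmono hr.1 hρ hr.2
  have h1 := key (fun r => K r - F r) _ _ (fun r hr => (hK r hr).fun_sub (hF r hr))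
    (fun r hr => by linarith [(abs_le.1 (hb r hr)).2]) (hK0.sub hl)
  have h2 := key (fun r => K r + F r) _ _ (fun r hr => (hK r hr).fun_add (hF r hr))
    (fun r hr => by linarith [(abs_le.1 (hb r hr)).1]) (hK0.add hl)
  rw [abs_le]
  constructor <;> linarith

section

variable {p : ℝ → ℝ} {γ κ ρs cs M : ℝ} (hp : IsPressureLaw p γ κ ρs cs M)
include hp

/-- The bound `|w_ρ| ≤ k' B` integrates from the vacuum, where `w = f 0`, to `|w| ≤ B (1 + k)`. -/
theorem IsWaveFamily.abs_le_of_abs_data_le' {f : ℕ → ℝ → ℝ} {z z' : ℕ → ℝ → ℝ → ℝ}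
    (hz : IsWaveFamily p f z z') {k : ℝ → ℝ}
    (hk : ∀ ρ, 0 < ρ → HasDerivAt k (√(deriv p ρ) / ρ) ρ) (hk0 : Tendsto k (𝓝[>] 0) (𝓝 0))
    {B : ℝ} (h0 : ∀ u, |f 0 u| ≤ B) (h1 : ∀ u, |f 1 u| ≤ B) {ρ : ℝ} (hρ : 0 < ρ) (u : ℝ) :
    |z 0 ρ u| ≤ B * (ρ * (1 + k ρ)) := by
  have hd : ∀ r, 0 < r → HasDerivAt (fun r => z 0 r u / r)
      ((r * z' 0 r u - z 0 r u) / r ^ 2) r := by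
    intro r hr
    refine ((hz.deriv_rho 0 r u hr).fun_div (hasDerivAt_id' r) hr.ne').congr_deriv ?_
    ring
  have hl : Tendsto (fun r => z 0 r u / r) (𝓝[>] 0) (𝓝 (f 0 u)) := by
    obtain ⟨C, hC, h⟩ := IsWaveFamily.abs_beta_sub_le hp hz 0 (max 1 |u|)
    rw [tendsto_iff_norm_sub_tendsto_zero]
    refine squeeze_zero_norm' (a := fun r : ℝ => C * r ^ (γ - 1)) ?_ ?_
    · filter_upwards [Ioc_mem_nhdsGT one_pos] with r hr
      simpa using h r ⟨hr.1, hr.2.trans (le_max_left _ _)⟩ u (le_max_right _ _)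
    · simpa using (tendsto_rpow_nhdsGT_zero (by linarith [hp.one_lt_gamma])).const_mul C
  have h2 := abs_sub_le_of_abs_deriv_le_deriv hd (fun r hr => (hk r hr).mul_const B)
    (fun r hr => (IsWaveFamily.abs_le_of_abs_data_le hp hz h1 hr u).2) hl
    (by simpa using hk0.mul_const B) hρ
  have h3 : |z 0 ρ u / ρ| ≤ B * (1 + k ρ) := by
    have := abs_add_le (z 0 ρ u / ρ - f 0 u) (f 0 u)
    rw [sub_add_cancel] at this
    linarith [h0 u]
  rw [abs_div, abs_of_pos hρ, div_le_iff₀ hρ] at h3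
  linarith

end

/-- `(η, q)` is an entropy pair for the Euler equations, with `η_ρ = ν`, `η_u = ρ β`, and
`A`, `B` are the derivatives of `β` with respect to `ρ`, `u`. -/
structure IsEntropyPair (p : ℝ → ℝ) (η q ν β A B : ℝ → ℝ → ℝ) : Prop where
  eta : ∀ z : ℝ × ℝ, 0 < z.1 → HasFDerivAt (fun z : ℝ × ℝ => η z.1 z.2)
    (ν z.1 z.2 • ContinuousLinearMap.fst ℝ ℝ ℝ
      + (z.1 * β z.1 z.2) • ContinuousLinearMap.snd ℝ ℝ ℝ) z
  flux : ∀ z : ℝ × ℝ, 0 < z.1 → HasFDerivAt (fun z : ℝ × ℝ => q z.1 z.2)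
    ((z.2 * ν z.1 z.2 + deriv p z.1 * β z.1 z.2) • ContinuousLinearMap.fst ℝ ℝ ℝ
      + (z.1 * ν z.1 z.2 + z.2 * (z.1 * β z.1 z.2)) • ContinuousLinearMap.snd ℝ ℝ ℝ) z
  beta : ∀ z : ℝ × ℝ, 0 < z.1 → HasFDerivAt (fun z : ℝ × ℝ => β z.1 z.2)
    (A z.1 z.2 • ContinuousLinearMap.fst ℝ ℝ ℝ + B z.1 z.2 • ContinuousLinearMap.snd ℝ ℝ ℝ) z
  continuousAt_nu : ∀ z : ℝ × ℝ, 0 < z.1 → ContinuousAt (fun z : ℝ × ℝ => ν z.1 z.2) z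
  continuousAt_A : ∀ z : ℝ × ℝ, 0 < z.1 → ContinuousAt (fun z : ℝ × ℝ => A z.1 z.2) z
  continuousAt_B : ∀ z : ℝ × ℝ, 0 < z.1 → ContinuousAt (fun z : ℝ × ℝ => B z.1 z.2) z

theorem hasFDerivAt_of_eqOn_Ioi {F G : ℝ → ℝ → ℝ} (h : ∀ ρ u, 0 < ρ → G ρ u = F ρ u) {z : ℝ × ℝ}
    (hz : 0 < z.1) {L : ℝ × ℝ →L[ℝ] ℝ} (hF : HasFDerivAt (fun z : ℝ × ℝ => F z.1 z.2) L z) :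
    HasFDerivAt (fun z : ℝ × ℝ => G z.1 z.2) L z := by
  refine hF.congr_of_eventuallyEq ?_
  have hev : ∀ᶠ v : ℝ × ℝ in 𝓝 z, 0 < v.1 :=
    (continuous_fst.tendsto z).eventually (lt_mem_nhds hz)
  filter_upwards [hev] with v hv using h _ _ hv

section

variable {p : ℝ → ℝ} {γ κ ρs cs M : ℝ} (hp : IsPressureLaw p γ κ ρs cs M) {χ σ : ℝ → ℝ → ℝ → ℝ}
  (hχ : IsEntropyKernel p χ)

/-- `∂_ρ (β, ·)` for the entropy generated by `ψ`, `β = η_u / ρ`. -/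
noncomputable def betaRho (χ : ℝ → ℝ → ℝ → ℝ) (ψ : ℝ → ℝ) (ρ u : ℝ) : ℝ :=
  (ρ * deriv (fun r => mollify (fun ρ v => χ ρ v 0) (iteratedDeriv 1 ψ) r u) ρ
    - mollify (fun ρ v => χ ρ v 0) (iteratedDeriv 1 ψ) ρ u) / ρ ^ 2

include hp hχ

/-- With `q = h + uη`, the relations `h_ρ = p' η_u/ρ` and `h_u = ρ η_ρ - η` for the convolved
kernels are precisely the compatibility conditions of an entropy pair. -/
theorem isEntropyPair_of_contDiff (hσ : IsEntropyFluxKernel p χ σ) {ψ : ℝ → ℝ}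
    (hψ : ContDiff ℝ ∞ ψ) (hc : HasCompactSupport ψ) :
    IsEntropyPair p (generatedFunction χ ψ) (generatedFunction σ ψ)
      (fun ρ u => deriv (fun r => mollify (fun ρ v => χ ρ v 0) ψ r u) ρ)
      (fun ρ u => mollify (fun ρ v => χ ρ v 0) (iteratedDeriv 1 ψ) ρ u / ρ)
      (betaRho χ ψ)
      (fun ρ u => mollify (fun ρ v => χ ρ v 0) (iteratedDeriv 2 ψ) ρ u / ρ) := by
  have hz := (hχ.isWeakKernel 0).isWaveFamily hψ hc
  have cz := fun j z hz' => IsWaveFamily.continuousAt hz j (q := z) hz'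
  have cz' := fun j z hz' => IsWaveFamily.continuousAt' hp hz j (q := z) hz'
  have hη := fun ρ u hρ => IsEntropyKernel.generatedFunction_eq hp hχ ψ (ρ := ρ) hρ u
  have hq := fun ρ u hρ => IsEntropyFluxKernel.generatedFunction_eq hp hχ hσ hψ.continuous hc
    (ρ := ρ) hρ u
  refine ⟨fun z hz0 => ?_, fun z hz0 => ?_, fun z hz0 => ?_, fun z hz0 => ?_, fun z hz0 => ?_,
    fun z hz0 => ?_⟩
  · refine hasFDerivAt_of_eqOn_Ioi (F := mollify (fun ρ v => χ ρ v 0) ψ) hη hz0 ?_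
    refine (IsWaveFamily.hasFDerivAt hp hz 0 hz0).congr_fderiv ?_
    simp only [iteratedDeriv_zero, zero_add]
    rw [mul_div_cancel₀ _ hz0.ne']
  · have hH := fun ρ u hρ => IsEntropyFluxKernel.mollify_deriv hp hχ hσ hψ hc 0 (ρ := ρ) hρ u
    have h1 : HasFDerivAt (fun z : ℝ × ℝ => mollify (fun ρ u => σ ρ u 0 - u * χ ρ u 0) ψ z.1 z.2)
        _ z := hasFDerivAt_of_partial hz0
        (F := mollify (fun ρ u => σ ρ u 0 - u * χ ρ u 0) ψ)
        (F₁ := fun ρ u => deriv p ρ / ρ * mollify (fun ρ v => χ ρ v 0) (deriv ψ) ρ u)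
        (F₂ := fun ρ u => ρ * deriv (fun r => mollify (fun ρ v => χ ρ v 0) ψ r u) ρ
          - mollify (fun ρ v => χ ρ v 0) ψ ρ u)
        (fun ρ u hρ => (hH ρ u hρ).1) (fun ρ u hρ => (hH ρ u hρ).2) ?_ ?_
    · have h2 := IsWaveFamily.hasFDerivAt hp hz 0 hz0
      have h3 := h1.fun_add ((hasFDerivAt_snd (𝕜 := ℝ) (E := ℝ) (F := ℝ) (p := z)).fun_mul h2)
      simp only [iteratedDeriv_zero] at h3
      refine hasFDerivAt_of_eqOn_Ioi (F := fun ρ u =>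
        mollify (fun ρ u => σ ρ u 0 - u * χ ρ u 0) ψ ρ u
          + u * mollify (fun ρ v => χ ρ v 0) ψ ρ u)
        (fun ρ u hρ => by rw [hq ρ u hρ, hη ρ u hρ]) hz0 ?_
      refine h3.congr_fderiv ?_
      simp only [zero_add, iteratedDeriv_one]
      ext
      · simp; field_simp; ring
      · simp; field_simp; simp
    · have c1 := cz 1 z hz0
      simp only [iteratedDeriv_one] at c1
      exact (((hp.continuousOn_deriv.continuousAt (Ioi_mem_nhds hz0)).comp
        (f := fun z : ℝ × ℝ => z.1) continuousAt_fst).div continuousAt_fst hz0.ne').mul c1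
    · have c1 := cz 0 z hz0
      have c2 := cz' 0 z hz0
      simp only [iteratedDeriv_zero] at c1 c2
      exact (continuousAt_fst.mul c2).sub c1
  · exact IsWaveFamily.hasFDerivAt_beta hp hz 1 hz0
  · have := cz' 0 z hz0
    simpa only [iteratedDeriv_zero] using this
  · exact ((continuousAt_fst.mul (cz' 1 z hz0)).sub (cz 1 z hz0)).div (continuousAt_fst.pow 2)
      (pow_pos hz0 2).ne'
  · exact (cz 2 z hz0).div continuousAt_fst hz0.ne'

/-- Pointwise bounds, in terms of `ψ₁ - ψ₂`, for the difference of the entropies generated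
by `ψ₁`, `ψ₂`. -/
theorem abs_sub_le_of_abs_iteratedDeriv_sub_le {ψ₁ ψ₂ : ℝ → ℝ}
    (h₁ : ContDiff ℝ ∞ ψ₁) (hc₁ : HasCompactSupport ψ₁) (h₂ : ContDiff ℝ ∞ ψ₂)
    (hc₂ : HasCompactSupport ψ₂) {δ : ℝ}
    (hδ : ∀ j ≤ 2, ∀ s, |iteratedDeriv j ψ₁ s - iteratedDeriv j ψ₂ s| ≤ δ) {ρ : ℝ} (hρ : 0 < ρ)
    (u : ℝ) :
    |mollify (fun ρ v => χ ρ v 0) (iteratedDeriv 1 ψ₁) ρ u / ρ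
      - mollify (fun ρ v => χ ρ v 0) (iteratedDeriv 1 ψ₂) ρ u / ρ| ≤ δ ∧
    |betaRho χ ψ₁ ρ u - betaRho χ ψ₂ ρ u| ≤ √(deriv p ρ) / ρ * δ ∧
    |mollify (fun ρ v => χ ρ v 0) (iteratedDeriv 2 ψ₁) ρ u / ρ
      - mollify (fun ρ v => χ ρ v 0) (iteratedDeriv 2 ψ₂) ρ u / ρ| ≤ δ := by
  have hz := ((hχ.isWeakKernel 0).isWaveFamily h₁ hc₁).sub
    ((hχ.isWeakKernel 0).isWaveFamily h₂ hc₂)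
  have b1 := IsWaveFamily.abs_le_of_abs_data_le hp hz (B := δ)
    (fun u => by simpa using hδ 1 (by norm_num) u) hρ u
  have b2 := IsWaveFamily.abs_le_of_abs_data_le hp hz.shift (B := δ)
    (fun u => by simpa using hδ 2 (by norm_num) u) hρ u
  simp only [zero_add, Nat.reduceAdd] at b1 b2
  refine ⟨?_, ?_, ?_⟩
  · rw [← sub_div]; exact b1.1
  · refine le_of_eq_of_le ?_ b2.2
    unfold betaRho
    congr 1
    ring
  · rw [← sub_div]; exact b2.1

/-- These bounds depend on `ψ` only through its `C²` size, and so dominate a whole approximating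
sequence. The part `h` of the flux is at most `C p`, because `|h_ρ| ≤ C p'`. -/
theorem abs_generatedFunction_le (hσ : IsEntropyFluxKernel p χ σ) {ψ : ℝ → ℝ}
    (hψ : ContDiff ℝ ∞ ψ) (hc : HasCompactSupport ψ) {k : ℝ → ℝ}
    (hk : ∀ ρ, 0 < ρ → HasDerivAt k (√(deriv p ρ) / ρ) ρ) (hk0 : Tendsto k (𝓝[>] 0) (𝓝 0))
    {C : ℝ} (hC : ∀ j ≤ 2, ∀ s, |iteratedDeriv j ψ s| ≤ C) {ρ : ℝ} (hρ : 0 < ρ) (u : ℝ) :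
    |generatedFunction χ ψ ρ u| ≤ C * (ρ * (1 + k ρ)) ∧
    |generatedFunction σ ψ ρ u| ≤ C * p ρ + |u| * (C * (ρ * (1 + k ρ))) := by
  have hz := (hχ.isWeakKernel 0).isWaveFamily hψ hc
  have b0 := IsWaveFamily.abs_le_of_abs_data_le' hp hz hk hk0 (B := C)
    (fun u => by simpa using hC 0 (by norm_num) (u - 0))
    (fun u => by simpa using hC 1 (by norm_num) (u - 0)) hρ u
  rw [iteratedDeriv_zero, ← IsEntropyKernel.generatedFunction_eq hp hχ ψ hρ u] at b0
  refine ⟨b0, ?_⟩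
  rw [IsEntropyFluxKernel.generatedFunction_eq hp hχ hσ hψ.continuous hc hρ u]
  refine (abs_add_le _ _).trans (add_le_add ?_ ?_)
  · have hp0 := hp.tendsto_zero
    have := abs_sub_le_of_abs_deriv_le_deriv
      (fun r hr => (IsEntropyFluxKernel.mollify_deriv hp hχ hσ hψ hc 0 hr u).1)
      (fun r hr => (hp.hasDerivAt hr).mul_const C) (fun r hr => ?_)
      ((IsEntropyFluxKernel.isWeakKernel hχ hσ 0).mollify_tendsto_zero hψ hc u)
      (by simpa using hp0.mul_const C) hρ
    · rw [sub_zero] at this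
      linarith
    · have b1 := (IsWaveFamily.abs_le_of_abs_data_le hp hz (B := C)
        (fun u => by simpa using hC 1 (by norm_num) (u - 0)) hr u).1
      rw [iteratedDeriv_one] at b1
      have e : deriv p r / r * mollify (fun ρ v => χ ρ v 0) (deriv ψ) r u
          = deriv p r * (mollify (fun ρ v => χ ρ v 0) (deriv ψ) r u / r) := by ring
      have := (hp.strictly_hyperbolic r hr)
      rw [e, abs_mul, abs_of_pos this]
      gcongr
  · rw [abs_mul]
    gcongr

end

/-! ### Test functions on the half-plane -/

theorem mem_halfPlane {z : ℝ × ℝ} : z ∈ (halfPlane : Set (ℝ × ℝ)) ↔ 0 < z.1 := Iff.rfl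

theorem TestFunction.lineDerivOp_apply_eq_fderiv (φ : 𝓓(halfPlane, ℝ)) (v z : ℝ × ℝ) :
    (∂_{v} φ : 𝓓(halfPlane, ℝ)) z = fderiv ℝ φ z v := by
  rw [TestFunction.lineDerivOp_eq_lineDerivCLM ℝ, TestFunction.lineDerivCLM_apply_of_le (by simp)]
  exact (φ.contDiff.differentiable (by simp)).differentiableAt.lineDeriv_eq_fderiv

theorem TestFunction.integrable_mul {F : ℝ × ℝ → ℝ} (hF : LocallyIntegrableOn F halfPlane volume)
    (φ : 𝓓(halfPlane, ℝ)) : Integrable (fun z => F z * φ z) volume := by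
  simpa [mul_comm] using TestFunction.integrable_bilin (ContinuousLinearMap.mul ℝ ℝ) hF φ

theorem ContinuousOn.locallyIntegrableOn_halfPlane {F : ℝ × ℝ → ℝ}
    (hF : ContinuousOn F (halfPlane : Set (ℝ × ℝ))) :
    LocallyIntegrableOn F halfPlane volume :=
  hF.locallyIntegrableOn halfPlane.isOpen.measurableSet

theorem TestFunction.integral_mul_congr {F G : ℝ × ℝ → ℝ} (h : ∀ z : ℝ × ℝ, 0 < z.1 → F z = G z)
    (φ : 𝓓(halfPlane, ℝ)) : ∫ z, F z * φ z = ∫ z, G z * φ z := by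
  congr 1
  ext z
  by_cases hz : φ z = 0
  · simp [hz]
  · rw [h z (φ.tsupport_subset (subset_tsupport φ hz))]

theorem TestFunction.integral_mul_lineDeriv {F : ℝ × ℝ → ℝ} {F' : ℝ × ℝ → ℝ} {v : ℝ × ℝ}
    (hF : ∀ z : ℝ × ℝ, 0 < z.1 → DifferentiableAt ℝ F z)
    (hF' : ∀ z : ℝ × ℝ, 0 < z.1 → fderiv ℝ F z v = F' z)
    (hc : ContinuousOn F' (halfPlane : Set (ℝ × ℝ))) (φ : 𝓓(halfPlane, ℝ)) :
    ∫ z, F z * (∂_{v} φ : 𝓓(halfPlane, ℝ)) z = -∫ z, F' z * φ z := by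
  have hFc : ContinuousOn F (halfPlane : Set (ℝ × ℝ)) := fun z hz =>
    (hF z hz).continuousAt.continuousWithinAt
  have hF'c : ContinuousOn (fun z => fderiv ℝ F z v) (halfPlane : Set (ℝ × ℝ)) :=
    hc.congr fun z hz => hF' z hz
  rw [← TestFunction.integral_mul_congr hF' φ]
  simp_rw [TestFunction.lineDerivOp_apply_eq_fderiv]
  refine integral_mul_fderiv_eq_neg_fderiv_mul_of_integrable ?_ ?_ ?_ ?_ ?_
  · exact TestFunction.integrable_mul hF'c.locallyIntegrableOn_halfPlane φ
  · have := TestFunction.integrable_mul hFc.locallyIntegrableOn_halfPlane (∂_{v} φ)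
    simpa only [TestFunction.lineDerivOp_apply_eq_fderiv] using this
  · exact TestFunction.integrable_mul hFc.locallyIntegrableOn_halfPlane φ
  · exact fun z hz => hF z (φ.tsupport_subset hz)
  · exact fun z _ => (φ.contDiff.differentiable (by simp)).differentiableAt

theorem toDistribution_apply {F : ℝ × ℝ → ℝ} (hF : LocallyIntegrableOn F halfPlane volume)
    (φ : 𝓓(halfPlane, ℝ)) : toDistribution F φ = ∫ z, F z * φ z := by
  have h : toDistribution F φ
      = TestFunction.integralAgainstBilinCLM (ContinuousLinearMap.mul ℝ ℝ) volume F φ := rfl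
  rw [h, TestFunction.integralAgainstBilinCLM_eq_integral hF]
  congr 1
  ext z
  simp [mul_comm]

theorem lineDeriv_toDistribution_apply {F : ℝ × ℝ → ℝ}
    (hF : LocallyIntegrableOn F halfPlane volume) (v : ℝ × ℝ) (φ : 𝓓(halfPlane, ℝ)) :
    (∂_{v} (toDistribution F)) φ = -∫ z, F z * (∂_{v} φ : 𝓓(halfPlane, ℝ)) z := by
  rw [Distribution.lineDerivOp_apply_apply, map_neg, toDistribution_apply hF]

/-! ### Classical solutions -/

/-- `F_t` -/
noncomputable def derivT (F : ℝ × ℝ → ℝ) (z : ℝ × ℝ) : ℝ := fderiv ℝ F z (1, 0)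

/-- `F_x` -/
noncomputable def derivX (F : ℝ × ℝ → ℝ) (z : ℝ × ℝ) : ℝ := fderiv ℝ F z (0, 1)

theorem DifferentiableAt.hasDerivAt_slice_fst {F : ℝ × ℝ → ℝ} {t x : ℝ}
    (h : DifferentiableAt ℝ F (t, x)) : HasDerivAt (fun s => F (s, x)) (derivT F (t, x)) t := by
  have := h.hasFDerivAt.comp_hasDerivAt t ((hasDerivAt_id' t).prodMk (hasDerivAt_const t x))
  exact this

theorem DifferentiableAt.hasDerivAt_slice_snd {F : ℝ × ℝ → ℝ} {t x : ℝ}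
    (h : DifferentiableAt ℝ F (t, x)) : HasDerivAt (fun y => F (t, y)) (derivX F (t, x)) x := by
  have := h.hasFDerivAt.comp_hasDerivAt x ((hasDerivAt_const x t).prodMk (hasDerivAt_id' x))
  exact this

theorem ContDiffOn.contDiffAt_derivX {F : ℝ × ℝ → ℝ}
    (h : ContDiffOn ℝ 2 F (halfPlane : Set (ℝ × ℝ))) {z : ℝ × ℝ} (hz : 0 < z.1) :
    ContDiffAt ℝ 1 (derivX F) z :=
  ((h.contDiffAt (halfPlane.isOpen.mem_nhds hz)).fderiv_right (m := 1) (by norm_num)).clm_apply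
    contDiffAt_const

theorem ContDiffOn.contDiffAt_derivT {F : ℝ × ℝ → ℝ}
    (h : ContDiffOn ℝ 2 F (halfPlane : Set (ℝ × ℝ))) {z : ℝ × ℝ} (hz : 0 < z.1) :
    ContDiffAt ℝ 1 (derivT F) z :=
  ((h.contDiffAt (halfPlane.isOpen.mem_nhds hz)).fderiv_right (m := 1) (by norm_num)).clm_apply
    contDiffAt_const

theorem ContDiffOn.continuousOn_derivX_derivX {F : ℝ × ℝ → ℝ}
    (h : ContDiffOn ℝ 2 F (halfPlane : Set (ℝ × ℝ))) :
    ContinuousOn (derivX (derivX F)) (halfPlane : Set (ℝ × ℝ)) := fun _ hz =>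
  (((h.contDiffAt_derivX hz).fderiv_right (m := 0) (by norm_num)).clm_apply
    contDiffAt_const).continuousAt.continuousWithinAt

/-- A positive `C²` density `R` and a `C²` velocity `U` on the half-plane solving the Navier-Stokes
equations in nonconservative form. -/
structure IsSmoothFlow (p : ℝ → ℝ) (ε : ℝ) (R U : ℝ × ℝ → ℝ) : Prop where
  contDiffOn_rho : ContDiffOn ℝ 2 R (halfPlane : Set (ℝ × ℝ))
  contDiffOn_u : ContDiffOn ℝ 2 U (halfPlane : Set (ℝ × ℝ))
  pos : ∀ z : ℝ × ℝ, 0 < z.1 → 0 < R z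
  mass : ∀ z : ℝ × ℝ, 0 < z.1 → derivT R z + derivX R z * U z + R z * derivX U z = 0
  momentum : ∀ z : ℝ × ℝ, 0 < z.1 → R z * derivT U z + R z * U z * derivX U z
    + deriv p (R z) * derivX R z = ε * derivX (derivX U) z

theorem IsNavierStokesSolution.isSmoothFlow {p : ℝ → ℝ} {γ κ ρs cs M : ℝ}
    (hp : IsPressureLaw p γ κ ρs cs M) {ε ρl ul ρr ur : ℝ} {ρbar ubar : ℝ → ℝ} {ρ u : ℝ → ℝ → ℝ}
    (h : IsNavierStokesSolution p ε ρl ul ρr ur ρbar ubar ρ u) :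
    IsSmoothFlow p ε (fun z => ρ z.1 z.2) (fun z => u z.1 z.2) := by
  have hsub : (halfPlane : Set (ℝ × ℝ)) ⊆ Ici 0 ×ˢ univ := fun z hz =>
    ⟨(mem_halfPlane.1 hz).le, mem_univ _⟩
  have cR := h.contDiffOn_rho.mono hsub
  have cU := h.contDiffOn_u.mono hsub
  have hpos : ∀ z : ℝ × ℝ, 0 < z.1 → 0 < ρ z.1 z.2 := fun z hz => by
    obtain ⟨c, hc, h⟩ := h.no_vacuum z.1 hz
    exact hc.trans_le (h z.1 ⟨hz.le, le_rfl⟩ z.2)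
  have dR : ∀ z : ℝ × ℝ, 0 < z.1 → DifferentiableAt ℝ (fun z : ℝ × ℝ => ρ z.1 z.2) z :=
    fun z hz => (cR.contDiffAt (halfPlane.isOpen.mem_nhds hz)).differentiableAt (by norm_num)
  have dU : ∀ z : ℝ × ℝ, 0 < z.1 → DifferentiableAt ℝ (fun z : ℝ × ℝ => u z.1 z.2) z :=
    fun z hz => (cU.contDiffAt (halfPlane.isOpen.mem_nhds hz)).differentiableAt (by norm_num)
  have hmass : ∀ z : ℝ × ℝ, 0 < z.1 → derivT (fun z : ℝ × ℝ => ρ z.1 z.2) z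
      + derivX (fun z : ℝ × ℝ => ρ z.1 z.2) z * u z.1 z.2
      + ρ z.1 z.2 * derivX (fun z : ℝ × ℝ => u z.1 z.2) z = 0 := by
    rintro ⟨t, x⟩ hz
    have h1 := (dR _ hz).hasDerivAt_slice_fst
    have h2 := (dR _ hz).hasDerivAt_slice_snd
    have h3 := (dU _ hz).hasDerivAt_slice_snd
    have := h.mass t x hz
    rw [h1.deriv, (h2.fun_mul h3).deriv] at this
    linarith
  refine ⟨cR, cU, hpos, hmass, ?_⟩
  rintro ⟨t, x⟩ hz
  have h1 := (dR _ hz).hasDerivAt_slice_fst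
  have h2 := (dR _ hz).hasDerivAt_slice_snd
  have h3 := (dU _ hz).hasDerivAt_slice_snd
  have h4 := (dU _ hz).hasDerivAt_slice_fst
  have h5 := (hp.hasDerivAt (hpos _ hz)).comp x h2
  have := h.momentum t x hz
  rw [(h1.fun_mul h4).deriv] at this
  have e1 := ((h2.fun_mul (h3.fun_pow 2)).fun_add h5).deriv
  have e2 : iteratedDeriv 2 (u t) x
      = derivX (derivX fun z : ℝ × ℝ => u z.1 z.2) (t, x) := by
    have e3 : deriv (u t) = fun y => derivX (fun z : ℝ × ℝ => u z.1 z.2) (t, y) := by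
      ext y
      exact (dU (t, y) hz).hasDerivAt_slice_snd.deriv
    rw [iteratedDeriv_succ, iteratedDeriv_one, e3]
    exact ((cU.contDiffAt_derivX hz).differentiableAt (by norm_num)).hasDerivAt_slice_snd.deriv
  have e4 : deriv (fun y => ρ t y * u t y ^ 2 + p (ρ t y)) x = _ := e1
  rw [e4, e2] at this
  have hm := hmass _ hz
  simp only at hm this ⊢
  linear_combination this - u t x * hm

namespace IsSmoothFlow

variable {p : ℝ → ℝ} {ε : ℝ} {R U : ℝ × ℝ → ℝ} (h : IsSmoothFlow p ε R U)
include h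

theorem differentiableAt_rho {z : ℝ × ℝ} (hz : 0 < z.1) : DifferentiableAt ℝ R z :=
  (h.contDiffOn_rho.contDiffAt (halfPlane.isOpen.mem_nhds hz)).differentiableAt (by norm_num)

theorem differentiableAt_u {z : ℝ × ℝ} (hz : 0 < z.1) : DifferentiableAt ℝ U z :=
  (h.contDiffOn_u.contDiffAt (halfPlane.isOpen.mem_nhds hz)).differentiableAt (by norm_num)

theorem continuousOn_derivX_rho : ContinuousOn (derivX R) (halfPlane : Set (ℝ × ℝ)) := fun _ hz =>
  (h.contDiffOn_rho.contDiffAt_derivX hz).continuousAt.continuousWithinAt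

theorem continuousOn_derivX_u : ContinuousOn (derivX U) (halfPlane : Set (ℝ × ℝ)) := fun _ hz =>
  (h.contDiffOn_u.contDiffAt_derivX hz).continuousAt.continuousWithinAt

theorem continuousOn_comp {F : ℝ → ℝ → ℝ}
    (hF : ∀ z : ℝ × ℝ, 0 < z.1 → ContinuousAt (fun z : ℝ × ℝ => F z.1 z.2) z) :
    ContinuousOn (fun z => F (R z) (U z)) (halfPlane : Set (ℝ × ℝ)) := fun z hz =>
  (ContinuousAt.comp (f := fun z => (R z, U z)) (g := fun z : ℝ × ℝ => F z.1 z.2)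
    (hF (R z, U z) (h.pos z hz)) ((h.differentiableAt_rho hz).continuousAt.prodMk
      (h.differentiableAt_u hz).continuousAt)).continuousWithinAt

theorem hasFDerivAt_comp {F : ℝ → ℝ → ℝ} {L₁ L₂ : ℝ} {z : ℝ × ℝ} (hz : 0 < z.1)
    (hF : HasFDerivAt (fun z : ℝ × ℝ => F z.1 z.2)
      (L₁ • ContinuousLinearMap.fst ℝ ℝ ℝ + L₂ • ContinuousLinearMap.snd ℝ ℝ ℝ) (R z, U z)) :
    HasFDerivAt (fun z => F (R z) (U z)) (L₁ • fderiv ℝ R z + L₂ • fderiv ℝ U z) z := by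
  have := HasFDerivAt.comp (f := fun z => (R z, U z)) z hF
    ((h.differentiableAt_rho hz).hasFDerivAt.prodMk (h.differentiableAt_u hz).hasFDerivAt)
  refine this.congr_fderiv ?_
  ext <;> simp

/-- The dissipation of an entropy along a smooth flow. -/
theorem neg_integral_sub_integral_eq {η q ν β A B : ℝ → ℝ → ℝ} (he : IsEntropyPair p η q ν β A B)
    (φ : 𝓓(halfPlane, ℝ)) :
    -(∫ z, η (R z) (U z) * (∂_{((1, 0) : ℝ × ℝ)} φ : 𝓓(halfPlane, ℝ)) z)
      - ∫ z, q (R z) (U z) * (∂_{((0, 1) : ℝ × ℝ)} φ : 𝓓(halfPlane, ℝ)) z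
    = (∫ z, (-ε * (A (R z) (U z) * derivX R z + B (R z) (U z) * derivX U z) * derivX U z) * φ z)
      + ∫ z, (-ε * β (R z) (U z) * derivX U z)
        * (∂_{((0, 1) : ℝ × ℝ)} φ : 𝓓(halfPlane, ℝ)) z := by
  have hη := fun z hz => h.hasFDerivAt_comp (z := z) hz (he.eta (R z, U z) (h.pos z hz))
  have hq := fun z hz => h.hasFDerivAt_comp (z := z) hz (he.flux (R z, U z) (h.pos z hz))
  have hβ := fun z hz => h.hasFDerivAt_comp (z := z) hz (he.beta (R z, U z) (h.pos z hz))
  have cν := h.continuousOn_comp he.continuousAt_nu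
  have cA := h.continuousOn_comp he.continuousAt_A
  have cB := h.continuousOn_comp he.continuousAt_B
  have cβ := h.continuousOn_comp fun z hz => (he.beta z hz).continuousAt
  have cR : ContinuousOn R (halfPlane : Set (ℝ × ℝ)) := h.contDiffOn_rho.continuousOn
  have cU : ContinuousOn U (halfPlane : Set (ℝ × ℝ)) := h.contDiffOn_u.continuousOn
  have cRx := h.continuousOn_derivX_rho
  have cUx := h.continuousOn_derivX_u
  have cUxx := h.contDiffOn_u.continuousOn_derivX_derivX
  have cRt : ContinuousOn (derivT R) (halfPlane : Set (ℝ × ℝ)) := fun z hz =>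
    (h.contDiffOn_rho.contDiffAt_derivT hz).continuousAt.continuousWithinAt
  have cUt : ContinuousOn (derivT U) (halfPlane : Set (ℝ × ℝ)) := fun z hz =>
    (h.contDiffOn_u.contDiffAt_derivT hz).continuousAt.continuousWithinAt
  have hW : ∀ z : ℝ × ℝ, 0 < z.1 → HasFDerivAt (fun z => β (R z) (U z) * derivX U z)
      (β (R z) (U z) • fderiv ℝ (derivX U) z + derivX U z •
        (A (R z) (U z) • fderiv ℝ R z + B (R z) (U z) • fderiv ℝ U z)) z := fun z hz =>
    (hβ z hz).fun_mul
      ((h.contDiffOn_u.contDiffAt_derivX hz).differentiableAt (by norm_num)).hasFDerivAt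
  have iη : LocallyIntegrableOn (fun z => ν (R z) (U z) * derivT R z
      + R z * β (R z) (U z) * derivT U z) halfPlane volume :=
    ((cν.mul cRt).add ((cR.mul cβ).mul cUt)).locallyIntegrableOn_halfPlane
  have cW1 : ContinuousOn (fun z => ε * (β (R z) (U z) * derivX (derivX U) z))
      (halfPlane : Set (ℝ × ℝ)) := continuousOn_const.mul (cβ.mul cUxx)
  have cW2 : ContinuousOn (fun z => ε * (A (R z) (U z) * derivX R z
      + B (R z) (U z) * derivX U z) * derivX U z) (halfPlane : Set (ℝ × ℝ)) :=
    (continuousOn_const.mul ((cA.mul cRx).add (cB.mul cUx))).mul cUx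
  have cQ : ContinuousOn (fun z => ε * (β (R z) (U z) * derivX (derivX U) z)
      - (ν (R z) (U z) * derivT R z + R z * β (R z) (U z) * derivT U z))
      (halfPlane : Set (ℝ × ℝ)) := cW1.sub ((cν.mul cRt).add ((cR.mul cβ).mul cUt))
  rw [TestFunction.integral_mul_lineDeriv (fun z hz => (hη z hz).differentiableAt)
      (F' := fun z => ν (R z) (U z) * derivT R z + R z * β (R z) (U z) * derivT U z)
      (fun z hz => by rw [(hη z hz).fderiv]; simp [derivT])
      ((cν.mul cRt).add ((cR.mul cβ).mul cUt)) φ,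
    -- Here `q_x` is written as `ε β U_xx - η_t`, by the mass equation times `ν` and the momentum
    -- equation times `β`.
    TestFunction.integral_mul_lineDeriv (fun z hz => (hq z hz).differentiableAt)
      (F' := fun z => ε * (β (R z) (U z) * derivX (derivX U) z)
        - (ν (R z) (U z) * derivT R z + R z * β (R z) (U z) * derivT U z))
      (fun z hz => by
        rw [(hq z hz).fderiv]
        have h1 := h.mass z hz
        have h2 := h.momentum z hz
        have e1 : fderiv ℝ R z (0, 1) = derivX R z := rfl
        have e2 : fderiv ℝ U z (0, 1) = derivX U z := rfl
        simp only [add_apply, smul_apply, smul_eq_mul, e1, e2]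
        linear_combination ν (R z) (U z) * h1 + β (R z) (U z) * h2) cQ φ]
  -- The product rule for `(ε β U_x)_x` splits `ε β U_xx` into a flux and a source; second
  -- derivatives of the velocity disappear from the final formula.
  have key := TestFunction.integral_mul_lineDeriv (F := fun z => -ε * β (R z) (U z) * derivX U z)
    (v := (0, 1)) (φ := φ)
    (F' := fun z => -(ε * (β (R z) (U z) * derivX (derivX U) z) +
      ε * (A (R z) (U z) * derivX R z + B (R z) (U z) * derivX U z) * derivX U z))
    (fun z hz => by
      simp only [mul_assoc]
      exact ((hW z hz).const_mul (-ε)).differentiableAt)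
    (fun z hz => by
      simp only [mul_assoc]
      rw [((hW z hz).const_mul (-ε)).fderiv]
      have e1 : fderiv ℝ R z (0, 1) = derivX R z := rfl
      have e2 : fderiv ℝ U z (0, 1) = derivX U z := rfl
      have e3 : fderiv ℝ (derivX U) z (0, 1) = derivX (derivX U) z := rfl
      simp only [add_apply, smul_apply, smul_eq_mul, e1, e2, e3]
      ring) ((cW1.add cW2).neg)
  rw [key]
  have i1 := TestFunction.integrable_mul iη φ
  have i2 := TestFunction.integrable_mul cQ.locallyIntegrableOn_halfPlane φ
  have i3 := TestFunction.integrable_mul cW2.locallyIntegrableOn_halfPlane φ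
  have i4 := TestFunction.integrable_mul (cW1.add cW2).neg.locallyIntegrableOn_halfPlane φ
  simp only [Pi.neg_apply, Pi.add_apply] at i4
  rw [neg_neg, sub_neg_eq_add, ← integral_add i1 i2, ← sub_eq_add_neg]
  rw [show (fun z => (-ε * (A (R z) (U z) * derivX R z + B (R z) (U z) * derivX U z)
      * derivX U z) * φ z) = fun z => -((ε * (A (R z) (U z) * derivX R z
      + B (R z) (U z) * derivX U z) * derivX U z) * φ z) by ext z; ring, integral_neg,
    ← neg_add', ← integral_add i3 i4, ← integral_neg]
  congr 1
  ext z
  ring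

end IsSmoothFlow

/-! ### Entropies generated by `C²` functions -/

/-- Mollification of `ψ` with a bump narrower than `1`: the first two derivatives commute with the
convolution, and the supports stay in one ball independent of the accuracy, as dominated convergence
will require. -/
theorem exists_smooth_approx {ψ : ℝ → ℝ} (hψ : ContDiff ℝ 2 ψ)
    (hc : HasCompactSupport ψ) : ∃ r, ∀ δ, 0 < δ → ∃ φ : ℝ → ℝ, ContDiff ℝ ∞ φ ∧
      HasCompactSupport φ ∧ (∀ s, r < |s| → φ s = 0) ∧
      ∀ j ≤ 2, ∀ s, |iteratedDeriv j φ s - iteratedDeriv j ψ s| ≤ δ := by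
  obtain ⟨r, hr⟩ := hc.isCompact.isBounded.subset_closedBall 0
  refine ⟨r + 1, fun δ hδ => ?_⟩
  have hc0 : ∀ j ≤ 2, HasCompactSupport (iteratedDeriv j ψ) := fun j _ => hc.iteratedDeriv_real j
  have hcont : ∀ j ≤ 2, Continuous (iteratedDeriv j ψ) := fun j hj =>
    hψ.continuous_iteratedDeriv j (by exact_mod_cast hj)
  have hu : ∀ j ≤ 2, ∃ d > 0, ∀ x y, dist x y < d →
      dist (iteratedDeriv j ψ x) (iteratedDeriv j ψ y) < δ := fun j hj => by
    have := (hc0 j hj).uniformContinuous_of_continuous (hcont j hj)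
    obtain ⟨d, hd, h⟩ := Metric.uniformContinuous_iff.1 this δ hδ
    exact ⟨d, hd, fun x y hxy => h hxy⟩
  obtain ⟨d₀, hd₀, h₀⟩ := hu 0 (by norm_num)
  obtain ⟨d₁, hd₁, h₁⟩ := hu 1 (by norm_num)
  obtain ⟨d₂, hd₂, h₂⟩ := hu 2 (by norm_num)
  set d := min (min d₀ d₁) (min d₂ 1)
  have hd : 0 < d := lt_min (lt_min hd₀ hd₁) (lt_min hd₂ one_pos)
  let b : ContDiffBump (0 : ℝ) := ⟨d / 2, d, half_pos hd, half_lt_self hd⟩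
  have hb : HasCompactSupport (b.normed volume) := b.hasCompactSupport_normed
  have hbc : LocallyIntegrable (b.normed (volume : Measure ℝ)) volume :=
    b.continuous_normed.locallyIntegrable
  set φ := convolution (b.normed volume) ψ (ContinuousLinearMap.lsmul ℝ ℝ) volume with hφ
  have hd0 : iteratedDeriv 0 φ = convolution (b.normed volume) (iteratedDeriv 0 ψ)
      (ContinuousLinearMap.lsmul ℝ ℝ) volume := by simp [hφ]
  have hψ1 : ContDiff ℝ 1 (deriv ψ) := by
    have : ContDiff ℝ (1 + 1) ψ := by simpa [one_add_one_eq_two] using hψ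
    exact ((contDiff_succ_iff_deriv.1 this).2).2
  have e1 : deriv φ = convolution (b.normed volume) (deriv ψ)
      (ContinuousLinearMap.lsmul ℝ ℝ) volume := by
    ext x
    exact (hc.hasDerivAt_convolution_right (ContinuousLinearMap.lsmul ℝ ℝ) hbc
      (hψ.of_le (by norm_num)) x).deriv
  have hd1 : iteratedDeriv 1 φ = convolution (b.normed volume) (iteratedDeriv 1 ψ)
      (ContinuousLinearMap.lsmul ℝ ℝ) volume := by simpa only [iteratedDeriv_one] using e1
  have hd2 : iteratedDeriv 2 φ = convolution (b.normed volume) (iteratedDeriv 2 ψ)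
      (ContinuousLinearMap.lsmul ℝ ℝ) volume := by
    rw [iteratedDeriv_succ, iteratedDeriv_one, e1, iteratedDeriv_succ, iteratedDeriv_one]
    ext x
    exact (hc.deriv.hasDerivAt_convolution_right (ContinuousLinearMap.lsmul ℝ ℝ) hbc hψ1 x).deriv
  have hsupp : ∀ s, r + 1 < |s| → φ s = 0 := by
    intro s hs
    by_contra hne
    obtain ⟨x, hx, y, hy, rfl⟩ := support_convolution_subset _ (show s ∈ Function.support φ from hne)
    rw [b.support_normed_eq, Metric.mem_ball, dist_zero_right] at hx
    have hy' := hr (subset_tsupport ψ hy)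
    rw [Metric.mem_closedBall, dist_zero_right] at hy'
    have hx' : ‖x‖ < 1 := hx.trans_le ((min_le_right _ _).trans (min_le_right _ _))
    have := abs_add_le x y
    rw [Real.norm_eq_abs] at hx' hy'
    simp only at hs
    linarith
  refine ⟨φ, ?_, ?_, hsupp, ?_⟩
  · exact b.hasCompactSupport_normed.contDiff_convolution_left _ b.contDiff_normed
      hψ.continuous.locallyIntegrable
  · refine HasCompactSupport.of_support_subset_isCompact (isCompact_Icc (a := -(r + 1)) (b := r + 1))
      fun s hs => abs_le.1 (not_lt.1 fun h => hs (hsupp s h))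
  · have key : ∀ j ≤ 2, ∀ d', d ≤ d' → (∀ x y, dist x y < d' →
        dist (iteratedDeriv j ψ x) (iteratedDeriv j ψ y) < δ) → ∀ s,
        |convolution (b.normed volume) (iteratedDeriv j ψ) (ContinuousLinearMap.lsmul ℝ ℝ) volume s
          - iteratedDeriv j ψ s| ≤ δ := by
      intro j hj d' hd' h s
      have := b.dist_normed_convolution_le (μ := volume) (x₀ := s) (ε := δ)
        (hcont j hj).aestronglyMeasurable
        (fun x hx => (h x s ((Metric.mem_ball.1 hx).trans_le hd')).le)
      rwa [Real.dist_eq] at this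
    intro j hj s
    interval_cases j
    · rw [hd0]
      exact key 0 (by norm_num) d₀ ((min_le_left _ _).trans (min_le_left _ _)) h₀ s
    · rw [hd1]
      exact key 1 (by norm_num) d₁ ((min_le_left _ _).trans (min_le_right _ _)) h₁ s
    · rw [hd2]
      exact key 2 le_rfl d₂ ((min_le_right _ _).trans (min_le_left _ _)) h₂ s

/-- Dominated convergence, with measurability and local integrability of the limit as part of the
conclusion: the limit coefficients are known only as pointwise limits. -/
theorem tendsto_integral_mul_testFunction {F : ℕ → ℝ × ℝ → ℝ} {F₀ G : ℝ × ℝ → ℝ}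
    (hF : ∀ m, ContinuousOn (F m) (halfPlane : Set (ℝ × ℝ)))
    (hG : ContinuousOn G (halfPlane : Set (ℝ × ℝ)))
    (hb : ∀ m, ∀ z : ℝ × ℝ, 0 < z.1 → |F m z| ≤ G z)
    (hlim : ∀ z : ℝ × ℝ, 0 < z.1 → Tendsto (fun m => F m z) atTop (𝓝 (F₀ z))) :
    AEStronglyMeasurable F₀ (volume.restrict (halfPlane : Set (ℝ × ℝ))) ∧
    LocallyIntegrableOn F₀ halfPlane volume ∧
    ∀ φ : 𝓓(halfPlane, ℝ), Tendsto (fun m => ∫ z, F m z * φ z) atTop (𝓝 (∫ z, F₀ z * φ z)) := by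
  have hm : MeasurableSet (halfPlane : Set (ℝ × ℝ)) := halfPlane.isOpen.measurableSet
  have hmeas : AEStronglyMeasurable F₀ (volume.restrict (halfPlane : Set (ℝ × ℝ))) :=
    aestronglyMeasurable_of_tendsto_ae atTop (fun m => (hF m).aestronglyMeasurable hm)
      ((ae_restrict_iff' hm).2 (Eventually.of_forall hlim))
  have hb₀ : ∀ z : ℝ × ℝ, 0 < z.1 → |F₀ z| ≤ G z := fun z hz =>
    le_of_tendsto (hlim z hz).abs (Eventually.of_forall fun m => hb m z hz)
  refine ⟨hmeas, ?_, fun φ => ?_⟩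
  · rw [locallyIntegrableOn_iff halfPlane.isOpen.isLocallyClosed]
    intro K hK hKc
    refine (hG.locallyIntegrableOn_halfPlane.integrableOn_compact_subset hK hKc).mono'
      (hmeas.mono_measure (Measure.restrict_mono hK le_rfl)) ?_
    refine (ae_restrict_iff' hKc.measurableSet).2 (Eventually.of_forall fun z hz => ?_)
    rw [Real.norm_eq_abs]
    exact hb₀ z (hK hz)
  · have hi := fun m => TestFunction.integrable_mul (hF m).locallyIntegrableOn_halfPlane φ
    refine tendsto_integral_of_dominated_convergence (fun z => ‖G z * φ z‖)
      (fun m => (hi m).aestronglyMeasurable)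
      (TestFunction.integrable_mul hG.locallyIntegrableOn_halfPlane φ).norm
      (fun m => Eventually.of_forall fun z => ?_) (Eventually.of_forall fun z => ?_)
    · by_cases hz : φ z = 0
      · simp [hz]
      · have hz' : 0 < z.1 := φ.tsupport_subset (subset_tsupport φ hz)
        rw [norm_mul, norm_mul, Real.norm_eq_abs, Real.norm_eq_abs]
        gcongr
        exact (hb m z hz').trans (le_abs_self _)
    · by_cases hz : φ z = 0
      · simp [hz]
      · exact (hlim z (φ.tsupport_subset (subset_tsupport φ hz))).mul_const _

theorem tendsto_generatedFunction {K : ℝ → ℝ → ℝ → ℝ} {ρ u r : ℝ}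
    (hK : Continuous fun s => K ρ u s) {ψ : ℝ → ℝ} {φ : ℕ → ℝ → ℝ}
    (hψ : Continuous ψ) (hφ : ∀ m, Continuous (φ m)) (hs : ∀ m s, r < |s| → φ m s = 0)
    {δ : ℕ → ℝ} (hδ : Tendsto δ atTop (𝓝 0)) (h : ∀ m s, |φ m s - ψ s| ≤ δ m) :
    Tendsto (fun m => generatedFunction K (φ m) ρ u) atTop (𝓝 (generatedFunction K ψ ρ u)) := by
  have hlim : ∀ s, Tendsto (fun m => φ m s) atTop (𝓝 (ψ s)) := fun s => by
    rw [tendsto_iff_norm_sub_tendsto_zero]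
    exact squeeze_zero (fun _ => norm_nonneg _) (fun m => h m s) hδ
  obtain ⟨D, hD⟩ := hδ.bddAbove_range
  refine tendsto_integral_of_dominated_convergence
    ((Icc (-r) r).indicator fun s => (|ψ s| + D) * |K ρ u s|)
    (fun m => ((hφ m).mul hK).aestronglyMeasurable) ?_
    (fun m => Eventually.of_forall fun s => ?_)
    (Eventually.of_forall fun s => (hlim s).mul_const _)
  · exact (((hψ.abs.add continuous_const).mul hK.abs).continuousOn.integrableOn_compact
      isCompact_Icc).integrable_indicator measurableSet_Icc
  · by_cases hsr : s ∈ Icc (-r) r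
    · rw [indicator_of_mem hsr, norm_mul, Real.norm_eq_abs, Real.norm_eq_abs]
      gcongr
      have h1 := abs_add_le (φ m s - ψ s) (ψ s)
      rw [sub_add_cancel] at h1
      linarith [h m s, hD (mem_range_self m)]
    · rw [indicator_of_notMem hsr, hs m s (not_le.1 fun h => hsr (abs_le.1 h))]
      simp

/-- For `ψ` merely `C²` the coefficients are obtained as limits of those of smooth approximations:
the kernel estimates are linear in the generator, so convergence in `C²` makes the coefficients
Cauchy at each state. `C`, `β`, `A`, `B` depend on `ψ` but on neither the flow nor `ε`. -/
theorem exists_dissipation_representation {p : ℝ → ℝ} {γ κ ρs cs M : ℝ}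
    (hp : IsPressureLaw p γ κ ρs cs M) {χ σ : ℝ → ℝ → ℝ → ℝ} (hχ : IsEntropyKernel p χ)
    (hσ : IsEntropyFluxKernel p χ σ) {ψ : ℝ → ℝ} (hψ : ContDiff ℝ 2 ψ)
    (hψc : HasCompactSupport ψ) :
    ∃ C, 0 ≤ C ∧ ∃ β A B : ℝ → ℝ → ℝ,
      (∀ ρ u, 0 < ρ → |β ρ u| ≤ C ∧ |A ρ u| ≤ C * (√(deriv p ρ) / ρ) ∧ |B ρ u| ≤ C) ∧
      ∀ ε R U, IsSmoothFlow p ε R U →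
        LocallyIntegrableOn (fun z => generatedFunction χ ψ (R z) (U z)) halfPlane volume ∧
        LocallyIntegrableOn (fun z => generatedFunction σ ψ (R z) (U z)) halfPlane volume ∧
        AEStronglyMeasurable (fun z => -ε * (A (R z) (U z) * derivX R z
          + B (R z) (U z) * derivX U z) * derivX U z)
          (volume.restrict (halfPlane : Set (ℝ × ℝ))) ∧
        AEStronglyMeasurable (fun z => -ε * β (R z) (U z) * derivX U z)
          (volume.restrict (halfPlane : Set (ℝ × ℝ))) ∧
        ∀ φ : 𝓓(halfPlane, ℝ),
          -(∫ z, generatedFunction χ ψ (R z) (U z)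
              * (∂_{((1, 0) : ℝ × ℝ)} φ : 𝓓(halfPlane, ℝ)) z)
            - ∫ z, generatedFunction σ ψ (R z) (U z)
              * (∂_{((0, 1) : ℝ × ℝ)} φ : 𝓓(halfPlane, ℝ)) z
          = (∫ z, (-ε * (A (R z) (U z) * derivX R z + B (R z) (U z) * derivX U z)
              * derivX U z) * φ z)
            + ∫ z, (-ε * β (R z) (U z) * derivX U z)
              * (∂_{((0, 1) : ℝ × ℝ)} φ : 𝓓(halfPlane, ℝ)) z := by
  obtain ⟨r, hr⟩ := exists_smooth_approx hψ hψc
  choose φ hφ hφc hφs hφd using fun m : ℕ => hr (1 / ((m : ℝ) + 1)) Nat.one_div_pos_of_nat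
  have hδ0 : Tendsto (fun m : ℕ => 1 / ((m : ℝ) + 1)) atTop (𝓝 0) :=
    tendsto_one_div_add_atTop_nhds_zero_nat
  have hδ1 : ∀ m : ℕ, 1 / ((m : ℝ) + 1) ≤ 1 := fun m => by
    rw [div_le_one (by positivity)]
    linarith [(Nat.cast_nonneg m : (0 : ℝ) ≤ m)]
  obtain ⟨C, hC0, hC⟩ : ∃ C, 0 ≤ C ∧ ∀ m, ∀ j ≤ 2, ∀ s, |iteratedDeriv j (φ m) s| ≤ C := by
    have hb : ∀ j ≤ 2, ∃ C, ∀ s, |iteratedDeriv j ψ s| ≤ C := fun j hj =>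
      (hψc.iteratedDeriv_real j).exists_bound_of_continuous
        (hψ.continuous_iteratedDeriv j (by exact_mod_cast hj))
    obtain ⟨C₀, h₀⟩ := hb 0 (by norm_num)
    obtain ⟨C₁, h₁⟩ := hb 1 (by norm_num)
    obtain ⟨C₂, h₂⟩ := hb 2 (by norm_num)
    refine ⟨max C₀ (max C₁ C₂) + 1, ?_, fun m j hj s => ?_⟩
    · have := (abs_nonneg _).trans (h₀ 0)
      have := le_max_left C₀ (max C₁ C₂)
      linarith
    · have h1 := abs_add_le (iteratedDeriv j (φ m) s - iteratedDeriv j ψ s) (iteratedDeriv j ψ s)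
      rw [sub_add_cancel] at h1
      have h2 := hφd m j hj s
      have h3 : |iteratedDeriv j ψ s| ≤ max C₀ (max C₁ C₂) := by
        interval_cases j
        · exact (h₀ s).trans (le_max_left _ _)
        · exact (h₁ s).trans ((le_max_left _ _).trans (le_max_right _ _))
        · exact (h₂ s).trans ((le_max_right _ _).trans (le_max_right _ _))
      linarith [hδ1 m]
  set b : ℕ → ℝ → ℝ → ℝ := fun m ρ u =>
    mollify (fun ρ v => χ ρ v 0) (iteratedDeriv 1 (φ m)) ρ u / ρ with hb_def
  set a : ℕ → ℝ → ℝ → ℝ := fun m => betaRho χ (φ m) with ha_def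
  set c : ℕ → ℝ → ℝ → ℝ := fun m ρ u =>
    mollify (fun ρ v => χ ρ v 0) (iteratedDeriv 2 (φ m)) ρ u / ρ with hc_def
  have hpair := fun m => isEntropyPair_of_contDiff hp hχ hσ (hφ m) (hφc m)
  have hdiff : ∀ l m N : ℕ, N ≤ l → N ≤ m → ∀ ρ u, 0 < ρ →
      |b l ρ u - b m ρ u| ≤ 2 * (1 / ((N : ℝ) + 1)) ∧
      |a l ρ u - a m ρ u| ≤ √(deriv p ρ) / ρ * (2 * (1 / ((N : ℝ) + 1))) ∧
      |c l ρ u - c m ρ u| ≤ 2 * (1 / ((N : ℝ) + 1)) := by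
    intro l m N hl hm ρ u hρ
    refine abs_sub_le_of_abs_iteratedDeriv_sub_le hp hχ (hφ l) (hφc l) (hφ m) (hφc m)
      (fun j hj s => ?_) hρ u
    have h1 := hφd l j hj s
    have h2 := hφd m j hj s
    have h3 := Nat.one_div_le_one_div (α := ℝ) hl
    have h4 := Nat.one_div_le_one_div (α := ℝ) hm
    have h5 := abs_sub_le (iteratedDeriv j (φ l) s) (iteratedDeriv j ψ s) (iteratedDeriv j (φ m) s)
    rw [abs_sub_comm (iteratedDeriv j ψ s)] at h5
    linarith
  have hbd : ∀ m ρ u, 0 < ρ → |b m ρ u| ≤ C ∧ |a m ρ u| ≤ √(deriv p ρ) / ρ * C ∧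
      |c m ρ u| ≤ C := by
    intro m ρ u hρ
    have h0 : HasCompactSupport (fun _ : ℝ => (0 : ℝ)) := HasCompactSupport.zero
    -- Comparison with the zero generator turns the difference estimate into a bound.
    have := abs_sub_le_of_abs_iteratedDeriv_sub_le hp hχ (hφ m) (hφc m) contDiff_const h0
      (δ := C) (fun j hj s => ?_) hρ u
    · simpa [iteratedDeriv_const, betaRho, mollify, hb_def, ha_def, hc_def] using this
    · simpa [iteratedDeriv_const] using hC m j hj s
  have hlim0 : ∀ x : ℝ, Tendsto (fun N : ℕ => x * (2 * (1 / ((N : ℝ) + 1)))) atTop (𝓝 0) :=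
    fun x => by simpa using (hδ0.const_mul 2).const_mul x
  have hex : ∀ (g : ℕ → ℝ → ℝ → ℝ) (x : ℝ → ℝ), (∀ l m N : ℕ, N ≤ l → N ≤ m → ∀ ρ u, 0 < ρ →
      |g l ρ u - g m ρ u| ≤ x ρ * (2 * (1 / ((N : ℝ) + 1)))) →
      ∃ g₀ : ℝ → ℝ → ℝ, ∀ ρ u, 0 < ρ → Tendsto (fun m => g m ρ u) atTop (𝓝 (g₀ ρ u)) := by
    intro g x h
    refine ⟨fun ρ u => limUnder atTop fun m => g m ρ u, fun ρ u hρ => ?_⟩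
    exact (cauchySeq_of_le_tendsto_0' (fun N : ℕ => x ρ * (2 * (1 / ((N : ℝ) + 1))))
      (fun n m hnm => h n m n le_rfl hnm ρ u hρ) (hlim0 _)).tendsto_limUnder
  obtain ⟨β, hβ⟩ := hex b (fun _ => 1) fun l m N hl hm ρ u hρ => by
    simpa using (hdiff l m N hl hm ρ u hρ).1
  obtain ⟨A, hA⟩ := hex a (fun ρ => √(deriv p ρ) / ρ) fun l m N hl hm ρ u hρ =>
    (hdiff l m N hl hm ρ u hρ).2.1
  obtain ⟨B, hB⟩ := hex c (fun _ => 1) fun l m N hl hm ρ u hρ => by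
    simpa using (hdiff l m N hl hm ρ u hρ).2.2
  refine ⟨C, hC0, β, A, B, fun ρ u hρ => ⟨?_, ?_, ?_⟩, ?_⟩
  · exact le_of_tendsto (hβ ρ u hρ).abs (Eventually.of_forall fun m => (hbd m ρ u hρ).1)
  · rw [mul_comm]
    exact le_of_tendsto (hA ρ u hρ).abs (Eventually.of_forall fun m => (hbd m ρ u hρ).2.1)
  · exact le_of_tendsto (hB ρ u hρ).abs (Eventually.of_forall fun m => (hbd m ρ u hρ).2.2)
  intro ε R U hf
  obtain ⟨k, hk_nonneg, hk, hk0⟩ := hp.exists_antideriv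
  have cR : ContinuousOn R (halfPlane : Set (ℝ × ℝ)) := hf.contDiffOn_rho.continuousOn
  have cU : ContinuousOn U (halfPlane : Set (ℝ × ℝ)) := hf.contDiffOn_u.continuousOn
  have hmaps : MapsTo R (halfPlane : Set (ℝ × ℝ)) (Ioi 0) := fun z hz => hf.pos z hz
  have ck : ContinuousOn (fun z => k (R z)) (halfPlane : Set (ℝ × ℝ)) :=
    ContinuousOn.comp (t := Ioi 0)
      (fun r hr => (hk r hr).continuousAt.continuousWithinAt) cR hmaps
  have cp : ContinuousOn (fun z => p (R z)) (halfPlane : Set (ℝ × ℝ)) :=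
    hp.continuousOn.comp cR hmaps
  have cp' : ContinuousOn (fun z => √(deriv p (R z)) / R z) (halfPlane : Set (ℝ × ℝ)) :=
    ((hp.continuousOn_deriv.comp cR hmaps).sqrt).div cR fun z hz => (hf.pos z hz).ne'
  have cRx := hf.continuousOn_derivX_rho
  have cUx := hf.continuousOn_derivX_u
  have cχ : ∀ z : ℝ × ℝ, 0 < z.1 → Continuous fun s => χ (R z) (U z) s := fun z hz =>
    (hχ.continuous _ (hf.pos z hz)).comp (continuous_const.prodMk continuous_id)
  have cσ : ∀ z : ℝ × ℝ, 0 < z.1 → Continuous fun s => σ (R z) (U z) s := fun z hz =>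
    (hσ.continuous _ (hf.pos z hz)).comp (continuous_const.prodMk continuous_id)
  have cη := fun m => hf.continuousOn_comp (F := generatedFunction χ (φ m)) fun z hz => ((hpair m).eta z hz).continuousAt
  have cq := fun m => hf.continuousOn_comp (F := generatedFunction σ (φ m)) fun z hz => ((hpair m).flux z hz).continuousAt
  have cb := fun m => hf.continuousOn_comp (F := b m) fun z hz => ((hpair m).beta z hz).continuousAt
  have ca := fun m => hf.continuousOn_comp (F := a m) (hpair m).continuousAt_A
  have cc := fun m => hf.continuousOn_comp (F := c m) (hpair m).continuousAt_B
  have hd0 : ∀ m s, |φ m s - ψ s| ≤ 1 / ((m : ℝ) + 1) := fun m s => by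
    simpa using hφd m 0 (by norm_num) s
  have hbη := fun m z (hz : 0 < z.1) =>
    abs_generatedFunction_le hp hχ hσ (hφ m) (hφc m) hk hk0 (hC m) (hf.pos z hz) (U z)
  have cG : ContinuousOn (fun z => C * (R z * (1 + k (R z)))) (halfPlane : Set (ℝ × ℝ)) :=
    continuousOn_const.mul (cR.mul (continuousOn_const.add ck))
  obtain ⟨-, lη, tη⟩ := tendsto_integral_mul_testFunction cη cG
    (fun m z hz => (hbη m z hz).1) (F₀ := fun z => generatedFunction χ ψ (R z) (U z))
    (fun z hz => tendsto_generatedFunction (cχ z hz) hψ.continuous (fun m => (hφ m).continuous)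
      hφs hδ0 hd0)
  obtain ⟨-, lq, tq⟩ := tendsto_integral_mul_testFunction cq
    ((continuousOn_const.mul cp).add (cU.abs.mul cG))
    (fun m z hz => (hbη m z hz).2) (F₀ := fun z => generatedFunction σ ψ (R z) (U z))
    (fun z hz => tendsto_generatedFunction (cσ z hz) hψ.continuous (fun m => (hφ m).continuous)
      hφs hδ0 hd0)
  obtain ⟨mf, -, tf⟩ := tendsto_integral_mul_testFunction
    (F := fun m z => -ε * (a m (R z) (U z) * derivX R z + c m (R z) (U z) * derivX U z)
      * derivX U z)
    (F₀ := fun z => -ε * (A (R z) (U z) * derivX R z + B (R z) (U z) * derivX U z) * derivX U z)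
    (G := fun z => |ε| * (√(deriv p (R z)) / R z * C * |derivX R z| + C * |derivX U z|)
      * |derivX U z|)
    (fun m => (continuousOn_const.mul (((ca m).mul cRx).add ((cc m).mul cUx))).mul cUx)
    ((continuousOn_const.mul (((cp'.mul continuousOn_const).mul cRx.abs).add
      (continuousOn_const.mul cUx.abs))).mul cUx.abs)
    (fun m z hz => by
      have h1 := hbd m (R z) (U z) (hf.pos z hz)
      rw [abs_mul, abs_mul, abs_neg]
      gcongr
      refine (abs_add_le _ _).trans (add_le_add ?_ ?_)
      · rw [abs_mul]; gcongr; exact h1.2.1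
      · rw [abs_mul]; gcongr; exact h1.2.2)
    (fun z hz => by
      have hz' := hf.pos z hz
      exact ((((hA _ (U z) hz').mul_const _).add ((hB _ (U z) hz').mul_const _)).const_mul
        _).mul_const _)
  obtain ⟨mg, -, tg⟩ := tendsto_integral_mul_testFunction
    (F := fun m z => -ε * b m (R z) (U z) * derivX U z)
    (F₀ := fun z => -ε * β (R z) (U z) * derivX U z)
    (G := fun z => |ε| * C * |derivX U z|)
    (fun m => (continuousOn_const.mul (cb m)).mul cUx)
    (continuousOn_const.mul cUx.abs)
    (fun m z hz => by
      have h1 := hbd m (R z) (U z) (hf.pos z hz)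
      rw [abs_mul, abs_mul, abs_neg]
      gcongr
      exact h1.1)
    (fun z hz => ((hβ _ (U z) (hf.pos z hz)).const_mul _).mul_const _)
  refine ⟨lη, lq, mf, mg, fun φ => ?_⟩
  -- Both sides of the identity for the smooth generators converge, so the identity passes to the
  -- limit.
  refine tendsto_nhds_unique ((tη _).neg.sub (tq _)) (((tf φ).add (tg _)).congr fun m => ?_)
  exact (hf.neg_integral_sub_integral_eq (hpair m) φ).symm

/-! ### The relative internal energy -/

/-- A function that vanishes at `r`, decreases on `[a, r]` and increases on `[r, b]` is nonnegative. -/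
theorem nonneg_of_hasDerivAt_of_sign {F F' : ℝ → ℝ} {r a b : ℝ} (hr : r ∈ Icc a b)
    (h0 : F r = 0) (hF : ∀ s ∈ Icc a b, HasDerivAt F (F' s) s)
    (hpos : ∀ s ∈ Icc a b, r ≤ s → 0 ≤ F' s) (hneg : ∀ s ∈ Icc a b, s ≤ r → F' s ≤ 0)
    {ρ : ℝ} (hρ : ρ ∈ Icc a b) : 0 ≤ F ρ := by
  rw [← h0]
  rcases le_total r ρ with h | h
  · have hsub : Icc r ρ ⊆ Icc a b := Icc_subset_Icc hr.1 hρ.2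
    have : MonotoneOn F (Icc r ρ) := by
      refine monotoneOn_of_deriv_nonneg (convex_Icc _ _)
        (fun s hs => (hF s (hsub hs)).continuousAt.continuousWithinAt)
        (fun s hs => (hF s (hsub (interior_subset hs))).differentiableAt.differentiableWithinAt)
        fun s hs => ?_
      have hs' := interior_subset hs
      rw [(hF s (hsub hs')).deriv]
      exact hpos s (hsub hs') hs'.1
    exact this ⟨le_rfl, h⟩ ⟨h, le_rfl⟩ h
  · have hsub : Icc ρ r ⊆ Icc a b := Icc_subset_Icc hρ.1 hr.2
    have : AntitoneOn F (Icc ρ r) := by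
      refine antitoneOn_of_deriv_nonpos (convex_Icc _ _)
        (fun s hs => (hF s (hsub hs)).continuousAt.continuousWithinAt)
        (fun s hs => (hF s (hsub (interior_subset hs))).differentiableAt.differentiableWithinAt)
        fun s hs => ?_
      have hs' := interior_subset hs
      rw [(hF s (hsub hs')).deriv]
      exact hneg s (hsub hs') hs'.2
    exact this ⟨le_rfl, h⟩ ⟨h, le_rfl⟩ h

/-- The enthalpy `h = (ρ e)' = e + p / ρ`. -/
noncomputable def enthalpy (p : ℝ → ℝ) (ρ : ℝ) : ℝ := internalEnergy p ρ + p ρ / ρ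

namespace IsPressureLaw

variable {p : ℝ → ℝ} {γ κ ρs cs M : ℝ} (hp : IsPressureLaw p γ κ ρs cs M)
include hp

theorem hasDerivAt_internalEnergy {ρ : ℝ} (hρ : 0 < ρ) :
    HasDerivAt (internalEnergy p) (p ρ / ρ ^ 2) ρ := by
  have hγ := hp.one_lt_gamma
  have hcont : ContinuousOn (fun s => p s / s ^ 2) (Ioi 0) :=
    hp.continuousOn.div (continuousOn_id.pow 2) fun x hx => (pow_pos (mem_Ioi.1 hx) 2).ne'
  obtain ⟨C, hC, hb⟩ := hp.abs_le_rpow ρ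
  have h1 : IntervalIntegrable (fun s : ℝ => C * s ^ (γ - 2)) volume 0 ρ :=
    (intervalIntegral.intervalIntegrable_rpow' (by linarith)).const_mul _
  have hint : IntervalIntegrable (fun s => p s / s ^ 2) volume 0 ρ := by
    refine h1.mono_fun ?_ ?_
    · rw [uIoc_of_le hρ.le]
      exact (hcont.mono Ioc_subset_Ioi_self).aestronglyMeasurable measurableSet_Ioc
    · rw [uIoc_of_le hρ.le]
      refine (ae_restrict_mem measurableSet_Ioc).mono fun s hs => ?_
      have hpos := hs.1
      beta_reduce
      rw [norm_div, Real.norm_eq_abs, Real.norm_of_nonneg (by positivity : 0 ≤ s ^ 2),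
        Real.norm_of_nonneg (by positivity : 0 ≤ C * s ^ (γ - 2)), div_le_iff₀ (by positivity)]
      refine (hb s hs).1.trans (le_of_eq ?_)
      rw [mul_assoc, ← Real.rpow_natCast, ← Real.rpow_add hpos]
      congr 2
      push_cast
      ring
  exact intervalIntegral.integral_hasDerivAt_right hint
    (hcont.stronglyMeasurableAtFilter isOpen_Ioi ρ hρ) (hcont.continuousAt (Ioi_mem_nhds hρ))

theorem hasDerivAt_enthalpy {ρ : ℝ} (hρ : 0 < ρ) :
    HasDerivAt (enthalpy p) (deriv p ρ / ρ) ρ := by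
  refine ((hp.hasDerivAt_internalEnergy hρ).fun_add
    ((hp.hasDerivAt hρ).fun_div (hasDerivAt_id' ρ) hρ.ne')).congr_deriv ?_
  field_simp
  ring

/-- In terms of the enthalpy `h`, `∂_ρ e*(ρ, r) = h(ρ) - h(r)`; sign and growth of `e*` then follow
from monotonicity of `h`. -/
theorem relativeInternalEnergy_eq {ρ r : ℝ} (hρ : 0 < ρ) (hr : 0 < r) :
    relativeInternalEnergy p ρ r = ρ * (enthalpy p ρ - enthalpy p r) - (p ρ - p r) := by
  rw [relativeInternalEnergy, (hp.hasDerivAt_internalEnergy hr).deriv, enthalpy, enthalpy]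
  field_simp
  ring

theorem strictMonoOn_enthalpy : StrictMonoOn (enthalpy p) (Ioi 0) := by
  refine strictMonoOn_of_deriv_pos (convex_Ioi 0)
    (fun x hx => (hp.hasDerivAt_enthalpy hx).continuousAt.continuousWithinAt) fun x hx => ?_
  rw [interior_Ioi] at hx
  rw [(hp.hasDerivAt_enthalpy hx).deriv]
  exact div_pos (hp.strictly_hyperbolic x hx) hx

theorem hasDerivAt_relativeInternalEnergy {ρ r : ℝ} (hρ : 0 < ρ) (hr : 0 < r) :
    HasDerivAt (fun ρ => relativeInternalEnergy p ρ r) (enthalpy p ρ - enthalpy p r) ρ := by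
  have h : HasDerivAt (fun ρ => ρ * (enthalpy p ρ - enthalpy p r) - (p ρ - p r))
      (enthalpy p ρ - enthalpy p r) ρ := by
    refine (((hasDerivAt_id' ρ).fun_mul ((hp.hasDerivAt_enthalpy hρ).sub_const _)).fun_sub
      ((hp.hasDerivAt hρ).sub_const _)).congr_deriv ?_
    field_simp
    ring
  refine h.congr_of_eventuallyEq ?_
  filter_upwards [Ioi_mem_nhds hρ] with s hs using hp.relativeInternalEnergy_eq hs hr

theorem relativeInternalEnergy_self {r : ℝ} (hr : 0 < r) : relativeInternalEnergy p r r = 0 := by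
  rw [hp.relativeInternalEnergy_eq hr hr]; ring

theorem relativeInternalEnergy_nonneg {ρ r : ℝ} (hρ : 0 < ρ) (hr : 0 < r) :
    0 ≤ relativeInternalEnergy p ρ r := by
  have hpos : ∀ s ∈ Icc (min ρ r) (max ρ r), 0 < s := fun s hs => (lt_min hρ hr).trans_le hs.1
  refine nonneg_of_hasDerivAt_of_sign (F := fun s => relativeInternalEnergy p s r)
    (a := min ρ r) (b := max ρ r)
    ⟨min_le_right _ _, le_max_right _ _⟩ (hp.relativeInternalEnergy_self hr)
    (fun s hs => hp.hasDerivAt_relativeInternalEnergy (hpos s hs) hr)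
    (fun s hs h => sub_nonneg.2 (hp.strictMonoOn_enthalpy.monotoneOn hr (hpos s hs) h))
    (fun s hs h => sub_nonpos.2 (hp.strictMonoOn_enthalpy.monotoneOn (hpos s hs) hr h))
    ⟨min_le_left _ _, le_max_left _ _⟩

/-- `2L e* - (h - h(r))²` vanishes at `r` and has derivative `2 (L - p'/s)(h - h(r))`, which has the
sign of `s - r`. This controls the pressure work in the energy flux by the energy itself. -/
theorem sq_enthalpy_sub_le {a b L : ℝ} (ha : 0 < a) (hL : ∀ s ∈ Icc a b, deriv p s / s ≤ L)
    {ρ r : ℝ} (hρ : ρ ∈ Icc a b) (hr : r ∈ Icc a b) :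
    (enthalpy p ρ - enthalpy p r) ^ 2 ≤ 2 * L * relativeInternalEnergy p ρ r := by
  have hr0 : 0 < r := ha.trans_le hr.1
  have hpos : ∀ s ∈ Icc a b, 0 < s := fun s hs => ha.trans_le hs.1
  have := nonneg_of_hasDerivAt_of_sign
    (F := fun s => 2 * L * relativeInternalEnergy p s r - (enthalpy p s - enthalpy p r) ^ 2)
    (F' := fun s => 2 * (L - deriv p s / s) * (enthalpy p s - enthalpy p r)) hr
    (by simp [hp.relativeInternalEnergy_self hr0])
    (fun s hs => by
      refine (((hp.hasDerivAt_relativeInternalEnergy (hpos s hs) hr0).const_mul _).fun_sub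
        (((hp.hasDerivAt_enthalpy (hpos s hs)).sub_const _).fun_pow 2)).congr_deriv ?_
      simp
      ring)
    (fun s hs h => mul_nonneg (by linarith [hL s hs])
      (sub_nonneg.2 (hp.strictMonoOn_enthalpy.monotoneOn hr0 (hpos s hs) h)))
    (fun s hs h => mul_nonpos_of_nonneg_of_nonpos (by linarith [hL s hs])
      (sub_nonpos.2 (hp.strictMonoOn_enthalpy.monotoneOn (hpos s hs) hr0 h))) hρ
  linarith

/-- Beyond `2 r₁` the slope of `e*(·, r)` is at least `h(2 r₁) - h(r₁) > 0`, uniformly in `r ≤ r₁`,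
so `e*` grows at least linearly. -/
theorem exists_le_relativeInternalEnergy (r₁ : ℝ) :
    ∃ C, 0 ≤ C ∧ ∀ ρ r, 0 < ρ → 0 < r → r ≤ r₁ → ρ ≤ C * (1 + relativeInternalEnergy p ρ r) := by
  rcases le_or_gt r₁ 0 with h0 | h0
  · exact ⟨0, le_rfl, fun ρ r _ hr hr1 => by linarith⟩
  set d := enthalpy p (2 * r₁) - enthalpy p r₁ with hd_def
  have hd : 0 < d := sub_pos.2 (hp.strictMonoOn_enthalpy h0 (by simpa using h0) (by linarith))
  refine ⟨2 * r₁ + 1 / d, by positivity, fun ρ r hρ hr hr1 => ?_⟩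
  have hE := hp.relativeInternalEnergy_nonneg hρ hr
  rcases le_total ρ (2 * r₁) with h | h
  · have h1 : 0 ≤ 1 / d := by positivity
    nlinarith [mul_nonneg (by positivity : 0 ≤ 2 * r₁ + 1 / d) hE]
  · have hmono : MonotoneOn (fun s => relativeInternalEnergy p s r - d * s) (Icc (2 * r₁) ρ) := by
      have hder : ∀ s ∈ Icc (2 * r₁) ρ, HasDerivAt
          (fun s => relativeInternalEnergy p s r - d * s) (enthalpy p s - enthalpy p r - d * 1) s :=
        fun s hs => (hp.hasDerivAt_relativeInternalEnergy (by linarith [hs.1]) hr).fun_sub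
          ((hasDerivAt_id' s).const_mul d)
      refine monotoneOn_of_deriv_nonneg (convex_Icc _ _)
        (fun s hs => (hder s hs).continuousAt.continuousWithinAt)
        (fun s hs => (hder s (interior_subset hs)).differentiableAt.differentiableWithinAt)
        fun s hs => ?_
      have hs' := interior_subset hs
      have hs0 : 0 < s := by linarith [hs'.1]
      rw [(hder s hs').deriv]
      have h1 := hp.strictMonoOn_enthalpy.monotoneOn (a := 2 * r₁) (b := s)
        (by simpa using h0) hs0 hs'.1
      have h2 := hp.strictMonoOn_enthalpy.monotoneOn hr h0 hr1
      linarith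
    have h1 := hmono ⟨le_rfl, h⟩ ⟨h, le_rfl⟩ h
    have h2 := hp.relativeInternalEnergy_nonneg (ρ := 2 * r₁) (by linarith) hr
    have h3 : d * (ρ - 2 * r₁) ≤ relativeInternalEnergy p ρ r := by simp only at h1; linarith
    have h4 : ρ - 2 * r₁ ≤ 1 / d * relativeInternalEnergy p ρ r := by
      rw [one_div, inv_mul_eq_div, le_div_iff₀ hd]; linarith
    have h5 : 0 ≤ 1 / d := by positivity
    nlinarith [mul_nonneg h0.le hE]

end IsPressureLaw

/-! ### The energy identity -/

theorem ContDiffAt.derivT_derivX_comm {F : ℝ × ℝ → ℝ} {z : ℝ × ℝ} (h : ContDiffAt ℝ 2 F z) :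
    derivT (derivX F) z = derivX (derivT F) z := by
  have hs := h.isSymmSndFDerivAt (by simp)
  have hd : DifferentiableAt ℝ (fderiv ℝ F) z :=
    (h.fderiv_right (m := 1) (by norm_num)).differentiableAt (by norm_num)
  have e : ∀ v w : ℝ × ℝ, fderiv ℝ (fun z => fderiv ℝ F z v) z w
      = fderiv ℝ (fderiv ℝ F) z w v := by
    intro v w
    rw [fderiv_clm_apply hd (differentiableAt_const v)]
    simp
  have h1 : derivT (derivX F) z = fderiv ℝ (fun z => fderiv ℝ F z (0, 1)) z (1, 0) := rfl
  have h2 : derivX (derivT F) z = fderiv ℝ (fun z => fderiv ℝ F z (1, 0)) z (0, 1) := rfl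
  rw [h1, h2, e, e]
  exact hs.eq _ _

namespace IsSmoothFlow

variable {p : ℝ → ℝ} {ε : ℝ} {R U : ℝ × ℝ → ℝ} (h : IsSmoothFlow p ε R U)
include h

theorem differentiableAt_derivX_rho {z : ℝ × ℝ} (hz : 0 < z.1) :
    DifferentiableAt ℝ (derivX R) z :=
  (h.contDiffOn_rho.contDiffAt_derivX hz).differentiableAt (by norm_num)

theorem differentiableAt_derivX_u {z : ℝ × ℝ} (hz : 0 < z.1) :
    DifferentiableAt ℝ (derivX U) z :=
  (h.contDiffOn_u.contDiffAt_derivX hz).differentiableAt (by norm_num)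

theorem derivT_derivX_rho {t x : ℝ} (ht : 0 < t) : derivT (derivX R) (t, x)
    = -(derivX (derivX R) (t, x) * U (t, x) + 2 * (derivX R (t, x) * derivX U (t, x))
      + R (t, x) * derivX (derivX U) (t, x)) := by
  have hz : 0 < (t, x).1 := ht
  rw [(h.contDiffOn_rho.contDiffAt (halfPlane.isOpen.mem_nhds hz)).derivT_derivX_comm]
  have h1 : DifferentiableAt ℝ (derivT R) (t, x) :=
    (h.contDiffOn_rho.contDiffAt_derivT hz).differentiableAt (by norm_num)
  have h2 := ((h.differentiableAt_derivX_rho hz).hasDerivAt_slice_snd.fun_mul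
      (h.differentiableAt_u hz).hasDerivAt_slice_snd).fun_add
      ((h.differentiableAt_rho hz).hasDerivAt_slice_snd.fun_mul
      (h.differentiableAt_derivX_u hz).hasDerivAt_slice_snd)
  replace h2 := h2.fun_neg.congr_of_eventuallyEq (f₁ := fun y => derivT R (t, y))
    (Eventually.of_forall fun y => by linarith [h.mass (t, y) ht])
  rw [h1.hasDerivAt_slice_snd.unique h2]
  ring

/-- The transport equation satisfied by the effective velocity `U + ε R_x / R²`. -/
theorem effective_velocity {t x : ℝ} (ht : 0 < t) :
    DifferentiableAt ℝ (fun z => ε * derivX R z / R z ^ 2) (t, x) ∧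
    R (t, x) * (derivT (fun z => ε * derivX R z / R z ^ 2) (t, x)
      + U (t, x) * derivX (fun z => ε * derivX R z / R z ^ 2) (t, x))
    = -ε * derivX (derivX U) (t, x) := by
  have hz : 0 < (t, x).1 := ht
  have hR := (h.pos _ hz).ne'
  have dR := h.differentiableAt_rho hz
  have dRx := h.differentiableAt_derivX_rho hz
  have hd : DifferentiableAt ℝ (fun z => ε * derivX R z / R z ^ 2) (t, x) :=
    (dRx.const_mul ε).fun_mul ((dR.fun_pow 2).fun_inv (pow_ne_zero 2 hR))
  refine ⟨hd, ?_⟩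
  have h1 := (dRx.hasDerivAt_slice_fst.const_mul ε).fun_div (dR.hasDerivAt_slice_fst.fun_pow 2)
    (pow_ne_zero 2 hR)
  have h2 := (dRx.hasDerivAt_slice_snd.const_mul ε).fun_div (dR.hasDerivAt_slice_snd.fun_pow 2)
    (pow_ne_zero 2 hR)
  rw [hd.hasDerivAt_slice_fst.unique h1, hd.hasDerivAt_slice_snd.unique h2,
    h.derivT_derivX_rho ht]
  have hm := h.mass _ hz
  have e : derivT R (t, x) = -(derivX R (t, x) * U (t, x) + R (t, x) * derivX U (t, x)) := by
    linarith
  rw [e]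
  field_simp
  simp
  ring

end IsSmoothFlow

/-- The density of the energy of the velocities `U` and `W` relative to the state `(r, b)`. -/
noncomputable def energyDensity (p r b : ℝ → ℝ) (R U W : ℝ × ℝ → ℝ) (z : ℝ × ℝ) : ℝ :=
  1 / 2 * R z * (U z - b z.2) ^ 2 + 1 / 2 * R z * W z ^ 2
    + 2 * (R z * (enthalpy p (R z) - enthalpy p (r z.2)) - (p (R z) - p (r z.2)))

/-- The flux of the energy of the velocities `U` and `W` relative to the state `(r, b)`. -/
noncomputable def energyFlux (p r b : ℝ → ℝ) (R U W : ℝ × ℝ → ℝ) (z : ℝ × ℝ) : ℝ :=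
  1 / 2 * (R z * U z) * (U z - b z.2) ^ 2 + 1 / 2 * (R z * U z) * W z ^ 2
    + 2 * (R z * (U z - b z.2) * (enthalpy p (R z) - enthalpy p (r z.2))
      + b z.2 * (R z * (enthalpy p (R z) - enthalpy p (r z.2)) - (p (R z) - p (r z.2))))

/-- The source in the balance of the relative energy due to the variation of the reference state. -/
noncomputable def energySource (p r b : ℝ → ℝ) (ρ v W x : ℝ) : ℝ :=
  ρ * v * (v - b x + W) * deriv b x
    + 2 * (ρ * v * (deriv p (r x) / r x) * deriv r x + deriv b x * (p ρ - p (r x))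
      - b x * deriv p (r x) * deriv r x)

/-- `W` may be any velocity relative to `b` that is driven by the pressure alone. Both kinetic
energies exchange work with the pressure, hence the factor `2` on the internal energy; the work
fails to cancel only by the term with `U - b - W`, which for the effective velocity is the
dissipation in `R_x`. -/
theorem IsSmoothFlow.energy_identity {p : ℝ → ℝ} {γ κ ρs cs M : ℝ}
    (hp : IsPressureLaw p γ κ ρs cs M) {ε : ℝ} {R U : ℝ × ℝ → ℝ} (h : IsSmoothFlow p ε R U)
    {r b : ℝ → ℝ} (hr : Differentiable ℝ r) (hb : Differentiable ℝ b) (hr0 : ∀ x, 0 < r x)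
    {W : ℝ × ℝ → ℝ} {t x : ℝ} (ht : 0 < t) (hW : DifferentiableAt ℝ W (t, x))
    (hWeq : R (t, x) * (derivT W (t, x) + U (t, x) * derivX W (t, x))
      = -deriv p (R (t, x)) * derivX R (t, x) - R (t, x) * U (t, x) * deriv b x) :
    DifferentiableAt ℝ (energyDensity p r b R U W) (t, x) ∧
    DifferentiableAt ℝ (energyFlux p r b R U W) (t, x) ∧
    derivT (energyDensity p r b R U W) (t, x) + derivX (energyFlux p r b R U W) (t, x)
      = (U (t, x) - b x - W (t, x)) * deriv p (R (t, x)) * derivX R (t, x)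
        + ε * (U (t, x) - b x) * derivX (derivX U) (t, x)
        - energySource p r b (R (t, x)) (U (t, x)) (W (t, x)) x := by
  have hz : 0 < (t, x).1 := ht
  have hRpos := h.pos _ hz
  have dR := h.differentiableAt_rho hz
  have dU := h.differentiableAt_u hz
  have dhR : DifferentiableAt ℝ (fun z => enthalpy p (R z)) (t, x) :=
    (hp.hasDerivAt_enthalpy hRpos).differentiableAt.comp (t, x) dR
  have dpR : DifferentiableAt ℝ (fun z => p (R z)) (t, x) :=
    (hp.hasDerivAt hRpos).differentiableAt.comp (t, x) dR
  have drx : DifferentiableAt ℝ (fun z : ℝ × ℝ => r z.2) (t, x) :=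
    (hr x).comp (t, x) differentiableAt_snd
  have dhr : DifferentiableAt ℝ (fun z : ℝ × ℝ => enthalpy p (r z.2)) (t, x) :=
    DifferentiableAt.comp (g := enthalpy p) (t, x)
      (hp.hasDerivAt_enthalpy (hr0 x)).differentiableAt drx
  have dpr : DifferentiableAt ℝ (fun z : ℝ × ℝ => p (r z.2)) (t, x) :=
    DifferentiableAt.comp (g := p) (t, x) (hp.hasDerivAt (hr0 x)).differentiableAt drx
  have db : DifferentiableAt ℝ (fun z : ℝ × ℝ => b z.2) (t, x) :=
    (hb x).comp (t, x) differentiableAt_snd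
  have dA : DifferentiableAt ℝ (energyDensity p r b R U W) (t, x) :=
    (((dR.const_mul (1 / 2)).fun_mul ((dU.fun_sub db).fun_pow 2)).fun_add
      ((dR.const_mul (1 / 2)).fun_mul (hW.fun_pow 2))).fun_add
      (((dR.fun_mul (dhR.fun_sub dhr)).fun_sub (dpR.fun_sub dpr)).const_mul 2)
  have dG : DifferentiableAt ℝ (energyFlux p r b R U W) (t, x) :=
    ((((dR.fun_mul dU).const_mul (1 / 2)).fun_mul ((dU.fun_sub db).fun_pow 2)).fun_add
      (((dR.fun_mul dU).const_mul (1 / 2)).fun_mul (hW.fun_pow 2))).fun_add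
      ((((dR.fun_mul (dU.fun_sub db)).fun_mul (dhR.fun_sub dhr)).fun_add
      (db.fun_mul ((dR.fun_mul (dhR.fun_sub dhr)).fun_sub (dpR.fun_sub dpr)))).const_mul 2)
  refine ⟨dA, dG, ?_⟩
  have Rt := dR.hasDerivAt_slice_fst
  have Ut := dU.hasDerivAt_slice_fst
  have Wt := hW.hasDerivAt_slice_fst
  have Rx := dR.hasDerivAt_slice_snd
  have Ux := dU.hasDerivAt_slice_snd
  have Wx := hW.hasDerivAt_slice_snd
  have bx := (hb x).hasDerivAt
  have rx := (hr x).hasDerivAt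
  have hRt : HasDerivAt (fun s => enthalpy p (R (s, x)))
      (deriv p (R (t, x)) / R (t, x) * derivT R (t, x)) t :=
    HasDerivAt.comp (h₂ := enthalpy p) t (hp.hasDerivAt_enthalpy hRpos) Rt
  have pRt : HasDerivAt (fun s => p (R (s, x))) (deriv p (R (t, x)) * derivT R (t, x)) t :=
    HasDerivAt.comp (h₂ := p) t (hp.hasDerivAt hRpos) Rt
  have hRx : HasDerivAt (fun y => enthalpy p (R (t, y)))
      (deriv p (R (t, x)) / R (t, x) * derivX R (t, x)) x :=
    HasDerivAt.comp (h₂ := enthalpy p) x (hp.hasDerivAt_enthalpy hRpos) Rx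
  have pRx : HasDerivAt (fun y => p (R (t, y))) (deriv p (R (t, x)) * derivX R (t, x)) x :=
    HasDerivAt.comp (h₂ := p) x (hp.hasDerivAt hRpos) Rx
  have hrx : HasDerivAt (fun y => enthalpy p (r y)) (deriv p (r x) / r x * deriv r x) x :=
    HasDerivAt.comp (h₂ := enthalpy p) x (hp.hasDerivAt_enthalpy (hr0 x)) rx
  have prx : HasDerivAt (fun y => p (r y)) (deriv p (r x) * deriv r x) x :=
    HasDerivAt.comp (h₂ := p) x (hp.hasDerivAt (hr0 x)) rx
  have At := (((Rt.const_mul (1 / 2)).fun_mul ((Ut.sub_const (b x)).fun_pow 2)).fun_add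
      ((Rt.const_mul (1 / 2)).fun_mul (Wt.fun_pow 2))).fun_add
      (((Rt.fun_mul (hRt.sub_const (enthalpy p (r x)))).fun_sub
        (pRt.sub_const (p (r x)))).const_mul 2)
  have Gx := ((((Rx.fun_mul Ux).const_mul (1 / 2)).fun_mul ((Ux.fun_sub bx).fun_pow 2)).fun_add
      (((Rx.fun_mul Ux).const_mul (1 / 2)).fun_mul (Wx.fun_pow 2))).fun_add
      ((((Rx.fun_mul (Ux.fun_sub bx)).fun_mul (hRx.fun_sub hrx)).fun_add
      (bx.fun_mul ((Rx.fun_mul (hRx.fun_sub hrx)).fun_sub (pRx.fun_sub prx)))).const_mul 2)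
  rw [dA.hasDerivAt_slice_fst.unique At, dG.hasDerivAt_slice_snd.unique Gx, energySource]
  have hm := h.mass _ hz
  have hmom := h.momentum _ hz
  obtain ⟨a, ha⟩ : ∃ a, a = deriv p (R (t, x)) / R (t, x) := ⟨_, rfl⟩
  obtain ⟨k, hk⟩ : ∃ k, k = deriv p (r x) / r x := ⟨_, rfl⟩
  have ha' : deriv p (R (t, x)) = R (t, x) * a := by rw [ha]; field_simp
  have hk' : deriv p (r x) = r x * k := by rw [hk]; field_simp [(hr0 x).ne']
  rw [← ha, ← hk]
  rw [ha'] at hWeq hmom ⊢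
  rw [hk']
  generalize derivT R (t, x) = Rt' at *
  simp only [Nat.reduceSub, pow_one, Nat.cast_ofNat]
  -- The multipliers are the derivatives of the energy density: in the density for the mass
  -- equation, in the velocities (divided by `R`) for the other two.
  linear_combination (1 / 2 * (U (t, x) - b x) ^ 2 + 1 / 2 * W (t, x) ^ 2
    + 2 * (enthalpy p (R (t, x)) - enthalpy p (r x))) * hm + (U (t, x) - b x) * hmom
    + W (t, x) * hWeq

/-! ### Weighted energy estimate -/

/-- Squaring the positive part makes the cut-off differentiable across the boundary of its support.
-/
theorem hasDerivAt_sq_max_zero (y : ℝ) : HasDerivAt (fun y : ℝ => max 0 y ^ 2) (2 * max 0 y) y := by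
  rcases lt_trichotomy y 0 with hy | rfl | hy
  · rw [max_eq_left hy.le, mul_zero]
    refine (hasDerivAt_const y (0 : ℝ)).congr_of_eventuallyEq ?_
    filter_upwards [Iio_mem_nhds hy] with s hs
    rw [max_eq_left (le_of_lt hs)]
    norm_num
  · rw [hasDerivAt_iff_isLittleO]
    simp only [max_self, mul_zero, sub_zero, smul_zero, ne_eq, OfNat.ofNat_ne_zero,
      not_false_eq_true, zero_pow]
    refine (Asymptotics.IsBigO.of_bound 1 (Eventually.of_forall fun y => ?_)).trans_isLittleO
      (Asymptotics.isLittleO_pow_id (𝕜 := ℝ) one_lt_two)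
    rw [one_mul, norm_pow, norm_pow, Real.norm_eq_abs, Real.norm_eq_abs, sq_abs, sq_abs]
    rcases le_total y 0 with h | h
    · rw [max_eq_left h]
      nlinarith [sq_nonneg y]
    · rw [max_eq_right h]
  · rw [max_eq_right hy.le]
    refine (by simpa using (hasDerivAt_id' y).fun_pow 2 :
      HasDerivAt (fun y : ℝ => y ^ 2) (2 * y) y).congr_of_eventuallyEq ?_
    filter_upwards [Ioi_mem_nhds hy] with s hs
    rw [max_eq_right (le_of_lt hs)]

/-- The cut-off profile of the weight. -/
noncomputable def coneProfile (K N : ℝ) (z : ℝ × ℝ) : ℝ :=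
  max 0 (1 - (√(1 + z.2 ^ 2) + K * z.1) / N)

/-- A weight which decreases in time on an expanding family of backward cones of speed `K`. -/
noncomputable def coneWeight (c K N : ℝ) (z : ℝ × ℝ) : ℝ :=
  Real.exp (-c * z.1) * coneProfile K N z ^ 2

theorem coneProfile_nonneg (K N : ℝ) (z : ℝ × ℝ) : 0 ≤ coneProfile K N z := le_max_left _ _

theorem coneProfile_le_one {K N : ℝ} (hK : 0 ≤ K) (hN : 0 < N) {z : ℝ × ℝ} (hz : 0 ≤ z.1) :
    coneProfile K N z ≤ 1 := by
  refine max_le zero_le_one ?_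
  have : 0 ≤ (√(1 + z.2 ^ 2) + K * z.1) / N := by positivity
  linarith

theorem coneProfile_eq_zero {K N : ℝ} (hK : 0 ≤ K) (hN : 0 < N) {z : ℝ × ℝ} (hz : 0 ≤ z.1)
    (hx : N ≤ |z.2|) : coneProfile K N z = 0 := by
  refine max_eq_left ?_
  have h1 : |z.2| ≤ √(1 + z.2 ^ 2) := Real.abs_le_sqrt (by linarith)
  have h2 : 0 ≤ K * z.1 := by positivity
  rw [sub_nonpos, le_div_iff₀ hN]
  linarith

theorem half_le_coneProfile {K N T X : ℝ} (hK : 0 ≤ K) (hN : 0 < N)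
    (h : 2 * (1 + X + K * T) ≤ N) {z : ℝ × ℝ} (hz : z.1 ≤ T) (hx : |z.2| ≤ X) :
    1 / 2 ≤ coneProfile K N z := by
  refine le_max_of_le_right ?_
  have h1 : √(1 + z.2 ^ 2) ≤ 1 + X := by
    rw [Real.sqrt_le_left (by linarith [abs_nonneg z.2]), ← sq_abs z.2]
    nlinarith [abs_nonneg z.2]
  have h2 : K * z.1 ≤ K * T := mul_le_mul_of_nonneg_left hz hK
  have : (√(1 + z.2 ^ 2) + K * z.1) / N ≤ 1 / 2 := by
    rw [div_le_iff₀ hN]; linarith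
  linarith

theorem coneWeight_slice (c K N t x : ℝ) :
    DifferentiableAt ℝ (coneWeight c K N) (t, x) ∧
    derivT (coneWeight c K N) (t, x) = -c * coneWeight c K N (t, x)
      - Real.exp (-c * t) * (2 * coneProfile K N (t, x) * (K / N)) ∧
    derivX (coneWeight c K N) (t, x)
      = -(Real.exp (-c * t) * (2 * coneProfile K N (t, x) * (x / √(1 + x ^ 2) / N))) := by
  have h1 : DifferentiableAt ℝ (fun z : ℝ × ℝ => 1 - (√(1 + z.2 ^ 2) + K * z.1) / N) (t, x) := by
    have : (1 : ℝ) + x ^ 2 ≠ 0 := by positivity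
    fun_prop (disch := exact this)
  have hd : DifferentiableAt ℝ (coneWeight c K N) (t, x) := by
    refine DifferentiableAt.fun_mul (by fun_prop) ?_
    exact DifferentiableAt.comp (g := fun y : ℝ => max 0 y ^ 2) (t, x)
      (hasDerivAt_sq_max_zero _).differentiableAt h1
  refine ⟨hd, ?_, ?_⟩
  · have e1 : HasDerivAt (fun s : ℝ => 1 - (√(1 + x ^ 2) + K * s) / N) (-(K / N)) t := by
      refine ((((hasDerivAt_id' t).const_mul K).const_add (√(1 + x ^ 2))).div_const N).const_sub 1
        |>.congr_deriv ?_
      simp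
    have e2 := HasDerivAt.comp (h₂ := fun y : ℝ => max 0 y ^ 2) t (hasDerivAt_sq_max_zero _) e1
    have e3 := (((hasDerivAt_id' t).const_mul (-c)).exp).fun_mul e2
    rw [hd.hasDerivAt_slice_fst.unique e3]
    simp only [coneWeight, coneProfile, Function.comp]
    ring
  · have e0 : HasDerivAt (fun y : ℝ => √(1 + y ^ 2)) (x / √(1 + x ^ 2)) x := by
      refine (((hasDerivAt_id' x).fun_pow 2).const_add 1).sqrt (by positivity) |>.congr_deriv ?_
      simp
      field_simp
    have e1 : HasDerivAt (fun y : ℝ => 1 - (√(1 + y ^ 2) + K * t) / N)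
        (-(x / √(1 + x ^ 2) / N)) x := ((e0.add_const (K * t)).div_const N).const_sub 1
    have e2 := HasDerivAt.comp (h₂ := fun y : ℝ => max 0 y ^ 2) x (hasDerivAt_sq_max_zero _) e1
    have e3 := e2.const_mul (Real.exp (-c * t))
    rw [hd.hasDerivAt_slice_snd.unique e3]
    simp only [coneProfile]
    ring

theorem continuous_coneProfile (K N : ℝ) : Continuous (coneProfile K N) := by
  unfold coneProfile
  fun_prop

/-- Divergence theorem on a rectangle reaching down to `t = 0`, where only continuity of `f`, `g`
and of the divergence `D` is available. The lateral terms vanish and the term at time `T` has a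
sign. -/
theorem neg_integral_le_of_divergence_eq {f g D : ℝ × ℝ → ℝ} {T N : ℝ} (hT : 0 ≤ T) (hN : 0 ≤ N)
    (cf : ContinuousOn f (Icc (0, -N) (T, N))) (cg : ContinuousOn g (Icc (0, -N) (T, N)))
    (cD : ContinuousOn D (Icc (0, -N) (T, N)))
    (df : ∀ t x, 0 < t → DifferentiableAt ℝ f (t, x))
    (dg : ∀ t x, 0 < t → DifferentiableAt ℝ g (t, x))
    (hD : ∀ t x, 0 < t → derivT f (t, x) + derivX g (t, x) = D (t, x))
    (hg : ∀ t ∈ Icc 0 T, g (t, N) = 0 ∧ g (t, -N) = 0) (hf : ∀ x, 0 ≤ f (T, x)) :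
    -∫ z in Icc ((0 : ℝ), -N) (T, N), D z ≤ ∫ x in (-N)..N, f (0, x) := by
  have key := integral_divergence_prod_Icc_of_hasFDerivAt_of_le f g
    -- The time derivative of `f` is entered as `D - g_x`, so that the sum of the two partial
    -- derivatives is `D` everywhere, including the boundary.
    (fun z => (D z - derivX g z) • ContinuousLinearMap.fst ℝ ℝ ℝ
      + derivX f z • ContinuousLinearMap.snd ℝ ℝ ℝ) (fun z => fderiv ℝ g z) (0, -N) (T, N)
    (by constructor <;> simp <;> linarith) cf cg (fun z hz => ?_) (fun z hz => ?_) ?_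
  · have e : ∀ z : ℝ × ℝ, ((D z - derivX g z) • ContinuousLinearMap.fst ℝ ℝ ℝ
      + derivX f z • ContinuousLinearMap.snd ℝ ℝ ℝ) (1, 0) + fderiv ℝ g z (0, 1) = D z := by
      intro z
      simp [derivX]
    simp only [e] at key
    have h1 : ∫ t in (0 : ℝ)..T, g (t, N) = 0 := by
      refine intervalIntegral.integral_zero_ae (Eventually.of_forall fun t ht => ?_)
      rw [uIoc_of_le hT] at ht
      exact (hg t ⟨ht.1.le, ht.2⟩).1
    have h2 : ∫ t in (0 : ℝ)..T, g (t, -N) = 0 := by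
      refine intervalIntegral.integral_zero_ae (Eventually.of_forall fun t ht => ?_)
      rw [uIoc_of_le hT] at ht
      exact (hg t ⟨ht.1.le, ht.2⟩).2
    have h3 : 0 ≤ ∫ x in (-N)..N, f (T, x) :=
      intervalIntegral.integral_nonneg (by linarith) fun x _ => hf x
    simp only [h1, h2] at key
    linarith
  · have h1 : 0 < z.1 := hz.1.1
    refine (df z.1 z.2 h1).hasFDerivAt.congr_fderiv ?_
    rw [← hD z.1 z.2 h1]
    ext <;> simp [derivT, derivX]
  · exact (dg z.1 z.2 hz.1.1).hasFDerivAt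
  · have e : ∀ z : ℝ × ℝ, ((D z - derivX g z) • ContinuousLinearMap.fst ℝ ℝ ℝ
      + derivX f z • ContinuousLinearMap.snd ℝ ℝ ℝ) (1, 0) + fderiv ℝ g z (0, 1) = D z := by
      intro z
      simp [derivX]
    simp only [e]
    exact cD.integrableOn_compact isCompact_Icc

/-- The pointwise estimate of the weighted dissipation. -/
theorem weighted_dissipation_le {E m c c₀ K N A G w ux b' θ Θ ε s src Q : ℝ} (hE : 0 ≤ E)
    (hm : 0 ≤ m) (hm1 : m ≤ 1) (hN : 0 < N) (hε : 0 ≤ ε) (hA : 0 ≤ A) (hc₀ : 0 ≤ c₀)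
    (hG : |G| ≤ K * A) (hs : |s| ≤ 1) (hθ : θ ≤ Θ) (hb' : |b'| ≤ θ)
    (hsrc : |src| ≤ c₀ * (1 + A) * θ) (hc : c = c₀ * Θ) (hQ : 0 ≤ Q) :
    (-c * (E * m ^ 2) - E * (2 * m * (K / N))) * A
      + -(E * (2 * m * (s / N))) * (G - ε * w * ux)
      + E * m ^ 2 * (-ε * Q - src - ε * ux * (ux - b'))
    ≤ E * (-(1 / 4 * m ^ 2 * (ε * (ux ^ 2 + Q))) + ((c₀ + ε * Θ) * θ + 4 * ε * w ^ 2 / N ^ 2)) := by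
  have hθ0 : 0 ≤ θ := (abs_nonneg _).trans hb'
  have hΘ0 : 0 ≤ Θ := hθ0.trans hθ
  -- The energy flux through the cut-off is absorbed by the decrease of the profile in time, as the
  -- cone speed `K` bounds flux over energy.
  have h1 : -(s / N) * G ≤ K / N * A := by
    have : |s * G| ≤ 1 * (K * A) := by
      rw [abs_mul]; exact mul_le_mul hs hG (abs_nonneg _) zero_le_one
    have h2 := (abs_le.1 this).1
    calc -(s / N) * G = -(s * G) / N := by ring
      _ ≤ K * A / N := by gcongr; linarith
      _ = _ := by ring
  -- Young's inequality: a quarter of the viscous dissipation pays for the viscous flux; the rest is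
  -- `O(N⁻²)`.
  have h2 : 2 * m * (s / N) * (ε * w * ux) ≤ ε * (1 / 4 * m ^ 2 * ux ^ 2 + 4 * w ^ 2 / N ^ 2) := by
    have h3 : 2 * (m * ux) * (s * w / N) ≤ 1 / 4 * (m * ux) ^ 2 + 4 * (s * w / N) ^ 2 := by
      nlinarith [sq_nonneg (1 / 2 * (m * ux) - 2 * (s * w / N))]
    have h4 : (s * w / N) ^ 2 ≤ w ^ 2 / N ^ 2 := by
      rw [div_pow, mul_pow]
      gcongr
      nlinarith [sq_nonneg w, (sq_le_one_iff_abs_le_one s).2 hs]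
    calc 2 * m * (s / N) * (ε * w * ux) = ε * (2 * (m * ux) * (s * w / N)) := by ring
      _ ≤ ε * (1 / 4 * (m * ux) ^ 2 + 4 * (w ^ 2 / N ^ 2)) := by gcongr; linarith
      _ = _ := by ring
  -- The part of the source proportional to the energy is absorbed by the exponential factor, thanks
  -- to `c = c₀ Θ`.
  have h5 : -src ≤ c₀ * θ + c * A := by
    have := (abs_le.1 hsrc).1
    have h6 : c₀ * A * θ ≤ c₀ * A * Θ := by gcongr
    rw [hc]
    linarith
  have h6 : ε * ux * b' ≤ ε * (1 / 2 * ux ^ 2 + 1 / 2 * (Θ * θ)) := by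
    have h7 : b' ^ 2 ≤ Θ * θ := by
      rw [← sq_abs, sq]
      exact mul_le_mul (hb'.trans hθ) hb' (abs_nonneg _) hΘ0
    have h8 : ux * b' ≤ 1 / 2 * ux ^ 2 + 1 / 2 * b' ^ 2 := by nlinarith [sq_nonneg (ux - b')]
    calc ε * ux * b' = ε * (ux * b') := by ring
      _ ≤ _ := by gcongr; linarith
  have hm2 : m ^ 2 ≤ 1 := pow_le_one₀ hm hm1
  have h9 : m ^ 2 * (-ε * Q - src - ε * ux * (ux - b'))
      ≤ m ^ 2 * (-ε * Q - 1 / 2 * (ε * ux ^ 2) + c * A) + (c₀ + ε * Θ) * θ := by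
    have : m ^ 2 * ((c₀ + ε * Θ) * θ) ≤ 1 * ((c₀ + ε * Θ) * θ) := by gcongr
    have h10 : m ^ 2 * (-ε * Q - src - ε * ux * (ux - b'))
        ≤ m ^ 2 * (-ε * Q - 1 / 2 * (ε * ux ^ 2) + c * A + (c₀ + ε * Θ) * θ) := by
      gcongr
      nlinarith [mul_nonneg hε (mul_nonneg hΘ0 hθ0)]
    linarith
  have h11 : 2 * m * (-(s / N) * G) ≤ 2 * m * (K / N * A) := by gcongr
  have h12 : 0 ≤ m ^ 2 * (ε * Q) := by positivity
  calc _ = E * (-c * m ^ 2 * A - 2 * m * (K / N * A) + 2 * m * (-(s / N) * G)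
      + 2 * m * (s / N) * (ε * w * ux)
      + m ^ 2 * (-ε * Q - src - ε * ux * (ux - b'))) := by ring
    _ ≤ _ := by
      refine mul_le_mul_of_nonneg_left ?_ hE
      have h13 : 4 * ε * w ^ 2 / N ^ 2 = ε * (4 * w ^ 2 / N ^ 2) := by ring
      rw [h13]
      nlinarith

theorem mul_abs_add_mul_abs_add_le {ρ v w V B : ℝ} (hρ : 0 ≤ ρ) (hv : |v| ≤ |w| + B) :
    |ρ * v * (w + V)| ≤ ρ * (2 * w ^ 2 + V ^ 2 + B ^ 2) := by
  rw [abs_mul, abs_mul, abs_of_nonneg hρ, mul_assoc]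
  refine mul_le_mul_of_nonneg_left ?_ hρ
  have h3 : |v| * |w + V| ≤ (|w| + B) * (|w| + |V|) :=
    mul_le_mul hv (abs_add_le _ _) (abs_nonneg _) ((abs_nonneg _).trans hv)
  rw [← sq_abs w, ← sq_abs V]
  linarith [two_mul_le_add_sq |w| |V|, two_mul_le_add_sq |w| B, two_mul_le_add_sq B |V|]

theorem abs_source_combination_le {T₁ T₂ T₃ T₄ b' r' c₁ c₂ c₃ c₄ : ℝ} (h₁ : |T₁| ≤ c₁)
    (h₂ : |T₂| ≤ c₂) (h₃ : |T₃| ≤ c₃) (h₄ : |T₄| ≤ c₄) :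
    |T₁ * b' + 2 * (T₂ * r' + T₃ * b' - T₄ * r')|
      ≤ (c₁ + 2 * (c₂ + c₃ + c₄)) * (|b'| + |r'|) := by
  have n₁ := (abs_nonneg _).trans h₁
  have n₂ := (abs_nonneg _).trans h₂
  have n₃ := (abs_nonneg _).trans h₃
  have n₄ := (abs_nonneg _).trans h₄
  have hb := abs_nonneg b'
  have hr := abs_nonneg r'
  have e₁ : |T₁ * b'| ≤ c₁ * |b'| := by rw [abs_mul]; gcongr
  have e₂ : |T₂ * r'| ≤ c₂ * |r'| := by rw [abs_mul]; gcongr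
  have e₃ : |T₃ * b'| ≤ c₃ * |b'| := by rw [abs_mul]; gcongr
  have e₄ : |T₄ * r'| ≤ c₄ * |r'| := by rw [abs_mul]; gcongr
  have p₁ := mul_nonneg n₁ hr
  have p₂ := mul_nonneg n₂ hb
  have p₃ := mul_nonneg n₃ hr
  have p₄ := mul_nonneg n₄ hb
  have q := abs_add_le (T₁ * b') (2 * (T₂ * r' + T₃ * b' - T₄ * r'))
  have q' := abs_sub (T₂ * r' + T₃ * b') (T₄ * r')
  have q'' := abs_add_le (T₂ * r') (T₃ * b')
  rw [abs_mul 2, abs_two] at q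
  linarith

namespace IsPressureLaw

variable {p : ℝ → ℝ} {γ κ ρs cs M : ℝ} (hp : IsPressureLaw p γ κ ρs cs M)
include hp

theorem relativeInternalEnergy_nonneg' {ρ r : ℝ} (hρ : 0 < ρ) (hr : 0 < r) :
    0 ≤ ρ * (enthalpy p ρ - enthalpy p r) - (p ρ - p r) :=
  (hp.relativeInternalEnergy_nonneg hρ hr).trans_eq (hp.relativeInternalEnergy_eq hρ hr)

theorem energyDensity_nonneg {r b : ℝ → ℝ} (hr0 : ∀ x, 0 < r x) {R U W : ℝ × ℝ → ℝ} {z : ℝ × ℝ}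
    (hR : 0 < R z) : 0 ≤ energyDensity p r b R U W z := by
  have := hp.relativeInternalEnergy_nonneg' hR (hr0 z.2)
  unfold energyDensity
  positivity

/-- The constant depends on the pressure law and the reference state alone, hence is uniform in `ε`.
Density and pressure are bounded by the energy through the linear growth of `e*`, and `W` through
its own kinetic energy. -/
theorem exists_energySource_le {r b : ℝ → ℝ} {B r₀ r₁ : ℝ} (h0 : 0 < r₀)
    (hr : ∀ x, r x ∈ Icc r₀ r₁) (hb : ∀ x, |b x| ≤ B) :
    ∃ c₀, 0 ≤ c₀ ∧ ∀ (R U W : ℝ × ℝ → ℝ) (z : ℝ × ℝ), 0 < R z →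
      |energySource p r b (R z) (U z) (W z) z.2|
        ≤ c₀ * (1 + energyDensity p r b R U W z) * (|deriv b z.2| + |deriv r z.2|) := by
  obtain ⟨C, hC, hCb⟩ := hp.exists_le_relativeInternalEnergy r₁
  have hr0 : ∀ x, 0 < r x := fun x => h0.trans_le (hr x).1
  have hsub : Icc r₀ r₁ ⊆ Ioi 0 := fun s hs => h0.trans_le hs.1
  obtain ⟨P₁, hP₁⟩ := isCompact_Icc.exists_bound_of_continuousOn (hp.continuousOn_deriv.mono hsub)
  obtain ⟨P, hP⟩ := isCompact_Icc.exists_bound_of_continuousOn (hp.continuousOn.mono hsub)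
  simp only [Real.norm_eq_abs] at hP hP₁
  have hB : 0 ≤ B := (abs_nonneg _).trans (hb 0)
  have hP0 : 0 ≤ P := (abs_nonneg _).trans (hP _ (hr 0))
  have hP10 : 0 ≤ P₁ := (abs_nonneg _).trans (hP₁ _ (hr 0))
  have hcs := hp.c_star_pos
  have hρs := hp.rho_star_pos
  refine ⟨(6 + B ^ 2 * C) + 2 * ((C / 2 + 1 + B * C) * (P₁ / r₀)
    + (cs * ρs + cs * C + P) + B * P₁), by positivity, fun R U W z hR => ?_⟩
  set x := z.2
  set ρ := R z
  set w := U z - b x with hw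
  set V := W z
  have hE0 := hp.relativeInternalEnergy_nonneg' hR (hr0 x)
  have hCE := hCb ρ (r x) hR (hr0 x) (hr x).2
  rw [hp.relativeInternalEnergy_eq hR (hr0 x)] at hCE
  have hdens : energyDensity p r b R U W z = 1 / 2 * ρ * w ^ 2 + 1 / 2 * ρ * V ^ 2
    + 2 * (ρ * (enthalpy p ρ - enthalpy p (r x)) - (p ρ - p (r x))) := rfl
  rw [hdens]
  set e := ρ * (enthalpy p ρ - enthalpy p (r x)) - (p ρ - p (r x))
  set A := 1 / 2 * ρ * w ^ 2 + 1 / 2 * ρ * V ^ 2 + 2 * e with hA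
  have hw2 : 0 ≤ ρ * w ^ 2 := by positivity
  have hV2 : 0 ≤ ρ * V ^ 2 := by positivity
  have hA0 : 0 ≤ A := by positivity
  have hρA : ρ ≤ C * (1 + A) := hCE.trans (by gcongr; linarith)
  have hρw : ρ * |w| ≤ (C / 2 + 1) * (1 + A) := by
    have : |w| ≤ 1 / 2 * (1 + w ^ 2) := by nlinarith [sq_nonneg (|w| - 1), sq_abs w]
    have h2 : ρ * |w| ≤ ρ * (1 / 2 * (1 + w ^ 2)) := by gcongr
    linarith
  have hv : |U z| ≤ |w| + B := by
    have : U z = w + b x := by rw [hw]; ring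
    rw [this]
    exact (abs_add_le _ _).trans (by linarith [hb x])
  have hρv : ρ * |U z| ≤ (C / 2 + 1 + B * C) * (1 + A) := by
    have h2 : ρ * |U z| ≤ ρ * (|w| + B) := by gcongr
    have h3 : B * ρ ≤ B * (C * (1 + A)) := by gcongr
    linarith
  have t1 : |ρ * U z * (w + V)| ≤ (6 + B ^ 2 * C) * (1 + A) := by
    refine (mul_abs_add_mul_abs_add_le hR.le hv).trans ?_
    have h5 : B ^ 2 * ρ ≤ B ^ 2 * (C * (1 + A)) := mul_le_mul_of_nonneg_left hρA (sq_nonneg B)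
    linarith
  have t2 : |deriv p (r x) / r x| ≤ P₁ / r₀ := by
    rw [abs_div, abs_of_pos (hr0 x)]
    gcongr
    · exact hP₁ _ (hr x)
    · exact (hr x).1
  have t3 : |ρ * U z * (deriv p (r x) / r x)| ≤ (C / 2 + 1 + B * C) * (P₁ / r₀) * (1 + A) := by
    rw [abs_mul, abs_mul, abs_of_pos hR]
    calc ρ * |U z| * |deriv p (r x) / r x|
        ≤ (C / 2 + 1 + B * C) * (1 + A) * (P₁ / r₀) := by gcongr
      _ = _ := by ring
  have t4 : |p ρ - p (r x)| ≤ (cs * ρs + cs * C + P) * (1 + A) := by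
    have h1 := hp.le_linear hR
    have h2 := hp.nonneg hR
    have h3 := (abs_le.1 (hP _ (hr x)))
    have h4 : cs * ρ ≤ cs * (C * (1 + A)) := by gcongr
    have h5 : 0 ≤ cs * ρs * A := by positivity
    have h6 : 0 ≤ P * A := by positivity
    have h7 : 0 ≤ cs * C * (1 + A) := by positivity
    have h8 : 0 ≤ cs * ρs := by positivity
    rw [abs_le]
    constructor <;> linarith [h3.1, h3.2]
  have t5 : |b x * deriv p (r x)| ≤ B * P₁ * (1 + A) := by
    rw [abs_mul]
    have h1 : |b x| * |deriv p (r x)| ≤ B * P₁ := by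
      gcongr
      · exact hb x
      · exact hP₁ _ (hr x)
    have : 0 ≤ B * P₁ * A := by positivity
    linarith
  have hsplit : energySource p r b ρ (U z) V x = (ρ * U z * (w + V)) * deriv b x
      + 2 * ((ρ * U z * (deriv p (r x) / r x)) * deriv r x + (p ρ - p (r x)) * deriv b x
        - (b x * deriv p (r x)) * deriv r x) := by
    rw [energySource, hw]
    ring
  rw [hsplit]
  refine (abs_source_combination_le t1 t3 t4 t5).trans (le_of_eq ?_)
  ring

/-- Here `K` depends on bounds of the particular flow, and so on `ε`. This is harmless: `K` only
determines how wide the cut-off must be. -/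
theorem exists_energyFlux_le {r b : ℝ → ℝ} {B V a β : ℝ} (ha : 0 < a)
    (hr : ∀ x, r x ∈ Icc a β) (hb : ∀ x, |b x| ≤ B) (hV : 0 ≤ V) :
    ∃ K, 0 ≤ K ∧ ∀ (R U W : ℝ × ℝ → ℝ) (z : ℝ × ℝ), R z ∈ Icc a β → |U z| ≤ V →
      |energyFlux p r b R U W z| ≤ K * energyDensity p r b R U W z := by
  have hr0 : ∀ x, 0 < r x := fun x => ha.trans_le (hr x).1
  obtain ⟨L, hL⟩ := isCompact_Icc.exists_bound_of_continuousOn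
    (f := fun s => deriv p s / s) (s := Icc a β)
    ((hp.continuousOn_deriv.div continuousOn_id fun x hx => (mem_Ioi.1 hx).ne').mono
      fun s hs => ha.trans_le hs.1)
  have hL' : ∀ s ∈ Icc a β, deriv p s / s ≤ L := fun s hs => (le_abs_self _).trans (hL s hs)
  have hL0 : 0 ≤ L := (norm_nonneg _).trans (hL _ (hr 0))
  have hβ : 0 ≤ β := ha.le.trans ((hr 0).1.trans (hr 0).2)
  have hB : 0 ≤ B := (abs_nonneg _).trans (hb 0)
  refine ⟨V + 2 + β * L + B, by positivity, fun R U W z hR hU => ?_⟩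
  have hRpos : 0 < R z := ha.trans_le hR.1
  have hE0 := hp.relativeInternalEnergy_nonneg' hRpos (hr0 z.2)
  have hsq := hp.sq_enthalpy_sub_le ha hL' hR (hr z.2)
  rw [hp.relativeInternalEnergy_eq hRpos (hr0 z.2)] at hsq
  unfold energyFlux energyDensity
  set ρ := R z
  set w := U z - b z.2
  set d := enthalpy p ρ - enthalpy p (r z.2)
  set e := ρ * d - (p ρ - p (r z.2))
  have h1 : |1 / 2 * (ρ * U z) * w ^ 2 + 1 / 2 * (ρ * U z) * W z ^ 2|
      ≤ V * (1 / 2 * ρ * w ^ 2 + 1 / 2 * ρ * W z ^ 2) := by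
    rw [show 1 / 2 * (ρ * U z) * w ^ 2 + 1 / 2 * (ρ * U z) * W z ^ 2
      = U z * (1 / 2 * ρ * w ^ 2 + 1 / 2 * ρ * W z ^ 2) by ring, abs_mul,
      abs_of_nonneg (by positivity : 0 ≤ 1 / 2 * ρ * w ^ 2 + 1 / 2 * ρ * W z ^ 2)]
    gcongr
  have h2 : |2 * (ρ * w * d)| ≤ ρ * w ^ 2 + β * (2 * L * e) := by
    have h3 : |2 * (w * d)| ≤ w ^ 2 + d ^ 2 := by
      rw [abs_le]
      constructor <;> nlinarith [sq_nonneg (w + d), sq_nonneg (w - d)]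
    have h4 : |2 * (ρ * w * d)| ≤ ρ * (w ^ 2 + d ^ 2) := by
      rw [show 2 * (ρ * w * d) = ρ * (2 * (w * d)) by ring, abs_mul, abs_of_pos hRpos]
      gcongr
    have h5 : ρ * d ^ 2 ≤ β * (2 * L * e) := by
      have := hR.2
      gcongr
    linarith
  have h6 : |2 * (b z.2 * e)| ≤ B * (2 * e) := by
    rw [show 2 * (b z.2 * e) = b z.2 * (2 * e) by ring, abs_mul,
      abs_of_nonneg (by positivity : 0 ≤ 2 * e)]
    gcongr
    exact hb _
  have h7 := abs_add_le (1 / 2 * (ρ * U z) * w ^ 2 + 1 / 2 * (ρ * U z) * W z ^ 2)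
    (2 * (ρ * w * d + b z.2 * e))
  have h8 := abs_add_le (2 * (ρ * w * d)) (2 * (b z.2 * e))
  rw [← mul_add] at h8
  have i1 : 0 ≤ ρ * w ^ 2 := by positivity
  have i2 : 0 ≤ ρ * W z ^ 2 := by positivity
  have i3 : 0 ≤ V * e := by positivity
  have i4 : 0 ≤ (2 + β * L + B) * (1 / 2 * ρ * W z ^ 2) := by positivity
  have i5 : 0 ≤ (β * L + B) * (1 / 2 * ρ * w ^ 2) := by positivity
  linarith

end IsPressureLaw

/-! ### The solution up to the initial time -/

/-- The closed half-plane. -/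
def closedHalfPlane : Set (ℝ × ℝ) := Ici 0 ×ˢ univ

/-- The `x`-derivative of `F` on the closed half-plane. -/
noncomputable def derivXWithin (F : ℝ × ℝ → ℝ) (z : ℝ × ℝ) : ℝ :=
  fderivWithin ℝ F closedHalfPlane z (0, 1)

theorem uniqueDiffOn_closedHalfPlane : UniqueDiffOn ℝ closedHalfPlane :=
  (uniqueDiffOn_Ici 0).prod uniqueDiffOn_univ

theorem derivXWithin_eq {F : ℝ × ℝ → ℝ} {z : ℝ × ℝ} (hz : 0 < z.1) :
    derivXWithin F z = derivX F z := by
  rw [derivXWithin, derivX, fderivWithin_of_mem_nhds]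
  exact prod_mem_nhds (Ici_mem_nhds hz) univ_mem

theorem ContDiffOn.continuousOn_derivXWithin {F : ℝ × ℝ → ℝ}
    (h : ContDiffOn ℝ 2 F closedHalfPlane) : ContinuousOn (derivXWithin F) closedHalfPlane :=
  (h.continuousOn_fderivWithin uniqueDiffOn_closedHalfPlane (by norm_num)).clm_apply
    continuousOn_const

theorem ContDiffOn.hasDerivAt_derivXWithin {F : ℝ × ℝ → ℝ}
    (h : ContDiffOn ℝ 2 F closedHalfPlane) {t : ℝ} (ht : 0 ≤ t) (x : ℝ) :
    HasDerivAt (fun y => F (t, y)) (derivXWithin F (t, x)) x := by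
  have h1 : DifferentiableWithinAt ℝ F closedHalfPlane (t, x) :=
    h.differentiableOn (by norm_num) _ ⟨ht, mem_univ _⟩
  have h2 := HasFDerivWithinAt.comp_hasDerivWithinAt (t := closedHalfPlane) (s := univ)
    (f := fun y => (t, y)) x h1.hasFDerivWithinAt
    ((hasDerivAt_const x t).prodMk (hasDerivAt_id' x)).hasDerivWithinAt
    (fun y _ => ⟨ht, mem_univ _⟩)
  exact hasDerivWithinAt_univ.1 h2

/-- The effective velocity `U - b + ε R_x / R²` relative to `b`. -/
noncomputable def effectiveVelocity (ε : ℝ) (b : ℝ → ℝ) (R U : ℝ × ℝ → ℝ) (z : ℝ × ℝ) : ℝ :=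
  U z - b z.2 + ε * derivXWithin R z / R z ^ 2

/-- The dissipation density `U_x² + p'(R) R_x² / R²`. -/
noncomputable def dissipationDensity (p : ℝ → ℝ) (R U : ℝ × ℝ → ℝ) (z : ℝ × ℝ) : ℝ :=
  derivXWithin U z ^ 2 + deriv p (R z) * derivXWithin R z ^ 2 / R z ^ 2

theorem Icc_prod_subset_closedHalfPlane (T N : ℝ) : Icc ((0 : ℝ), -N) (T, N) ⊆ closedHalfPlane :=
  fun _ hz => ⟨hz.1.1, mem_univ _⟩

section

variable {p : ℝ → ℝ} {γ κ ρs cs M : ℝ} (hp : IsPressureLaw p γ κ ρs cs M)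
  {ε : ℝ} {R U : ℝ × ℝ → ℝ} (hR : ContDiffOn ℝ 2 R closedHalfPlane)
  (hU : ContDiffOn ℝ 2 U closedHalfPlane) (hpos : ∀ z ∈ closedHalfPlane, 0 < R z)
  {r b : ℝ → ℝ} (hr : ContDiff ℝ 1 r) (hb : ContDiff ℝ 1 b) (hr0 : ∀ x, 0 < r x)

include hR hU hpos

theorem continuousOn_dissipationDensity (hp : IsPressureLaw p γ κ ρs cs M) :
    ContinuousOn (dissipationDensity p R U) closedHalfPlane := by
  have c1 : ContinuousOn (fun z => deriv p (R z)) closedHalfPlane :=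
    hp.continuousOn_deriv.comp hR.continuousOn hpos
  exact (hU.continuousOn_derivXWithin.pow 2).add ((c1.mul
    (hR.continuousOn_derivXWithin.pow 2)).div (hR.continuousOn.pow 2)
    fun z hz => (pow_pos (hpos z hz) 2).ne')

include hb in
theorem continuousOn_effectiveVelocity :
    ContinuousOn (effectiveVelocity ε b R U) closedHalfPlane :=
  (hU.continuousOn.sub (hb.continuous.comp continuous_snd).continuousOn).add
    ((continuousOn_const.mul hR.continuousOn_derivXWithin).div (hR.continuousOn.pow 2)
    fun z hz => (pow_pos (hpos z hz) 2).ne')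

include hp hr hb hr0

theorem continuousOn_energyDensity :
    ContinuousOn (energyDensity p r b R U (effectiveVelocity ε b R U)) closedHalfPlane ∧
    ContinuousOn (energyFlux p r b R U (effectiveVelocity ε b R U)) closedHalfPlane ∧
    ContinuousOn (fun z => energySource p r b (R z) (U z) (effectiveVelocity ε b R U z) z.2)
      closedHalfPlane := by
  have ch : ContinuousOn (enthalpy p) (Ioi 0) := fun s hs =>
    (hp.hasDerivAt_enthalpy hs).continuousAt.continuousWithinAt
  have cR := hR.continuousOn
  have cU := hU.continuousOn
  have chR : ContinuousOn (fun z => enthalpy p (R z)) closedHalfPlane := ch.comp cR hpos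
  have cpR : ContinuousOn (fun z => p (R z)) closedHalfPlane := hp.continuousOn.comp cR hpos
  have cr : ContinuousOn (fun z : ℝ × ℝ => r z.2) closedHalfPlane :=
    (hr.continuous.comp continuous_snd).continuousOn
  have cb : ContinuousOn (fun z : ℝ × ℝ => b z.2) closedHalfPlane :=
    (hb.continuous.comp continuous_snd).continuousOn
  have cr' : ContinuousOn (fun z : ℝ × ℝ => deriv r z.2) closedHalfPlane :=
    ((hr.continuous_deriv le_rfl).comp continuous_snd).continuousOn
  have cb' : ContinuousOn (fun z : ℝ × ℝ => deriv b z.2) closedHalfPlane :=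
    ((hb.continuous_deriv le_rfl).comp continuous_snd).continuousOn
  have chr : ContinuousOn (fun z : ℝ × ℝ => enthalpy p (r z.2)) closedHalfPlane :=
    ch.comp cr fun z _ => hr0 z.2
  have cpr : ContinuousOn (fun z : ℝ × ℝ => p (r z.2)) closedHalfPlane :=
    hp.continuousOn.comp cr fun z _ => hr0 z.2
  have cpr' : ContinuousOn (fun z : ℝ × ℝ => deriv p (r z.2)) closedHalfPlane :=
    hp.continuousOn_deriv.comp cr fun z _ => hr0 z.2
  have cW := continuousOn_effectiveVelocity (ε := ε) hR hU hpos hb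
  have cE := (cR.mul (chR.sub chr)).sub (cpR.sub cpr)
  refine ⟨?_, ?_, ?_⟩
  · exact (((continuousOn_const.mul cR).mul ((cU.sub cb).pow 2)).add
      ((continuousOn_const.mul cR).mul (cW.pow 2))).add (continuousOn_const.mul cE)
  · exact (((continuousOn_const.mul (cR.mul cU)).mul ((cU.sub cb).pow 2)).add
      ((continuousOn_const.mul (cR.mul cU)).mul (cW.pow 2))).add
      (continuousOn_const.mul (((cR.mul (cU.sub cb)).mul (chR.sub chr)).add (cb.mul cE)))
  · exact ((((cR.mul cU).mul ((cU.sub cb).add cW)).mul cb')).add (continuousOn_const.mul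
      (((((cR.mul cU).mul (cpr'.div cr fun z _ => (hr0 z.2).ne')).mul cr').add
        (cb'.mul (cpR.sub cpr))).sub ((cb.mul cpr').mul cr')))

omit hR hU hpos in
/-- The balance law of the weighted energy. -/
theorem weighted_energy_identity (hf : IsSmoothFlow p ε R U) (c K N : ℝ) {t x : ℝ} (ht : 0 < t) :
    DifferentiableAt ℝ (fun z => coneWeight c K N z
      * energyDensity p r b R U (effectiveVelocity ε b R U) z) (t, x) ∧
    DifferentiableAt ℝ (fun z => coneWeight c K N z
      * (energyFlux p r b R U (effectiveVelocity ε b R U) z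
        - ε * (U z - b z.2) * derivXWithin U z)) (t, x) ∧
    derivT (fun z => coneWeight c K N z
      * energyDensity p r b R U (effectiveVelocity ε b R U) z) (t, x)
    + derivX (fun z => coneWeight c K N z
      * (energyFlux p r b R U (effectiveVelocity ε b R U) z
        - ε * (U z - b z.2) * derivXWithin U z)) (t, x)
    = derivT (coneWeight c K N) (t, x) * energyDensity p r b R U (effectiveVelocity ε b R U) (t, x)
      + derivX (coneWeight c K N) (t, x)
        * (energyFlux p r b R U (effectiveVelocity ε b R U) (t, x)
          - ε * (U (t, x) - b x) * derivXWithin U (t, x))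
      + coneWeight c K N (t, x) * (-ε * (deriv p (R (t, x)) * derivXWithin R (t, x) ^ 2
          / R (t, x) ^ 2)
        - energySource p r b (R (t, x)) (U (t, x)) (effectiveVelocity ε b R U (t, x)) x
        - ε * derivXWithin U (t, x) * (derivXWithin U (t, x) - deriv b x)) := by
  have hz : 0 < (t, x).1 := ht
  have hev : ∀ᶠ z : ℝ × ℝ in 𝓝 (t, x), 0 < z.1 :=
    (continuous_fst.tendsto (t, x)).eventually (lt_mem_nhds ht)
  have hbd : Differentiable ℝ b := hb.differentiable (by norm_num)
  have db : DifferentiableAt ℝ (fun z : ℝ × ℝ => b z.2) (t, x) :=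
    (hbd x).comp (t, x) differentiableAt_snd
  have dU := hf.differentiableAt_u hz
  have dUx := hf.differentiableAt_derivX_u hz
  have dUx' : DifferentiableAt ℝ (derivXWithin U) (t, x) :=
    dUx.congr_of_eventuallyEq (hev.mono fun z hz => derivXWithin_eq hz)
  obtain ⟨dV, hV⟩ := hf.effective_velocity (x := x) ht
  set V := fun z => ε * derivX R z / R z ^ 2 with hVdef
  have eW : (effectiveVelocity ε b R U) =ᶠ[𝓝 (t, x)] fun z => U z - b z.2 + V z :=
    hev.mono fun z hz => by simp only [effectiveVelocity, hVdef, derivXWithin_eq hz]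
  have dW : DifferentiableAt ℝ (effectiveVelocity ε b R U) (t, x) :=
    ((dU.fun_sub db).fun_add dV).congr_of_eventuallyEq eW
  have hWt : derivT (effectiveVelocity ε b R U) (t, x) = derivT U (t, x) + derivT V (t, x) := by
    rw [derivT, eW.fderiv_eq]
    exact ((dU.fun_sub db).fun_add dV).hasDerivAt_slice_fst.unique
      ((dU.hasDerivAt_slice_fst.sub_const (b x)).fun_add dV.hasDerivAt_slice_fst)
  have hWx : derivX (effectiveVelocity ε b R U) (t, x)
      = derivX U (t, x) - deriv b x + derivX V (t, x) := by
    rw [derivX, eW.fderiv_eq]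
    exact ((dU.fun_sub db).fun_add dV).hasDerivAt_slice_snd.unique
      ((dU.hasDerivAt_slice_snd.fun_sub (hbd x).hasDerivAt).fun_add dV.hasDerivAt_slice_snd)
  obtain ⟨dA, dG, hAG⟩ := hf.energy_identity hp (hr.differentiable (by norm_num)) hbd hr0 ht dW (by
    rw [hWt, hWx]
    linear_combination hV + hf.momentum _ hz)
  obtain ⟨dφ, -, -⟩ := coneWeight_slice c K N t x
  set A := energyDensity p r b R U (effectiveVelocity ε b R U)
  set G := energyFlux p r b R U (effectiveVelocity ε b R U)
  have dF : DifferentiableAt ℝ (fun z => G z - ε * (U z - b z.2) * derivXWithin U z) (t, x) :=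
    dG.fun_sub (((dU.fun_sub db).const_mul ε).fun_mul dUx')
  have eUxx : derivX (derivXWithin U) (t, x) = derivX (derivX U) (t, x) := by
    have e : derivXWithin U =ᶠ[𝓝 (t, x)] derivX U := hev.mono fun z hz => derivXWithin_eq hz
    rw [derivX, e.fderiv_eq]
    rfl
  refine ⟨dφ.fun_mul dA, dφ.fun_mul dF, ?_⟩
  have h1 := (dφ.fun_mul dA).hasDerivAt_slice_fst.unique
    (dφ.hasDerivAt_slice_fst.fun_mul dA.hasDerivAt_slice_fst)
  have h2 := (dφ.fun_mul dF).hasDerivAt_slice_snd.unique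
    (dφ.hasDerivAt_slice_snd.fun_mul (dG.hasDerivAt_slice_snd.fun_sub
      (((dU.hasDerivAt_slice_snd.fun_sub (hbd x).hasDerivAt).const_mul ε).fun_mul
        dUx'.hasDerivAt_slice_snd)))
  rw [h1, h2, eUxx]
  have hRne := (hf.pos _ hz).ne'
  have hWU : U (t, x) - b x - effectiveVelocity ε b R U (t, x)
      = -(ε * derivX R (t, x) / R (t, x) ^ 2) := by
    rw [effectiveVelocity, derivXWithin_eq hz]
    ring
  rw [hWU] at hAG
  rw [derivXWithin_eq hz, derivXWithin_eq hz]
  linear_combination (coneWeight c K N (t, x)) * hAG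

end

/-! ### The dissipation bound, uniform in the viscosity. -/

/-- The dissipation of a smooth flow on a bounded region is controlled by the initial energy and
the variation of the reference state. -/
theorem IsSmoothFlow.dissipation_le {p : ℝ → ℝ} {γ κ ρs cs M : ℝ}
    (hp : IsPressureLaw p γ κ ρs cs M) {ε : ℝ} (hε : 0 ≤ ε) {R U : ℝ × ℝ → ℝ}
    (hR : ContDiffOn ℝ 2 R closedHalfPlane) (hU : ContDiffOn ℝ 2 U closedHalfPlane)
    (hpos : ∀ z ∈ closedHalfPlane, 0 < R z) (hf : IsSmoothFlow p ε R U)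
    {r b : ℝ → ℝ} (hr : ContDiff ℝ 1 r) (hb : ContDiff ℝ 1 b) (hr0 : ∀ x, 0 < r x)
    {T X K c₀ Θ Θ₁ C₀ Cw : ℝ} (hT : 0 < T) (hX : 0 < X) (hK : 0 ≤ K) (hc₀ : 0 ≤ c₀)
    (hG : ∀ z ∈ closedHalfPlane, z.1 ≤ T →
      |energyFlux p r b R U (effectiveVelocity ε b R U) z|
        ≤ K * energyDensity p r b R U (effectiveVelocity ε b R U) z)
    (hsrc : ∀ z ∈ closedHalfPlane,
      |energySource p r b (R z) (U z) (effectiveVelocity ε b R U z) z.2|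
        ≤ c₀ * (1 + energyDensity p r b R U (effectiveVelocity ε b R U) z)
          * (|deriv b z.2| + |deriv r z.2|))
    (hw : ∀ z ∈ closedHalfPlane, z.1 ≤ T → (U z - b z.2) ^ 2 ≤ Cw)
    (hΘ : ∀ x, |deriv b x| + |deriv r x| ≤ Θ)
    (hΘ₁ : ∀ N, ∫ x in Icc (-N) N, (|deriv b x| + |deriv r x|) ≤ Θ₁)
    (hC₀ : ∀ N, 0 ≤ N →
      ∫ x in (-N)..N, energyDensity p r b R U (effectiveVelocity ε b R U) (0, x) ≤ C₀) :
    Real.exp (-(c₀ * Θ) * T) / 16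
      * ∫ z in Icc ((0 : ℝ), -X) (T, X), ε * dissipationDensity p R U z
      ≤ C₀ + T * ((c₀ + ε * Θ) * Θ₁) + 1 := by
  set W := effectiveVelocity ε b R U with hW
  set A := energyDensity p r b R U W with hA
  set G := energyFlux p r b R U W with hGdef
  have hCw : 0 ≤ Cw := (sq_nonneg _).trans (hw (0, 0) ⟨self_mem_Ici, mem_univ _⟩ hT.le)
  have hΘ0 : 0 ≤ Θ := (by positivity : (0 : ℝ) ≤ |deriv b 0| + |deriv r 0|).trans (hΘ 0)
  -- The first entry keeps the profile at least `1/2` on `[0,T] × [-X,X]`; the second makes the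
  -- total viscous cut-off error `8 ε Cw T / N` at most `1`. Thus neither `K` nor `Cw` appears in
  -- the result.
  set N := max (2 * (1 + X + K * T)) (8 * ε * Cw * T) with hNdef
  have hN1 : 2 * (1 + X + K * T) ≤ N := le_max_left _ _
  have hKT : 0 ≤ K * T := by positivity
  have hN : 0 < N := by linarith
  have hXN : X ≤ N := by linarith
  have hN2 : 8 * ε * Cw * T ≤ N := le_max_right _ _
  set c := c₀ * Θ with hc
  obtain ⟨cA, cG, cS⟩ := continuousOn_energyDensity hp (ε := ε) hR hU hpos hr hb hr0
  have cφ : Continuous (coneWeight c K N) :=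
    (Real.continuous_exp.comp (by fun_prop)).mul ((continuous_coneProfile K N).pow 2)
  have cb : ContinuousOn (fun z : ℝ × ℝ => b z.2) closedHalfPlane :=
    (hb.continuous.comp continuous_snd).continuousOn
  have cb' : ContinuousOn (fun z : ℝ × ℝ => deriv b z.2) closedHalfPlane :=
    ((hb.continuous_deriv le_rfl).comp continuous_snd).continuousOn
  have cRx := hR.continuousOn_derivXWithin
  have cUx := hU.continuousOn_derivXWithin
  have cp' : ContinuousOn (fun z => deriv p (R z)) closedHalfPlane :=
    hp.continuousOn_deriv.comp hR.continuousOn hpos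
  have cQ : ContinuousOn (fun z => deriv p (R z) * derivXWithin R z ^ 2 / R z ^ 2)
      closedHalfPlane := (cp'.mul (cRx.pow 2)).div (hR.continuousOn.pow 2)
    fun z hz => (pow_pos (hpos z hz) 2).ne'
  have cF : ContinuousOn (fun z => G z - ε * (U z - b z.2) * derivXWithin U z) closedHalfPlane :=
    cG.sub ((continuousOn_const.mul (hU.continuousOn.sub cb)).mul cUx)
  set E : ℝ × ℝ → ℝ := fun z => Real.exp (-c * z.1) with hE
  have cE : Continuous E := by fun_prop
  set m := coneProfile K N with hm
  have cm : Continuous m := continuous_coneProfile K N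
  -- The divergence of the weighted energy balance, written without time derivatives so that it is
  -- continuous up to `t = 0`.
  set D : ℝ × ℝ → ℝ := fun z =>
    (-c * (E z * m z ^ 2) - E z * (2 * m z * (K / N))) * A z
      + -(E z * (2 * m z * (z.2 / √(1 + z.2 ^ 2) / N)))
        * (G z - ε * (U z - b z.2) * derivXWithin U z)
      + E z * m z ^ 2 * (-ε * (deriv p (R z) * derivXWithin R z ^ 2 / R z ^ 2)
        - energySource p r b (R z) (U z) (W z) z.2
        - ε * derivXWithin U z * (derivXWithin U z - deriv b z.2)) with hD
  have cs : Continuous fun z : ℝ × ℝ => z.2 / √(1 + z.2 ^ 2) / N := by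
    refine (continuous_snd.div (by fun_prop) fun z => ?_).div_const N
    have : (0 : ℝ) < 1 + z.2 ^ 2 := by positivity
    positivity
  have cD : ContinuousOn D closedHalfPlane := by
    refine (ContinuousOn.add ?_ ?_).add ?_
    · refine ContinuousOn.mul ?_ cA
      exact ((continuous_const.mul (cE.mul (cm.pow 2))).sub
        (cE.mul ((continuous_const.mul cm).mul continuous_const))).continuousOn
    · exact ((cE.mul ((continuous_const.mul cm).mul cs)).neg.continuousOn).mul cF
    · refine ((cE.mul (cm.pow 2)).continuousOn).mul ?_
      exact ((continuousOn_const.mul cQ).sub cS).sub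
        ((continuousOn_const.mul cUx).mul (cUx.sub cb'))
  set θ : ℝ → ℝ := fun x => |deriv b x| + |deriv r x| with hθ
  have cθ : Continuous θ :=
    (hb.continuous_deriv le_rfl).abs.add (hr.continuous_deriv le_rfl).abs
  set g : ℝ → ℝ := fun x => (c₀ + ε * Θ) * θ x + 4 * ε * Cw / N ^ 2 with hg
  have cg : Continuous g := (continuous_const.mul cθ).add continuous_const
  have hg0 : ∀ x, 0 ≤ g x := fun x => by
    have : 0 ≤ θ x := by positivity
    positivity
  have hAnn : ∀ z ∈ closedHalfPlane, 0 ≤ A z := fun z hz =>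
    hp.energyDensity_nonneg hr0 (hpos z hz)
  have hDle : ∀ z ∈ closedHalfPlane, z.1 ≤ T →
      E z * (1 / 4 * m z ^ 2 * (ε * dissipationDensity p R U z)) ≤ g z.2 - D z := by
    intro z hz hzT
    have hz0 : 0 ≤ z.1 := hz.1
    have hE0 : 0 ≤ E z := (Real.exp_pos _).le
    have hE1 : E z ≤ 1 := by
      refine Real.exp_le_one_iff.2 ?_
      have : 0 ≤ c * z.1 := by positivity
      linarith
    have hs : |z.2 / √(1 + z.2 ^ 2)| ≤ 1 := by
      have h1 : (0 : ℝ) < √(1 + z.2 ^ 2) := Real.sqrt_pos.2 (by positivity)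
      rw [abs_div, abs_of_pos h1, div_le_one h1]
      exact Real.abs_le_sqrt (by linarith)
    have hp' := hp.strictly_hyperbolic _ (hpos z hz)
    have key := weighted_dissipation_le (E := E z) (m := m z) (c := c) (c₀ := c₀) (K := K) (N := N)
      (A := A z) (G := G z) (w := U z - b z.2) (ux := derivXWithin U z) (b' := deriv b z.2)
      (θ := θ z.2) (Θ := Θ) (ε := ε) (s := z.2 / √(1 + z.2 ^ 2))
      (src := energySource p r b (R z) (U z) (W z) z.2)
      (Q := deriv p (R z) * derivXWithin R z ^ 2 / R z ^ 2) hE0 (coneProfile_nonneg _ _ _)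
      (coneProfile_le_one hK hN hz0) hN hε (hAnn z hz) hc₀ (hG z hz hzT) hs (hΘ z.2)
      (le_add_of_nonneg_right (abs_nonneg _)) (hsrc z hz) hc (by positivity)
    have h1 : E z * ((c₀ + ε * Θ) * θ z.2 + 4 * ε * (U z - b z.2) ^ 2 / N ^ 2) ≤ g z.2 := by
      have h2 : (c₀ + ε * Θ) * θ z.2 + 4 * ε * (U z - b z.2) ^ 2 / N ^ 2 ≤ g z.2 := by
        have := hw z hz hzT
        simp only [hg]
        gcongr
      calc _ ≤ E z * g z.2 := by gcongr
        _ ≤ 1 * g z.2 := mul_le_mul_of_nonneg_right hE1 (hg0 _)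
        _ = _ := one_mul _
    have h3 : D z ≤ E z * (-(1 / 4 * m z ^ 2 * (ε * dissipationDensity p R U z))
        + ((c₀ + ε * Θ) * θ z.2 + 4 * ε * (U z - b z.2) ^ 2 / N ^ 2)) := key
    linarith
  have hsub : Icc ((0 : ℝ), -N) (T, N) ⊆ closedHalfPlane := Icc_prod_subset_closedHalfPlane T N
  have hdiv := neg_integral_le_of_divergence_eq (T := T) (N := N)
    (f := fun z => coneWeight c K N z * A z)
    (g := fun z => coneWeight c K N z * (G z - ε * (U z - b z.2) * derivXWithin U z)) (D := D)
    hT.le hN.le ((cφ.continuousOn.mul cA).mono hsub) ((cφ.continuousOn.mul cF).mono hsub)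
    (cD.mono hsub)
    (fun t x ht => (weighted_energy_identity hp hr hb hr0 hf c K N ht).1)
    (fun t x ht => (weighted_energy_identity hp hr hb hr0 hf c K N ht).2.1)
    (fun t x ht => by
      obtain ⟨-, e1, e2⟩ := coneWeight_slice c K N t x
      rw [(weighted_energy_identity hp hr hb hr0 hf c K N ht).2.2, e1, e2]
      rfl)
    (fun t ht => by
      have h1 : coneProfile K N (t, N) = 0 :=
        coneProfile_eq_zero hK hN ht.1 (le_abs_self N)
      have h2 : coneProfile K N (t, -N) = 0 :=
        coneProfile_eq_zero hK hN ht.1 (by simp [abs_neg, le_abs_self])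
      simp [coneWeight, h1, h2])
    (fun x => mul_nonneg (mul_nonneg (Real.exp_pos _).le (sq_nonneg _))
      (hAnn _ ⟨hT.le, mem_univ _⟩))
  have hinit : ∫ x in (-N)..N, coneWeight c K N (0, x) * A (0, x) ≤ C₀ := by
    have cA0 : Continuous fun x => A (0, x) := by
      rw [← continuousOn_univ]
      exact cA.comp (by fun_prop) fun x _ => ⟨self_mem_Ici, mem_univ _⟩
    refine (intervalIntegral.integral_mono_on (by linarith) ?_ ?_ fun x _ => ?_).trans
      (hC₀ N hN.le)
    · exact ((cφ.comp (continuous_const.prodMk continuous_id)).mul cA0).intervalIntegrable _ _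
    · exact cA0.intervalIntegrable _ _
    · have h1 : coneWeight c K N (0, x) ≤ 1 := by
        simp only [coneWeight, mul_zero, Real.exp_zero, one_mul]
        exact pow_le_one₀ (coneProfile_nonneg _ _ _) (coneProfile_le_one hK hN le_rfl)
      exact mul_le_of_le_one_left (hAnn _ ⟨self_mem_Ici, mem_univ _⟩) h1
  have hgint : ∫ z in Icc ((0 : ℝ), -N) (T, N), g z.2 ≤ T * ((c₀ + ε * Θ) * Θ₁) + 1 := by
    have e : Icc ((0 : ℝ), -N) (T, N) = Icc 0 T ×ˢ Icc (-N) N := (Icc_prod_Icc _ _ _ _).symm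
    have h1 := setIntegral_prod_mul (μ := volume) (ν := volume) (fun _ : ℝ => (1 : ℝ)) g (Icc 0 T)
      (Icc (-N) N)
    simp only [one_mul] at h1
    rw [e, Measure.volume_eq_prod, h1, setIntegral_const, Real.volume_real_Icc_of_le hT.le,
      sub_zero, smul_eq_mul, mul_one]
    have h2 : ∫ x in Icc (-N) N, g x
        = (c₀ + ε * Θ) * (∫ x in Icc (-N) N, θ x) + 4 * ε * Cw / N ^ 2 * (2 * N) := by
      have i1 : IntegrableOn (fun x => (c₀ + ε * Θ) * θ x) (Icc (-N) N) :=
        (continuous_const.mul cθ).continuousOn.integrableOn_compact isCompact_Icc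
      have i2 : IntegrableOn (fun _ => 4 * ε * Cw / N ^ 2) (Icc (-N) N) :=
        continuousOn_const.integrableOn_compact isCompact_Icc
      rw [integral_add i1 i2, integral_const_mul, setIntegral_const,
        Real.volume_real_Icc_of_le (by linarith), smul_eq_mul]
      ring
    rw [h2]
    have h3 : T * (4 * ε * Cw / N ^ 2 * (2 * N)) ≤ 1 := by
      rw [show T * (4 * ε * Cw / N ^ 2 * (2 * N)) = 8 * ε * Cw * T / N by field_simp; ring,
        div_le_one hN]
      exact hN2
    have h4 : T * ((c₀ + ε * Θ) * ∫ x in Icc (-N) N, θ x) ≤ T * ((c₀ + ε * Θ) * Θ₁) := by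
      gcongr
      exact hΘ₁ N
    linarith
  have ig : IntegrableOn (fun z : ℝ × ℝ => g z.2) (Icc ((0 : ℝ), -N) (T, N)) :=
    (cg.comp continuous_snd).continuousOn.integrableOn_compact isCompact_Icc
  have iD : IntegrableOn D (Icc ((0 : ℝ), -N) (T, N)) :=
    (cD.mono hsub).integrableOn_compact isCompact_Icc
  have hsub2 : Icc ((0 : ℝ), -X) (T, X) ⊆ Icc ((0 : ℝ), -N) (T, N) :=
    Icc_subset_Icc ⟨le_rfl, by simpa using hXN⟩ ⟨le_rfl, hXN⟩
  have hdis0 : ∀ z ∈ closedHalfPlane, 0 ≤ dissipationDensity p R U z := fun z hz => by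
    have hp' := hp.strictly_hyperbolic _ (hpos z hz)
    unfold dissipationDensity
    positivity
  have hm_meas : MeasurableSet (Icc ((0 : ℝ), -N) (T, N)) := measurableSet_Icc
  calc Real.exp (-c * T) / 16 * ∫ z in Icc ((0 : ℝ), -X) (T, X), ε * dissipationDensity p R U z
      = ∫ z in Icc ((0 : ℝ), -X) (T, X),
          Real.exp (-c * T) / 16 * (ε * dissipationDensity p R U z) :=
        (integral_const_mul _ _).symm
    -- On the inner rectangle `m ≥ 1/2` and `E ≥ exp (-cT)`; the factor `1/16` is `1/4 · (1/2)²`.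
    _ ≤ ∫ z in Icc ((0 : ℝ), -X) (T, X), (g z.2 - D z) := by
        refine setIntegral_mono_on ?_ ((ig.sub iD).mono_set hsub2) measurableSet_Icc
          fun z hz => ?_
        · exact ((continuousOn_const.mul (continuousOn_const.mul
            (continuousOn_dissipationDensity hR hU hpos hp))).mono
            (hsub2.trans hsub)).integrableOn_compact isCompact_Icc
        · have hz' := hsub (hsub2 hz)
          refine le_trans ?_ (hDle z hz' hz.2.1)
          have h1 : 1 / 2 ≤ m z := half_le_coneProfile hK hN hN1 hz.2.1 (abs_le.2 ⟨hz.1.2, hz.2.2⟩)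
          have h2 : (1 / 2 : ℝ) ^ 2 ≤ m z ^ 2 := pow_le_pow_left₀ (by norm_num) h1 2
          have h3 : Real.exp (-c * T) ≤ E z := by
            refine Real.exp_le_exp.2 ?_
            have : c * z.1 ≤ c * T := mul_le_mul_of_nonneg_left hz.2.1 (by positivity)
            linarith
          have h4 := mul_nonneg hε (hdis0 z hz')
          calc Real.exp (-c * T) / 16 * (ε * dissipationDensity p R U z)
              = Real.exp (-c * T) * (1 / 4 * (1 / 2) ^ 2 * (ε * dissipationDensity p R U z)) := by
                ring
            _ ≤ _ := by gcongr
    -- The integrand is nonnegative by `hDle`, so the rectangle may be enlarged to where the cut-off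
    -- vanishes on the sides.
    _ ≤ ∫ z in Icc ((0 : ℝ), -N) (T, N), (g z.2 - D z) := by
        refine setIntegral_mono_set (ig.sub iD) ?_ hsub2.eventuallyLE
        refine (ae_restrict_iff' hm_meas).2 (Eventually.of_forall fun z hz => ?_)
        refine le_trans ?_ (hDle z (hsub hz) hz.2.1)
        have h4 := mul_nonneg hε (hdis0 z (hsub hz))
        have h5 : 0 ≤ E z := (Real.exp_pos _).le
        simp only [Pi.zero_apply]
        positivity
    _ = (∫ z in Icc ((0 : ℝ), -N) (T, N), g z.2) - ∫ z in Icc ((0 : ℝ), -N) (T, N), D z :=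
        integral_sub ig iD
    _ ≤ _ := by linarith

/-! ### Reference states, initial energy and the bound for the whole sequence. -/

namespace IsReferencePair

theorem bounds_of_monotone {f : ℝ → ℝ} (hf : Monotone f ∨ Antitone f) {a b L : ℝ}
    (hb : ∀ x, L ≤ x → f x = b) (ha : ∀ x, x ≤ -L → f x = a) (x : ℝ) :
    f x ∈ Icc (min a b) (max a b) := by
  have h1 : f (min x (-L)) = a := ha _ (min_le_right _ _)
  have h2 : f (max x L) = b := hb _ (le_max_right _ _)
  rcases hf with hf | hf
  · exact ⟨(min_le_left _ _).trans (h1 ▸ hf (min_le_left _ _)),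
      le_trans (h2 ▸ hf (le_max_left _ _)) (le_max_right _ _)⟩
  · exact ⟨(min_le_right _ _).trans (h2 ▸ hf (le_max_left _ _)),
      le_trans (h1 ▸ hf (min_le_left _ _)) (le_max_left _ _)⟩

theorem deriv_eq_zero_of_eventually_const {f : ℝ → ℝ} {a b L : ℝ}
    (hb : ∀ x, L ≤ x → f x = b) (ha : ∀ x, x ≤ -L → f x = a) {x : ℝ} (hx : L < |x|) :
    deriv f x = 0 := by
  rcases lt_abs.1 hx with h | h
  · rw [EventuallyEq.deriv_eq (f := fun _ => b), deriv_const]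
    filter_upwards [Ioi_mem_nhds h] with y hy using hb y (le_of_lt hy)
  · rw [EventuallyEq.deriv_eq (f := fun _ => a), deriv_const]
    filter_upwards [Iio_mem_nhds (show x < -L by linarith)] with y hy using ha y (le_of_lt hy)

variable {ρl ul ρr ur : ℝ} {ρbar ubar : ℝ → ℝ} (h : IsReferencePair ρl ul ρr ur ρbar ubar)
include h

theorem rho_mem (x : ℝ) : ρbar x ∈ Icc (min ρl ρr) (max ρl ρr) := by
  obtain ⟨L, hL, h1, h2⟩ := h.eq_end_states
  exact bounds_of_monotone h.monotone_rho (fun x hx => (h1 x hx).1) (fun x hx => (h2 x hx).1) x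

theorem abs_u_le (x : ℝ) : |ubar x| ≤ max |ul| |ur| := by
  obtain ⟨L, hL, h1, h2⟩ := h.eq_end_states
  have := bounds_of_monotone h.monotone_u (fun x hx => (h1 x hx).2) (fun x hx => (h2 x hx).2) x
  rw [abs_le]
  have h3 := neg_abs_le ul
  have h4 := neg_abs_le ur
  have h5 := le_abs_self ul
  have h6 := le_abs_self ur
  have h7 := le_max_left |ul| |ur|
  have h8 := le_max_right |ul| |ur|
  constructor
  · refine le_trans ?_ this.1
    exact le_min (by linarith) (by linarith)
  · exact this.2.trans (max_le (by linarith) (by linarith))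

theorem exists_deriv_bound : ∃ Θ Θ₁, (∀ x, |deriv ubar x| + |deriv ρbar x| ≤ Θ) ∧
    ∀ N, ∫ x in Icc (-N) N, (|deriv ubar x| + |deriv ρbar x|) ≤ Θ₁ := by
  obtain ⟨L, hL, h1, h2⟩ := h.eq_end_states
  have hc : Continuous fun x => |deriv ubar x| + |deriv ρbar x| :=
    (h.contDiff_u.continuous_deriv (by simp)).abs.add
      (h.contDiff_rho.continuous_deriv (by simp)).abs
  have hs : HasCompactSupport fun x => |deriv ubar x| + |deriv ρbar x| := by
    refine HasCompactSupport.of_support_subset_isCompact (isCompact_Icc (a := -L) (b := L))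
      fun x hx => abs_le.1 (not_lt.1 fun hlt => hx ?_)
    have e1 := deriv_eq_zero_of_eventually_const (fun x hx => (h1 x hx).2)
      (fun x hx => (h2 x hx).2) hlt
    have e2 := deriv_eq_zero_of_eventually_const (fun x hx => (h1 x hx).1)
      (fun x hx => (h2 x hx).1) hlt
    simp [e1, e2]
  obtain ⟨Θ, hΘ⟩ := hs.exists_bound_of_continuous hc
  refine ⟨Θ, ∫ x, (|deriv ubar x| + |deriv ρbar x|), fun x => (le_abs_self _).trans (hΘ x),
    fun N => ?_⟩
  exact setIntegral_le_integral (hc.integrable_of_hasCompactSupport hs)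
    (Eventually.of_forall fun x => by positivity)

end IsReferencePair

/-- From `W² ≤ 2 (u - b)² + 2 (ε ρ_x/ρ²)²`, the initial density of the combined energy is at most
three times the relative energy plus `ε² ρ_x²/ρ³`. -/
theorem IsPressureLaw.integral_energyDensity_zero_le {p : ℝ → ℝ} {γ κ ρs cs M : ℝ}
    (hp : IsPressureLaw p γ κ ρs cs M) {ε : ℝ} {ρ u : ℝ → ℝ → ℝ}
    (hR : ContDiffOn ℝ 2 (fun z : ℝ × ℝ => ρ z.1 z.2) closedHalfPlane)
    (hU : ContDiffOn ℝ 2 (fun z : ℝ × ℝ => u z.1 z.2) closedHalfPlane)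
    (hpos : ∀ z ∈ closedHalfPlane, 0 < ρ z.1 z.2) {r b : ℝ → ℝ} (hr : ContDiff ℝ 1 r)
    (hb : ContDiff ℝ 1 b) (hr0 : ∀ x, 0 < r x) {E₀ E₁ : ENNReal} (hE₀ : E₀ < ⊤) (hE₁ : E₁ < ⊤)
    (h₀ : relativeEnergy p r b (ρ 0) (u 0) ≤ E₀)
    (h₁ : ENNReal.ofReal (ε ^ 2) * ∫⁻ x, ENNReal.ofReal (deriv (ρ 0) x ^ 2 / ρ 0 x ^ 3) ≤ E₁)
    {N : ℝ} (hN : 0 ≤ N) :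
    ∫ x in (-N)..N, energyDensity p r b (fun z => ρ z.1 z.2) (fun z => u z.1 z.2)
      (effectiveVelocity ε b (fun z => ρ z.1 z.2) (fun z => u z.1 z.2)) (0, x)
      ≤ (3 * E₀ + E₁).toReal := by
  set R : ℝ × ℝ → ℝ := fun z => ρ z.1 z.2
  set U : ℝ × ℝ → ℝ := fun z => u z.1 z.2
  set A := energyDensity p r b R U (effectiveVelocity ε b R U)
  have hmem : ∀ x, ((0 : ℝ), x) ∈ closedHalfPlane := fun x => ⟨self_mem_Ici, mem_univ _⟩
  have cA : Continuous fun x => A (0, x) := by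
    rw [← continuousOn_univ]
    exact (continuousOn_energyDensity hp (ε := ε) hR hU hpos hr hb hr0).1.comp (by fun_prop)
      fun x _ => hmem x
  have cρ : Continuous (ρ 0) := by
    rw [← continuousOn_univ]
    exact hR.continuousOn.comp (f := fun x : ℝ => ((0 : ℝ), x)) (by fun_prop) fun x _ => hmem x
  have hA0 : ∀ x, 0 ≤ A (0, x) := fun x => hp.energyDensity_nonneg hr0 (hpos _ (hmem x))
  have hle : ∀ x, A (0, x) ≤ 3 * (1 / 2 * ρ 0 x * (u 0 x - b x) ^ 2
      + relativeInternalEnergy p (ρ 0 x) (r x)) + ε ^ 2 * (deriv (ρ 0) x ^ 2 / ρ 0 x ^ 3) := by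
    intro x
    have hρ : 0 < ρ 0 x := hpos _ (hmem x)
    have hd : derivXWithin R (0, x) = deriv (ρ 0) x :=
      (hR.hasDerivAt_derivXWithin le_rfl x).deriv.symm
    have hE := hp.relativeInternalEnergy_nonneg hρ (hr0 x)
    have hAx : A (0, x) = 1 / 2 * ρ 0 x * (u 0 x - b x) ^ 2
        + 1 / 2 * ρ 0 x * (u 0 x - b x + ε * deriv (ρ 0) x / ρ 0 x ^ 2) ^ 2
        + 2 * relativeInternalEnergy p (ρ 0 x) (r x) := by
      rw [hp.relativeInternalEnergy_eq hρ (hr0 x), ← hd]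
      rfl
    have h1 : (u 0 x - b x + ε * deriv (ρ 0) x / ρ 0 x ^ 2) ^ 2
        ≤ 2 * (u 0 x - b x) ^ 2 + 2 * (ε * deriv (ρ 0) x / ρ 0 x ^ 2) ^ 2 := add_sq_le.trans (by linarith)
    have h2 : 1 / 2 * ρ 0 x * (u 0 x - b x + ε * deriv (ρ 0) x / ρ 0 x ^ 2) ^ 2
        ≤ 1 / 2 * ρ 0 x * (2 * (u 0 x - b x) ^ 2 + 2 * (ε * deriv (ρ 0) x / ρ 0 x ^ 2) ^ 2) := by
      gcongr
    have h3 : ρ 0 x * (ε * deriv (ρ 0) x / ρ 0 x ^ 2) ^ 2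
        = ε ^ 2 * (deriv (ρ 0) x ^ 2 / ρ 0 x ^ 3) := by
      field_simp
    rw [hAx]
    nlinarith
  rw [intervalIntegral.integral_of_le (by linarith), integral_eq_lintegral_of_nonneg_ae
    (Eventually.of_forall hA0) cA.aestronglyMeasurable]
  refine ENNReal.toReal_mono (by finiteness) ?_
  calc ∫⁻ x in Ioc (-N) N, ENNReal.ofReal (A (0, x)) ≤ ∫⁻ x, ENNReal.ofReal (A (0, x)) :=
        setLIntegral_le_lintegral _ _
    _ ≤ ∫⁻ x, (3 * ENNReal.ofReal (1 / 2 * ρ 0 x * (u 0 x - b x) ^ 2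
          + relativeInternalEnergy p (ρ 0 x) (r x))
          + ENNReal.ofReal (ε ^ 2) * ENNReal.ofReal (deriv (ρ 0) x ^ 2 / ρ 0 x ^ 3)) := by
        refine lintegral_mono fun x => ?_
        have h3 : (3 : ENNReal) = ENNReal.ofReal 3 := by norm_num
        rw [h3, ← ENNReal.ofReal_mul (by norm_num), ← ENNReal.ofReal_mul (sq_nonneg ε)]
        exact (ENNReal.ofReal_le_ofReal (hle x)).trans ENNReal.ofReal_add_le
    _ = 3 * relativeEnergy p r b (ρ 0) (u 0)
          + ENNReal.ofReal (ε ^ 2) * ∫⁻ x, ENNReal.ofReal (deriv (ρ 0) x ^ 2 / ρ 0 x ^ 3) := by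
        have hm : Measurable fun x => ENNReal.ofReal (deriv (ρ 0) x ^ 2 / ρ 0 x ^ 3) :=
          (((measurable_deriv _).pow_const 2).div (cρ.measurable.pow_const 3)).ennreal_ofReal
        rw [lintegral_add_right _ (hm.const_mul _), lintegral_const_mul' _ _ (by norm_num),
          lintegral_const_mul' _ _ ENNReal.ofReal_ne_top]
        rfl
    _ ≤ _ := by gcongr

theorem exists_uniform_dissipation_bound {p : ℝ → ℝ} {γ κ ρs cs M : ℝ}
    (hp : IsPressureLaw p γ κ ρs cs M) {ρl ul ρr ur : ℝ} (hρl : 0 < ρl) (hρr : 0 < ρr)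
    {ρbar ubar : ℝ → ℝ} (hbar : IsReferencePair ρl ul ρr ur ρbar ubar)
    {ε : ℕ → ℝ} (hε : ∀ n, 0 < ε n) (hε0 : Tendsto ε atTop (𝓝 0)) {ρ u : ℕ → ℝ → ℝ → ℝ}
    (hsol : ∀ n, IsNavierStokesSolution p (ε n) ρl ul ρr ur ρbar ubar (ρ n) (u n))
    (hE₀ : (⨆ n, relativeEnergy p ρbar ubar (ρ n 0) (u n 0)) < ⊤)
    (hE₁ : (⨆ n, ENNReal.ofReal (ε n ^ 2) *
      ∫⁻ x, ENNReal.ofReal (deriv (ρ n 0) x ^ 2 / ρ n 0 x ^ 3)) < ⊤)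
    {T X : ℝ} (hT : 0 < T) (hX : 0 < X) :
    ∃ C, ∀ n, ∫ z in Icc ((0 : ℝ), -X) (T, X),
      ε n * dissipationDensity p (fun z => ρ n z.1 z.2) (fun z => u n z.1 z.2) z ≤ C := by
  obtain ⟨Θ, Θ₁, hΘ, hΘ₁⟩ := hbar.exists_deriv_bound
  have hr0 : 0 < min ρl ρr := lt_min hρl hρr
  obtain ⟨c₀, hc₀, hsrc⟩ := hp.exists_energySource_le hr0 hbar.rho_mem hbar.abs_u_le
  obtain ⟨ε₁, hε₁⟩ := hε0.bddAbove_range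
  have hε₁' : ∀ n, ε n ≤ ε₁ := fun n => hε₁ (mem_range_self n)
  have hΘ0 : 0 ≤ Θ := (by positivity : (0 : ℝ) ≤ |deriv ubar 0| + |deriv ρbar 0|).trans (hΘ 0)
  have hΘ₁0 : 0 ≤ Θ₁ := le_trans (integral_nonneg fun x => by positivity) (hΘ₁ 0)
  set E₀ := ⨆ n, relativeEnergy p ρbar ubar (ρ n 0) (u n 0)
  set E₁ := ⨆ n, ENNReal.ofReal (ε n ^ 2) *
      ∫⁻ x, ENNReal.ofReal (deriv (ρ n 0) x ^ 2 / ρ n 0 x ^ 3)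
  have hrb : ContDiff ℝ 1 ρbar := hbar.contDiff_rho.of_le (by simp)
  have hub : ContDiff ℝ 1 ubar := hbar.contDiff_u.of_le (by simp)
  have hrpos : ∀ x, 0 < ρbar x := fun x => hr0.trans_le (hbar.rho_mem x).1
  set e := Real.exp (-(c₀ * Θ) * T) / 16 with he
  have he0 : 0 < e := by positivity
  refine ⟨((3 * E₀ + E₁).toReal + T * ((c₀ + ε₁ * Θ) * Θ₁) + 1) / e, fun n => ?_⟩
  have hs := hsol n
  have hpos : ∀ z ∈ closedHalfPlane, 0 < ρ n z.1 z.2 := fun z hz => by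
    have hz1 : 0 ≤ z.1 := hz.1
    obtain ⟨c, hc, h⟩ := hs.no_vacuum (z.1 + 1) (by linarith)
    exact hc.trans_le (h z.1 ⟨hz1, by linarith⟩ z.2)
  -- The bounds `a`, `V` and the resulting cone speed `K` depend on `n`; the constant fixed above
  -- does not involve them.
  obtain ⟨a, ha, hRa⟩ := hs.no_vacuum T hT
  obtain ⟨V, hV⟩ := hs.bounded T hT
  have hV0 : 0 ≤ V := (abs_nonneg _).trans (hV 0 ⟨le_rfl, hT.le⟩ 0).2
  obtain ⟨K, hK, hKG⟩ := hp.exists_energyFlux_le (r := ρbar) (b := ubar)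
    (a := min a (min ρl ρr)) (β := max V (max ρl ρr)) (lt_min ha hr0)
    (fun x => ⟨(min_le_right _ _).trans (hbar.rho_mem x).1,
      (hbar.rho_mem x).2.trans (le_max_right _ _)⟩) hbar.abs_u_le hV0
  have key := IsSmoothFlow.dissipation_le hp (hε n).le (R := fun z => ρ n z.1 z.2)
    (U := fun z => u n z.1 z.2) hs.contDiffOn_rho hs.contDiffOn_u hpos (hs.isSmoothFlow hp)
    hrb hub hrpos (C₀ := (3 * E₀ + E₁).toReal) (Cw := (V + max |ul| |ur|) ^ 2) hT hX hK hc₀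
    (fun z hz hzT => hKG _ _ _ z
      ⟨(min_le_left _ _).trans (hRa _ ⟨hz.1, hzT⟩ _), (hV _ ⟨hz.1, hzT⟩ _).1.trans (le_max_left _ _)⟩
      (hV _ ⟨hz.1, hzT⟩ _).2)
    (fun z hz => hsrc (fun z => ρ n z.1 z.2) (fun z => u n z.1 z.2)
      (effectiveVelocity (ε n) ubar (fun z => ρ n z.1 z.2) (fun z => u n z.1 z.2)) z (hpos z hz))
    (fun z hz hzT => by
      rw [← sq_abs]
      refine pow_le_pow_left₀ (abs_nonneg _) ?_ 2
      exact (abs_sub _ _).trans (add_le_add (hV _ ⟨hz.1, hzT⟩ _).2 (hbar.abs_u_le _)))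
    hΘ hΘ₁
    (fun N hN => hp.integral_energyDensity_zero_le hs.contDiffOn_rho hs.contDiffOn_u hpos hrb hub
      hrpos hE₀ hE₁ (le_iSup (fun n => relativeEnergy p ρbar ubar (ρ n 0) (u n 0)) n)
      (le_iSup (fun n => ENNReal.ofReal (ε n ^ 2) *
        ∫⁻ x, ENNReal.ofReal (deriv (ρ n 0) x ^ 2 / ρ n 0 x ^ 3)) n) hN)
  rw [le_div_iff₀ he0, mul_comm]
  refine key.trans ?_
  have := hε₁' n
  gcongr

/-! ### Morrey's inequality in the plane. -/

theorem abs_sub_endpoints_le_of_abs_deriv_le_rpow {F F' : ℝ → ℝ} {A β : ℝ} (hβ : β < 1)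
    (hc : ContinuousOn F (Icc 0 1)) (hd : ∀ t ∈ Ioo (0 : ℝ) 1, HasDerivAt F (F' t) t)
    (hb : ∀ t ∈ Ioo (0 : ℝ) 1, |F' t| ≤ A * t ^ (-β)) : |F 1 - F 0| ≤ A / (1 - β) := by
  have hβ' : 0 < 1 - β := by linarith
  have hG : ∀ t ∈ Ioo (0 : ℝ) 1,
      HasDerivAt (fun t : ℝ => A / (1 - β) * t ^ (1 - β)) (A * t ^ (-β)) t := fun t ht =>
    ((Real.hasDerivAt_rpow_const (p := 1 - β) (Or.inl ht.1.ne')).const_mul _).congr_deriv (by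
      rw [show 1 - β - 1 = -β by ring]; field_simp)
  have hGc : ContinuousOn (fun t : ℝ => A / (1 - β) * t ^ (1 - β)) (Icc 0 1) :=
    (continuousOn_const.mul (continuousOn_id.rpow_const fun t _ => Or.inr hβ'.le))
  have key : ∀ {F F' : ℝ → ℝ}, ContinuousOn F (Icc 0 1) →
      (∀ t ∈ Ioo (0 : ℝ) 1, HasDerivAt F (F' t) t) →
      (∀ t ∈ Ioo (0 : ℝ) 1, |F' t| ≤ A * t ^ (-β)) → F 1 - F 0 ≤ A / (1 - β) := by
    intro F F' hc hd hb
    have := antitoneOn_of_deriv_nonpos (convex_Icc (0 : ℝ) 1) (hc.sub hGc)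
      (fun t ht => by
        rw [interior_Icc] at ht
        exact ((hd t ht).sub (hG t ht)).differentiableAt.differentiableWithinAt)
      (fun t ht => by
        rw [interior_Icc] at ht
        rw [((hd t ht).sub (hG t ht)).deriv]
        linarith [le_abs_self (F' t), hb t ht])
      (left_mem_Icc.2 zero_le_one) (right_mem_Icc.2 zero_le_one) zero_le_one
    simp only [Pi.sub_apply, Real.one_rpow, Real.zero_rpow hβ'.ne', mul_one, mul_zero] at this
    linarith
  rw [abs_le]
  have h1 := key hc hd hb
  have h2 := key (F := fun t => -F t) (F' := fun t => -F' t) hc.neg (fun t ht => (hd t ht).fun_neg)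
    (fun t ht => by rw [abs_neg]; exact hb t ht)
  constructor <;> linarith

section Morrey

variable {φ : ℝ × ℝ → ℝ} (hφ : ContDiff ℝ 1 φ) (hs : HasCompactSupport φ)
include hφ hs

/-- Change of variables under the homothety with centre `x` and ratio `t`, whose Jacobian in the
plane is `t²`. -/
theorem integral_rpow_fderiv_comp_homothety_le {r t : ℝ} (hr : 0 < r) (ht : 0 < t) (x : ℝ × ℝ)
    (B : Set (ℝ × ℝ)) :
    ∫ z in B, ‖fderiv ℝ φ (x + t • (z - x))‖ ^ r ≤ t ^ (-2 : ℝ) * ∫ z, ‖fderiv ℝ φ z‖ ^ r := by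
  have hc : Continuous fun z => ‖fderiv ℝ φ z‖ ^ r :=
    (hφ.continuous_fderiv one_ne_zero).norm.rpow_const fun _ => Or.inr hr.le
  have hi : Integrable fun z => ‖fderiv ℝ φ z‖ ^ r :=
    hc.integrable_of_hasCompactSupport ((hs.fderiv (𝕜 := ℝ)).norm.comp_left (g := fun s => s ^ r)
      (Real.zero_rpow hr.ne'))
  have e : (fun z => ‖fderiv ℝ φ (x + t • (z - x))‖ ^ r)
      = fun z => (fun y => (fun w => ‖fderiv ℝ φ w‖ ^ r) ((x - t • x) + y)) (t • z) := by
    funext z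
    rw [smul_sub]; congr 3; abel
  have hi1 : Integrable fun y => (fun w => ‖fderiv ℝ φ w‖ ^ r) ((x - t • x) + y) :=
    hi.comp_add_left _
  have hi2 : Integrable fun z => ‖fderiv ℝ φ (x + t • (z - x))‖ ^ r := by
    rw [e]; exact hi1.comp_smul ht.ne'
  refine (setIntegral_le_integral hi2 (.of_forall fun z => by positivity)).trans_eq ?_
  rw [e, Measure.integral_comp_smul volume
    (fun y => (fun w => ‖fderiv ℝ φ w‖ ^ r) ((x - t • x) + y)),
    integral_add_left_eq_self (fun w => ‖fderiv ℝ φ w‖ ^ r)]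
  simp only [Module.finrank_prod, Module.finrank_self, smul_eq_mul]
  rw [abs_of_nonneg (by positivity), Real.rpow_neg ht.le]
  norm_num

theorem setIntegral_fderiv_comp_homothety_le {r t : ℝ} (hr : 1 < r) (ht : 0 < t) (x : ℝ × ℝ)
    {B : Set (ℝ × ℝ)} (hB : IsCompact B) :
    ∫ z in B, ‖fderiv ℝ φ (x + t • (z - x))‖
      ≤ t ^ (-(2 / r)) * (∫ z, ‖fderiv ℝ φ z‖ ^ r) ^ (1 / r) * (volume.real B) ^ (1 - 1 / r) := by
  have hr0 : 0 < r := by linarith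
  have hc : Continuous fun z => ‖fderiv ℝ φ (x + t • (z - x))‖ :=
    ((hφ.continuous_fderiv one_ne_zero).comp (by fun_prop)).norm
  have : IsFiniteMeasure (volume.restrict B) := ⟨by simpa using hB.measure_lt_top⟩
  obtain ⟨M, hM⟩ := hB.exists_bound_of_continuousOn hc.continuousOn
  have hmem : MemLp (fun z => ‖fderiv ℝ φ (x + t • (z - x))‖) (ENNReal.ofReal r)
      (volume.restrict B) :=
    MemLp.of_bound hc.aestronglyMeasurable M ((ae_restrict_iff' hB.measurableSet).2
      (.of_forall hM))
  have hold := integral_mul_le_Lp_mul_Lq_of_nonneg (μ := volume.restrict B)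
    (Real.HolderConjugate.conjExponent hr) (f := fun z => ‖fderiv ℝ φ (x + t • (z - x))‖)
    (g := fun _ => 1) (.of_forall fun z => norm_nonneg _) (.of_forall fun z => zero_le_one)
    hmem (memLp_const 1)
  simp only [mul_one, Real.one_rpow, integral_const, smul_eq_mul, measureReal_restrict_apply_univ]
    at hold
  refine hold.trans ?_
  have e1 : 1 / r.conjExponent = 1 - 1 / r := by
    rw [Real.conjExponent]; field_simp
  rw [e1]
  gcongr
  refine (Real.rpow_le_rpow (integral_nonneg fun z => by positivity)
    (integral_rpow_fderiv_comp_homothety_le hφ hs hr0 ht x B) (by positivity)).trans_eq ?_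
  rw [Real.mul_rpow (by positivity) (integral_nonneg fun z => by positivity),
    ← Real.rpow_mul ht.le]
  congr 2
  ring

/-- The integral over `B` of `φ(x + t(z - x))` interpolates between `|B| φ(x)` at `t = 0` and `∫_B
φ` at `t = 1`. By Hölder and the homothety its `t`-derivative is `O(t^(-2/r))`, integrable because
`r > 2`. -/
theorem abs_sub_setIntegral_le {r : ℝ} (hr : 2 < r) {B : Set (ℝ × ℝ)} (hB : IsCompact B) {d : ℝ}
    {x : ℝ × ℝ} (hd : ∀ z ∈ B, ‖z - x‖ ≤ d) (hd0 : 0 ≤ d) :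
    |(∫ z in B, φ z) - volume.real B * φ x|
      ≤ d * ((∫ z, ‖fderiv ℝ φ z‖ ^ r) ^ (1 / r) * (volume.real B) ^ (1 - 1 / r))
        / (1 - 2 / r) := by
  have hr0 : 0 < r := by linarith
  have : IsFiniteMeasure (volume.restrict B) := ⟨by simpa using hB.measure_lt_top⟩
  have hcD : Continuous (fderiv ℝ φ) := hφ.continuous_fderiv one_ne_zero
  obtain ⟨M, hM⟩ := hcD.bounded_above_of_compact_support (hs.fderiv (𝕜 := ℝ))
  obtain ⟨N, hN⟩ := hφ.continuous.bounded_above_of_compact_support hs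
  have hderiv : ∀ t, HasDerivAt (fun t : ℝ => ∫ z in B, φ (x + t • (z - x)))
      (∫ z in B, fderiv ℝ φ (x + t • (z - x)) (z - x)) t := by
    intro t
    refine (hasDerivAt_integral_of_dominated_loc_of_deriv_le (μ := volume.restrict B)
      (F := fun t z => φ (x + t • (z - x)))
      (F' := fun t z => fderiv ℝ φ (x + t • (z - x)) (z - x)) (bound := fun _ => M * d)
      (s := univ) univ_mem ?_ ?_ ?_ ?_ (integrable_const _) ?_).2
    · exact .of_forall fun t => (hφ.continuous.comp (by fun_prop)).aestronglyMeasurable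
    · exact Integrable.of_bound (hφ.continuous.comp (by fun_prop)).aestronglyMeasurable N
        (.of_forall fun z => hN _)
    · exact ((hcD.comp (by fun_prop)).clm_apply (by fun_prop)).aestronglyMeasurable
    · refine (ae_restrict_iff' hB.measurableSet).2 (.of_forall fun z hz t _ => ?_)
      exact (ContinuousLinearMap.le_opNorm _ _).trans
        (mul_le_mul (hM _) (hd z hz) (norm_nonneg _) ((norm_nonneg _).trans (hM x)))
    · refine .of_forall fun z t _ => ?_
      have h1 : HasDerivAt (fun t : ℝ => x + t • (z - x)) (z - x) t := by
        simpa using ((hasDerivAt_id' t).smul_const (z - x)).const_add x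
      exact ((hφ.differentiable one_ne_zero _).hasFDerivAt).comp_hasDerivAt t h1
  have := abs_sub_endpoints_le_of_abs_deriv_le_rpow
    (A := d * ((∫ z, ‖fderiv ℝ φ z‖ ^ r) ^ (1 / r) * (volume.real B) ^ (1 - 1 / r))) (β := 2 / r)
    ((div_lt_one hr0).2 hr)
    (fun t _ => (hderiv t).continuousAt.continuousWithinAt) (fun t _ => hderiv t) (by
      intro t ht
      have hint : IntegrableOn (fun z => ‖fderiv ℝ φ (x + t • (z - x))‖) B :=
        Integrable.of_bound (hcD.comp (by fun_prop)).norm.aestronglyMeasurable M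
          (.of_forall fun z => by rw [norm_norm]; exact hM _)
      calc |∫ z in B, fderiv ℝ φ (x + t • (z - x)) (z - x)|
          ≤ ∫ z in B, d * ‖fderiv ℝ φ (x + t • (z - x))‖ := by
            rw [← Real.norm_eq_abs]
            refine norm_integral_le_of_norm_le (hint.const_mul d)
              ((ae_restrict_iff' hB.measurableSet).2 (.of_forall fun z hz => ?_))
            rw [mul_comm]
            exact ((fderiv ℝ φ (x + t • (z - x))).le_opNorm _).trans
              (mul_le_mul_of_nonneg_left (hd z hz) (norm_nonneg _))
        _ = d * ∫ z in B, ‖fderiv ℝ φ (x + t • (z - x))‖ := integral_const_mul _ _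
        _ ≤ _ := by
            rw [mul_assoc d, mul_comm _ (t ^ (-(2 / r))), ← mul_assoc (t ^ (-(2 / r)))]
            exact mul_le_mul_of_nonneg_left
              (setIntegral_fderiv_comp_homothety_le hφ hs (by linarith) ht.1 x hB) hd0)
  simpa using this

/-- Morrey's inequality in the plane. -/
theorem abs_sub_le_rpow_dist {r : ℝ} (hr : 2 < r) (x y : ℝ × ℝ) :
    |φ x - φ y| ≤ 4 / (1 - 2 / r) * dist x y ^ (1 - 2 / r)
      * (∫ z, ‖fderiv ℝ φ z‖ ^ r) ^ (1 / r) := by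
  have hr0 : 0 < r := by linarith
  have hα : 0 < 1 - 2 / r := sub_pos.2 ((div_lt_one hr0).2 hr)
  have hI : 0 ≤ ∫ z, ‖fderiv ℝ φ z‖ ^ r := integral_nonneg fun z => by positivity
  rcases eq_or_ne x y with rfl | hxy
  · simp [Real.zero_rpow hα.ne']
  set h := dist x y with hh
  have h0 : 0 < h := dist_pos.2 hxy
  have hv : volume.real (Metric.closedBall x h) = (2 * h) ^ 2 := by
    rw [← Prod.mk.eta (p := x), ← closedBall_prod_same, Measure.volume_eq_prod, measureReal_prod_prod,
      Real.volume_real_closedBall h0.le, Real.volume_real_closedBall h0.le, sq]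
  -- The same ball about `x` serves both points; every point of it is within `2h` of `x` and of `y`.
  have h1 := abs_sub_setIntegral_le hφ hs hr (isCompact_closedBall x h) (x := x) (d := 2 * h)
    (fun z hz => by
      rw [← dist_eq_norm]; linarith [Metric.mem_closedBall.1 hz]) (by positivity)
  have h2 := abs_sub_setIntegral_le hφ hs hr (isCompact_closedBall x h) (x := y) (d := 2 * h)
    (fun z hz => by
      rw [← dist_eq_norm]
      linarith [Metric.mem_closedBall.1 hz, dist_triangle z x y]) (by positivity)
  rw [hv] at h1 h2
  set I := (∫ z, ‖fderiv ℝ φ z‖ ^ r) ^ (1 / r)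
  have hI' : 0 ≤ I := Real.rpow_nonneg hI _
  have e : 2 * h * (I * ((2 * h) ^ 2) ^ (1 - 1 / r)) / (1 - 2 / r)
      = (2 * h) ^ 2 * (1 / (1 - 2 / r) * (2 * h) ^ (1 - 2 / r) * I) := by
    have : 2 * h * ((2 * h) ^ 2) ^ (1 - 1 / r) = (2 * h) ^ 2 * (2 * h) ^ (1 - 2 / r) := by
      rw [← Real.rpow_natCast, ← Real.rpow_mul (by positivity), ← Real.rpow_add (by positivity),
        ← Real.rpow_one_add' (by positivity) (by
          push_cast
          have := hα
          ring_nf at this ⊢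
          linarith)]
      congr 1
      push_cast
      ring
    calc _ = (2 * h * ((2 * h) ^ 2) ^ (1 - 1 / r)) * I / (1 - 2 / r) := by ring
      _ = _ := by rw [this]; ring
  rw [e] at h1 h2
  have h3 : (2 * h) ^ 2 * |φ x - φ y|
      ≤ (2 * h) ^ 2 * (2 * (1 / (1 - 2 / r) * (2 * h) ^ (1 - 2 / r) * I)) := by
    rw [← abs_of_nonneg (sq_nonneg (2 * h)), ← abs_mul, abs_of_nonneg (sq_nonneg (2 * h))]
    rw [abs_le] at h1 h2 ⊢
    constructor <;> linarith [h1.1, h1.2, h2.1, h2.2]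
  refine (le_of_mul_le_mul_left h3 (by positivity)).trans ?_
  have h4 : (2 : ℝ) ^ (1 - 2 / r) ≤ 2 :=
    (Real.rpow_le_rpow_of_exponent_le one_le_two
      (show 1 - 2 / r ≤ 1 by linarith [div_pos two_pos hr0])).trans_eq (Real.rpow_one 2)
  rw [Real.mul_rpow two_pos.le h0.le]
  calc _ = 2 / (1 - 2 / r) * h ^ (1 - 2 / r) * I * 2 ^ (1 - 2 / r) := by ring
    _ ≤ 2 / (1 - 2 / r) * h ^ (1 - 2 / r) * I * 2 := by gcongr
    _ = _ := by ring

end Morrey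

/-! ### Compactness of Sobolev balls of test functions. -/

/-- Compact rectangles exhausting the half-plane. -/
def exhaustion (i : ℕ) : Set (ℝ × ℝ) := Icc (1 / ((i : ℝ) + 1), -((i : ℝ) + 1)) (i + 1, i + 1)

theorem isCompact_exhaustion (i : ℕ) : IsCompact (exhaustion i) := by
  rw [exhaustion, ← Icc_prod_Icc]
  exact isCompact_Icc.prod isCompact_Icc

theorem exhaustion_subset (i : ℕ) : exhaustion i ⊆ (halfPlane : Set (ℝ × ℝ)) := fun z hz =>
  lt_of_lt_of_le (by positivity) hz.1.1

theorem IsCompact.exists_subset_exhaustion {K : Set (ℝ × ℝ)} (hK : IsCompact K)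
    (hKs : K ⊆ (halfPlane : Set (ℝ × ℝ))) : ∃ N : ℕ, ∀ i, N ≤ i → K ⊆ exhaustion i := by
  have hc : ContinuousOn (fun z : ℝ × ℝ => |z.1| + |z.1⁻¹| + |z.2|) K :=
    (continuousOn_fst.abs.add (continuousOn_fst.inv₀ fun z hz => (hKs hz).ne').abs).add
      continuousOn_snd.abs
  obtain ⟨M, hM⟩ := hK.exists_bound_of_continuousOn hc
  obtain ⟨N, hN⟩ := exists_nat_ge M
  refine ⟨N, fun i hi z hz => ?_⟩
  have h0 : 0 < z.1 := hKs hz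
  have h1 := (le_abs_self _).trans (hM z hz)
  have h2 : (N : ℝ) ≤ i := by exact_mod_cast hi
  have a1 := le_abs_self z.1
  have a2 := le_abs_self z.1⁻¹
  have a3 := abs_le.1 (le_refl |z.2|)
  have b1 := abs_nonneg z.1
  have b2 := abs_nonneg z.1⁻¹
  have b3 := abs_nonneg z.2
  refine ⟨⟨?_, ?_⟩, ?_, ?_⟩
  · change 1 / ((i : ℝ) + 1) ≤ z.1
    rw [one_div, inv_le_comm₀ (by positivity) h0]
    linarith
  · change -((i : ℝ) + 1) ≤ z.2
    linarith [a3.1]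
  · change z.1 ≤ (i : ℝ) + 1
    linarith
  · change z.2 ≤ (i : ℝ) + 1
    linarith [a3.2]

/-- Test functions supported in a fixed rectangle and bounded in `W^{1,r}`. -/
def sobolevBall (r : ℝ) (i : ℕ) : Set 𝓓(halfPlane, ℝ) :=
  {φ | tsupport φ ⊆ exhaustion i ∧ sobolevNorm (ENNReal.ofReal r) φ ≤ i}

namespace TestFunction

/-- The operator norm for the sup norm on the plane is at most the sum of the two partials. The
outer norm puts the right side in the form needed for comparing `L^r` norms. -/
theorem norm_fderiv_le (φ : 𝓓(halfPlane, ℝ)) (z : ℝ × ℝ) :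
    ‖fderiv ℝ φ z‖ ≤ ‖‖(∂_{((1, 0) : ℝ × ℝ)} φ : 𝓓(halfPlane, ℝ)) z‖
      + ‖(∂_{((0, 1) : ℝ × ℝ)} φ : 𝓓(halfPlane, ℝ)) z‖‖ := by
  rw [Real.norm_of_nonneg (by positivity), lineDerivOp_apply_eq_fderiv, lineDerivOp_apply_eq_fderiv]
  refine ContinuousLinearMap.opNorm_le_bound _ (by positivity) fun v => ?_
  have : v = v.1 • ((1, 0) : ℝ × ℝ) + v.2 • ((0, 1) : ℝ × ℝ) := by ext <;> simp
  conv_lhs => rw [this]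
  rw [map_add, map_smul, map_smul, add_mul]
  refine (norm_add_le _ _).trans (add_le_add ?_ ?_)
  · rw [norm_smul, mul_comm]
    exact mul_le_mul_of_nonneg_left (norm_fst_le v) (norm_nonneg _)
  · rw [norm_smul, mul_comm]
    exact mul_le_mul_of_nonneg_left (norm_snd_le v) (norm_nonneg _)

theorem memLp (φ : 𝓓(halfPlane, ℝ)) (r : ENNReal) : MemLp φ r volume :=
  φ.continuous.memLp_of_hasCompactSupport φ.hasCompactSupport

theorem sobolevNorm_lt_top (r : ENNReal) (φ : 𝓓(halfPlane, ℝ)) : sobolevNorm r φ < ⊤ :=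
  ENNReal.add_lt_top.2 ⟨ENNReal.add_lt_top.2 ⟨(φ.memLp r).2, (memLp _ r).2⟩, (memLp _ r).2⟩

theorem exists_mem_sobolevBall (r : ℝ) (φ : 𝓓(halfPlane, ℝ)) : ∃ i, φ ∈ sobolevBall r i := by
  obtain ⟨N, hN⟩ := IsCompact.exists_subset_exhaustion φ.hasCompactSupport φ.tsupport_subset
  obtain ⟨m, hm⟩ := ENNReal.exists_nat_gt (sobolevNorm_lt_top (ENNReal.ofReal r) φ).ne
  refine ⟨max N m, hN _ (le_max_left _ _), hm.le.trans ?_⟩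
  exact_mod_cast le_max_right N m

variable {r : ℝ} {i : ℕ} {φ : 𝓓(halfPlane, ℝ)}

theorem integral_rpow_fderiv_le (hr : 1 ≤ r) (h : φ ∈ sobolevBall r i) :
    (∫ z, ‖fderiv ℝ φ z‖ ^ r) ^ (1 / r) ≤ i := by
  have hr0 : 0 < r := by linarith
  have hφ : ContDiff ℝ 1 φ := φ.contDiff.of_le (by simp)
  have hmem : MemLp (fun z => fderiv ℝ φ z) (ENNReal.ofReal r) volume :=
    (hφ.continuous_fderiv one_ne_zero).memLp_of_hasCompactSupport
      (φ.hasCompactSupport.fderiv (𝕜 := ℝ))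
  have h1 := hmem.eLpNorm_eq_integral_rpow_norm (by simpa using hr0) ENNReal.ofReal_ne_top
  rw [ENNReal.toReal_ofReal hr0.le, inv_eq_one_div] at h1
  have h2 : eLpNorm (fun z => fderiv ℝ φ z) (ENNReal.ofReal r) volume ≤ i := by
    refine (eLpNorm_mono (norm_fderiv_le φ)).trans ((eLpNorm_add_le
      (memLp (∂_{((1, 0) : ℝ × ℝ)} φ : 𝓓(halfPlane, ℝ)) (ENNReal.ofReal r)).1.norm
      (memLp (∂_{((0, 1) : ℝ × ℝ)} φ : 𝓓(halfPlane, ℝ)) (ENNReal.ofReal r)).1.norm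
      (by simpa using hr)).trans ?_)
    rw [eLpNorm_norm, eLpNorm_norm]
    refine le_trans ?_ h.2
    rw [sobolevNorm, add_assoc]
    exact le_add_self
  rw [h1] at h2
  exact_mod_cast (ENNReal.ofReal_le_natCast).1 h2

theorem abs_sub_le_of_mem_sobolevBall (hr : 2 < r) (h : φ ∈ sobolevBall r i) (x y : ℝ × ℝ) :
    |φ x - φ y| ≤ 4 / (1 - 2 / r) * dist x y ^ (1 - 2 / r) * i := by
  have hα : 0 < 1 - 2 / r := sub_pos.2 ((div_lt_one (by linarith)).2 hr)
  refine (abs_sub_le_rpow_dist (φ.contDiff.of_le (by simp)) φ.hasCompactSupport hr x y).trans ?_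
  gcongr
  exact integral_rpow_fderiv_le (by linarith) h

theorem exists_bound_of_mem_sobolevBall (hr : 2 < r) (i : ℕ) :
    ∃ M, ∀ φ ∈ sobolevBall r i, ∀ x, |φ x| ≤ M := by
  have hα : 0 < 1 - 2 / r := sub_pos.2 ((div_lt_one (by linarith)).2 hr)
  obtain ⟨D, hD⟩ := (isCompact_exhaustion i).exists_bound_of_continuousOn
    (f := fun z => dist z ((-1, 0) : ℝ × ℝ)) (by fun_prop)
  refine ⟨max 0 (4 / (1 - 2 / r) * D ^ (1 - 2 / r) * i), fun φ h x => ?_⟩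
  by_cases hx : x ∈ exhaustion i
  · refine le_trans ?_ (le_max_right _ _)
    -- `(-1, 0)` lies outside the half-plane, so every test function vanishes there; the Hölder
    -- bound then gives a sup bound.
    have h1 := abs_sub_le_of_mem_sobolevBall hr h x (-1, 0)
    have h0 : φ (-1, 0) = 0 := by
      refine image_eq_zero_of_notMem_tsupport fun hm => ?_
      have : (0 : ℝ) < -1 := φ.tsupport_subset hm
      linarith
    rw [h0, sub_zero] at h1
    refine h1.trans ?_
    have := (le_abs_self _).trans (hD x hx)
    gcongr
  · rw [image_eq_zero_of_notMem_tsupport fun hm => hx (h.1 hm), abs_zero]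
    exact le_max_left _ _

/-- Compactness of the embedding of `W₀^{1,r}` in the continuous functions for `r > 2`. -/
theorem exists_finite_approx_sobolevBall (hr : 2 < r) (i : ℕ) {δ : ℝ} (hδ : 0 < δ) :
    ∃ D ⊆ sobolevBall r i, D.Finite ∧ ∀ φ ∈ sobolevBall r i, ∃ d ∈ D, ∀ x, |φ x - d x| ≤ δ := by
  have hα : 0 < 1 - 2 / r := sub_pos.2 ((div_lt_one (by linarith)).2 hr)
  have : CompactSpace (exhaustion i) := isCompact_iff_compactSpace.1 (isCompact_exhaustion i)
  obtain ⟨M, hM⟩ := exists_bound_of_mem_sobolevBall hr i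
  let res : 𝓓(halfPlane, ℝ) → BoundedContinuousFunction (exhaustion i) ℝ := fun φ =>
    BoundedContinuousFunction.mkOfCompact ⟨fun x => φ x, φ.continuous.comp continuous_subtype_val⟩
  have hres : ∀ φ x, res φ x = φ x := fun _ _ => rfl
  have htb : TotallyBounded (res '' sobolevBall r i) := by
    refine (BoundedContinuousFunction.arzela_ascoli (Icc (-M) M) isCompact_Icc _ ?_ ?_)
      |>.totallyBounded.subset subset_closure
    · rintro _ x ⟨φ, hφ, rfl⟩
      exact abs_le.1 (hM φ hφ x)
    · refine Metric.equicontinuous_of_continuity_modulus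
        (fun d => 4 / (1 - 2 / r) * d ^ (1 - 2 / r) * i) ?_ _ ?_
      · have : Continuous fun d : ℝ => 4 / (1 - 2 / r) * d ^ (1 - 2 / r) * i :=
          (continuous_const.mul (continuous_id.rpow_const fun _ => Or.inr hα.le)).mul
            continuous_const
        simpa [Real.zero_rpow hα.ne'] using this.tendsto 0
      · rintro x y ⟨_, φ, hφ, rfl⟩
        exact abs_sub_le_of_mem_sobolevBall hr hφ x y
  obtain ⟨D, hD, hDf, hcov⟩ := exists_subset_image_finite_and.1
    (Metric.finite_approx_of_totallyBounded htb δ hδ)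
  refine ⟨D, hD, hDf, fun φ hφ => ?_⟩
  obtain ⟨_, hy, hball⟩ := mem_iUnion₂.1 (hcov (mem_image_of_mem res hφ))
  obtain ⟨d, hd, rfl⟩ := hy
  refine ⟨d, hd, fun x => ?_⟩
  by_cases hx : x ∈ exhaustion i
  · exact (BoundedContinuousFunction.dist_coe_le_dist (f := res φ) (g := res d) ⟨x, hx⟩).trans
      (Metric.mem_ball.1 hball).le
  · rw [image_eq_zero_of_notMem_tsupport fun hm => hx (hφ.1 hm),
      image_eq_zero_of_notMem_tsupport fun hm => hx ((hD hd).1 hm), sub_zero, abs_zero]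
    exact hδ.le

/-- `s² ≤ 1 + s^r` for `r > 2`. This allows remainders small in `L²` to be tested against functions
bounded in `W^{1,r}`. -/
theorem setIntegral_sq_derivX_le (hr : 2 < r) (h : φ ∈ sobolevBall r i) :
    ∫ z in exhaustion i, (∂_{((0, 1) : ℝ × ℝ)} φ : 𝓓(halfPlane, ℝ)) z ^ 2
      ≤ volume.real (exhaustion i) + (i : ℝ) ^ r := by
  have hr0 : 0 < r := by linarith
  have hφ : ContDiff ℝ 1 φ := φ.contDiff.of_le (by simp)
  have hc := hφ.continuous_fderiv one_ne_zero
  have hi : Integrable fun z => ‖fderiv ℝ φ z‖ ^ r :=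
    (hc.norm.rpow_const fun _ => Or.inr hr0.le).integrable_of_hasCompactSupport
      ((φ.hasCompactSupport.fderiv (𝕜 := ℝ)).norm.comp_left (g := fun s => s ^ r)
        (Real.zero_rpow hr0.ne'))
  have h1 : ∫ z, ‖fderiv ℝ φ z‖ ^ r ≤ (i : ℝ) ^ r := by
    have := Real.rpow_le_rpow (Real.rpow_nonneg (integral_nonneg fun z => by positivity) _)
      (integral_rpow_fderiv_le (by linarith) h) hr0.le
    rwa [← Real.rpow_mul (integral_nonneg fun z => by positivity), one_div,
      inv_mul_cancel₀ hr0.ne', Real.rpow_one] at this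
  have : IsFiniteMeasure (volume.restrict (exhaustion i)) :=
    ⟨by simpa using (isCompact_exhaustion i).measure_lt_top⟩
  calc _ ≤ ∫ z in exhaustion i, (1 + ‖fderiv ℝ φ z‖ ^ r) := by
        refine integral_mono_of_nonneg (.of_forall fun z => sq_nonneg _)
          ((integrable_const 1).add hi.integrableOn) (.of_forall fun z => ?_)
        beta_reduce
        have h2 : |(∂_{((0, 1) : ℝ × ℝ)} φ : 𝓓(halfPlane, ℝ)) z| ≤ ‖fderiv ℝ φ z‖ := by
          rw [lineDerivOp_apply_eq_fderiv]
          simpa using (fderiv ℝ φ z).le_opNorm ((0, 1) : ℝ × ℝ)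
        rw [← sq_abs]
        refine (pow_le_pow_left₀ (abs_nonneg _) h2 2).trans ?_
        rcases le_total ‖fderiv ℝ φ z‖ 1 with h3 | h3
        · have : ‖fderiv ℝ φ z‖ ^ 2 ≤ 1 := pow_le_one₀ (norm_nonneg _) h3
          have : 0 ≤ ‖fderiv ℝ φ z‖ ^ r := by positivity
          linarith
        · have := Real.rpow_le_rpow_of_exponent_le h3 hr.le
          rw [Real.rpow_two] at this
          linarith
    _ = volume.real (exhaustion i) + ∫ z in exhaustion i, ‖fderiv ℝ φ z‖ ^ r := by
        rw [integral_add (integrable_const 1) hi.integrableOn]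
        simp
    _ ≤ _ := by
        gcongr
        exact (setIntegral_le_integral hi (.of_forall fun z => by positivity)).trans h1

end TestFunction

/-! ### Extraction of subsequences converging in the negative Sobolev space. -/

/-- Diagonal extraction: a pointwise bounded sequence of functions, which are jointly approximated
on each of countably many sets by their values at finitely many points, has a subsequence that
converges uniformly on each of these sets. -/
theorem exists_strictMono_uniformCauchy {X : Type*} {S : ℕ → Set X} {F : ℕ → X → ℝ}
    (hb : ∀ x, ∃ C, ∀ k, |F k x| ≤ C)
    (hS : ∀ i, ∀ δ > 0, ∃ D : Set X, D.Finite ∧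
      ∀ x ∈ S i, ∃ d ∈ D, ∀ k, |F k x - F k d| ≤ δ) :
    ∃ j : ℕ → ℕ, StrictMono j ∧ ∀ i, ∀ δ > 0, ∃ N, ∀ k ≥ N, ∀ l ≥ N, ∀ x ∈ S i,
      |F (j k) x - F (j l) x| ≤ δ := by
  choose C hC using hb
  choose D hDf hD using fun (i m : ℕ) => hS i (1 / ((m : ℝ) + 1)) (by positivity)
  have hcount : (⋃ i, ⋃ m, D i m).Countable :=
    countable_iUnion fun i => countable_iUnion fun m => (hDf i m).countable
  have := hcount.to_subtype
  -- A countable product of compact intervals is sequentially compact, which replaces an explicit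
  -- diagonal argument over the approximating points.
  obtain ⟨a, -, j, hj, hlim⟩ := (isCompact_univ_pi
    (fun x : (⋃ i, ⋃ m, D i m : Set X) => isCompact_Icc (a := -C x) (b := C x))).tendsto_subseq
    (x := fun k (x : (⋃ i, ⋃ m, D i m : Set X)) => F k x) (fun k x _ => abs_le.1 (hC x k))
  rw [tendsto_pi_nhds] at hlim
  refine ⟨j, hj, fun i δ hδ => ?_⟩
  obtain ⟨m, hm⟩ := exists_nat_one_div_lt (show 0 < δ / 3 by linarith)
  have hcau : ∀ d ∈ D i m, ∃ N, ∀ k ≥ N, ∀ l ≥ N, |F (j k) d - F (j l) d| ≤ δ / 3 := by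
    intro d hd
    have := (hlim ⟨d, mem_iUnion₂.2 ⟨i, m, hd⟩⟩).cauchySeq
    obtain ⟨N, hN⟩ := Metric.cauchySeq_iff.1 this (δ / 3) (by linarith)
    exact ⟨N, fun k hk l hl => (hN k hk l hl).le⟩
  choose! N hN using hcau
  obtain ⟨N₀, hN₀⟩ := ((hDf i m).image N).bddAbove
  refine ⟨N₀, fun k hk l hl x hx => ?_⟩
  obtain ⟨d, hd, hdx⟩ := hD i m x hx
  have h0 : N d ≤ N₀ := hN₀ (mem_image_of_mem N hd)
  have h1 := hdx (j k)
  have h2 := hdx (j l)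
  have h3 := hN d hd k (h0.trans hk) l (h0.trans hl)
  rw [abs_le] at h1 h2 h3 ⊢
  constructor <;> linarith [h1.1, h1.2, h2.1, h2.2, h3.1, h3.2]

theorem two_lt_conjExponent {q : ℝ} (hq₁ : 1 < q) (hq₂ : q < 2) : 2 < q / (q - 1) := by
  rw [lt_div_iff₀ (by linarith)]
  linarith

theorem CompactlyInside.exists_negSobolevNorm_le {U : Set (ℝ × ℝ)} (hU : CompactlyInside U) (q : ℝ) :
    ∃ i, ∀ (T : 𝓓'(halfPlane, ℝ)) (δ : ℝ),
      (∀ φ ∈ sobolevBall (q / (q - 1)) i, |T φ| ≤ δ) → negSobolevNorm q U T ≤ ENNReal.ofReal δ := by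
  obtain ⟨N, hN⟩ := hU.2.1.exists_subset_exhaustion hU.2.2
  -- One index serves as rectangle and as radius: at least `N` to contain `closure U`, at least `1`
  -- to contain the unit ball of the dual norm.
  refine ⟨max N 1, fun T δ h => iSup_le fun φ => iSup_le fun h1 => iSup_le fun h2 => ?_⟩
  rw [← ofReal_norm, Real.norm_eq_abs]
  refine ENNReal.ofReal_le_ofReal (h φ ⟨h1.trans (subset_closure.trans (hN _ (le_max_left _ _))),
    h2.trans ?_⟩)
  exact_mod_cast le_max_right N 1

theorem MemNegSobolevLoc.of_bound {q : ℝ} {T : 𝓓'(halfPlane, ℝ)}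
    (h : ∀ i, ∃ C, ∀ φ ∈ sobolevBall (q / (q - 1)) i, |T φ| ≤ C) : MemNegSobolevLoc q T := by
  intro U hU
  obtain ⟨i, hi⟩ := hU.exists_negSobolevNorm_le q
  obtain ⟨C, hC⟩ := h i
  exact (hi T C hC).trans_lt ENNReal.ofReal_lt_top

/-- The bound by the sup norm survives the limit, so the limit is a distribution of order zero; this
gives its continuity on each space of functions with fixed support. -/
theorem Distribution.exists_limit {F : ℕ → 𝓓'(halfPlane, ℝ)} {C : ℕ → ℝ}
    (hF : ∀ i k (φ : 𝓓(halfPlane, ℝ)) m, tsupport φ ⊆ exhaustion i → (∀ x, |φ x| ≤ m) →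
      |F k φ| ≤ C i * m)
    (hlim : ∀ φ, ∃ a, Tendsto (fun k => F k φ) atTop (𝓝 a)) :
    ∃ L : 𝓓'(halfPlane, ℝ), ∀ φ, Tendsto (fun k => F k φ) atTop (𝓝 (L φ)) := by
  choose L hL using hlim
  have hadd : ∀ φ ψ, L (φ + ψ) = L φ + L ψ := fun φ ψ =>
    tendsto_nhds_unique (hL _) (((hL φ).add (hL ψ)).congr fun k => (map_add (F k) φ ψ).symm)
  have hsmul : ∀ (c : ℝ) φ, L (c • φ) = c • L φ := fun c φ =>
    tendsto_nhds_unique (hL _) (((hL φ).const_smul c).congr fun k => (map_smul (F k) c φ).symm)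
  refine ⟨UniformConvergenceCLM.ofFun (RingHom.id ℝ) ℝ _
    (TestFunction.mkCLM ℝ L hadd hsmul fun K hK => ?_), hL⟩
  obtain ⟨N, hN⟩ := K.isCompact.exists_subset_exhaustion hK
  have hb : ∀ f : 𝓓^{⊤}_{K}(ℝ × ℝ, ℝ), |L (TestFunction.ofSupportedIn hK f)|
      ≤ C N * ‖ContDiffMapSupportedIn.toBoundedContinuousFunctionCLM ℝ f‖ := by
    intro f
    refine le_of_tendsto (hL _).abs (.of_forall fun k => hF N k _ _
      (f.tsupport_subset.trans (hN N le_rfl)) fun x => ?_)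
    exact (ContDiffMapSupportedIn.toBoundedContinuousFunctionCLM ℝ f).norm_coe_le_norm x
  let Λ : 𝓓^{⊤}_{K}(ℝ × ℝ, ℝ) →+ ℝ :=
    { toFun := L ∘ TestFunction.ofSupportedIn hK
      map_zero' := by
        have := hsmul 0 0
        rw [zero_smul, zero_smul] at this
        exact this
      map_add' := fun f g =>
        hadd (TestFunction.ofSupportedIn hK f) (TestFunction.ofSupportedIn hK g) }
  change Continuous Λ
  refine continuous_of_continuousAt_zero Λ ?_
  rw [ContinuousAt, map_zero]
  have hc : Continuous fun f : 𝓓^{⊤}_{K}(ℝ × ℝ, ℝ) =>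
      C N * ‖ContDiffMapSupportedIn.toBoundedContinuousFunctionCLM ℝ f‖ := by fun_prop
  refine squeeze_zero_norm hb ?_
  have h0 := hc.tendsto 0
  rwa [map_zero, norm_zero, mul_zero] at h0

/-- Sequences of distributions that are, up to a null sequence in `W^{-1,q}_loc`, bounded in the
space of measures are relatively compact in `W^{-1,q}_loc`, `1 < q < 2`. -/
theorem exists_subseq_tendsto_negSobolevNorm {q : ℝ} (hq₁ : 1 < q) (hq₂ : q < 2)
    {T F : ℕ → 𝓓'(halfPlane, ℝ)} {C : ℕ → ℝ}
    (hF : ∀ i k (φ : 𝓓(halfPlane, ℝ)) m, tsupport φ ⊆ exhaustion i → (∀ x, |φ x| ≤ m) →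
      |F k φ| ≤ C i * m)
    (hTF : ∀ i, ∀ δ > 0, ∃ N, ∀ k ≥ N, ∀ φ ∈ sobolevBall (q / (q - 1)) i,
      |T k φ - F k φ| ≤ δ) :
    ∃ j : ℕ → ℕ, StrictMono j ∧ ∃ L : 𝓓'(halfPlane, ℝ), MemNegSobolevLoc q L ∧
      ∀ U, CompactlyInside U →
        Tendsto (fun k => negSobolevNorm q U (T (j k) - L)) atTop (𝓝 0) := by
  have hr := two_lt_conjExponent hq₁ hq₂
  set r := q / (q - 1)
  obtain ⟨j, hj, hcau⟩ := exists_strictMono_uniformCauchy (S := sobolevBall r)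
    (F := fun k φ => F k φ)
    (fun φ => by
      obtain ⟨i, hi⟩ := TestFunction.exists_mem_sobolevBall r φ
      obtain ⟨M, hM⟩ := TestFunction.exists_bound_of_mem_sobolevBall hr i
      exact ⟨C i * M, fun k => hF i k φ M hi.1 (hM φ hi)⟩)
    (fun i δ hδ => by
      have hC : 0 < |C i| + 1 := by positivity
      obtain ⟨D, hD, hDf, happ⟩ :=
        TestFunction.exists_finite_approx_sobolevBall hr i (div_pos hδ hC)
      refine ⟨D, hDf, fun φ hφ => ?_⟩
      obtain ⟨d, hd, hdx⟩ := happ φ hφ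
      refine ⟨d, hd, fun k => ?_⟩
      -- The difference need not be small in `W^{1,r}`; it is small in the sup norm, which is all
      -- that functionals bounded as measures see.
      have h1 := hF i k (φ - d) (δ / (|C i| + 1))
        ((tsupport_sub φ d).trans (union_subset hφ.1 (hD hd).1)) hdx
      rw [map_sub] at h1
      refine h1.trans ?_
      calc C i * (δ / (|C i| + 1)) ≤ (|C i| + 1) * (δ / (|C i| + 1)) := by
            gcongr
            linarith [le_abs_self (C i)]
        _ = δ := by field_simp)
  obtain ⟨L, hL⟩ := Distribution.exists_limit (F := fun k => F (j k)) (C := C)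
    (fun i k => hF i (j k)) (fun φ => by
      obtain ⟨i, hi⟩ := TestFunction.exists_mem_sobolevBall r φ
      refine cauchySeq_tendsto_of_complete (Metric.cauchySeq_iff.2 fun δ hδ => ?_)
      obtain ⟨N, hN⟩ := hcau i (δ / 2) (by linarith)
      exact ⟨N, fun k hk l hl => (hN k hk l hl φ hi).trans_lt (by linarith)⟩)
  refine ⟨j, hj, L, .of_bound fun i => ?_, fun U hU => ?_⟩
  · obtain ⟨M, hM⟩ := TestFunction.exists_bound_of_mem_sobolevBall hr i
    exact ⟨C i * M, fun φ hφ => le_of_tendsto (hL φ).abs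
      (.of_forall fun k => hF i (j k) φ M hφ.1 (hM φ hφ))⟩
  · obtain ⟨i, hi⟩ := hU.exists_negSobolevNorm_le q
    rw [ENNReal.tendsto_nhds_zero]
    intro δ hδ
    obtain ⟨δ', hδ'0, hδ'⟩ := ENNReal.lt_iff_exists_nnreal_btwn.1 hδ
    have hpos : (0 : ℝ) < δ' := by exact_mod_cast hδ'0
    obtain ⟨N₁, hN₁⟩ := hcau i (δ' / 2) (by positivity)
    obtain ⟨N₂, hN₂⟩ := hTF i (δ' / 2) (by positivity)
    filter_upwards [eventually_ge_atTop (max N₁ N₂)] with k hk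
    refine (hi (T (j k) - L) δ' fun φ hφ => ?_).trans (by
      rw [ENNReal.ofReal_coe_nnreal]; exact hδ'.le)
    have h1 : |F (j k) φ - L φ| ≤ δ' / 2 :=
      le_of_tendsto ((hL φ).const_sub _).abs ((eventually_ge_atTop N₁).mono fun l hl =>
        hN₁ k ((le_max_left _ _).trans hk) l hl φ hφ)
    have h2 := hN₂ (j k) (((le_max_right _ _).trans hk).trans (hj.id_le k)) φ hφ
    change |T (j k) φ - L φ| ≤ δ'
    rw [abs_le] at h1 h2 ⊢
    constructor <;> linarith [h1.1, h1.2, h2.1, h2.2]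

/-- A sequence in the range of `T` may visit indices in any order, while the remainder is small only
for large indices. Either an index recurs forever, or the indices can be made to tend to infinity.
-/
theorem exists_subseq_const_or_tendsto_atTop (n : ℕ → ℕ) :
    ∃ j : ℕ → ℕ, StrictMono j ∧ ((∃ m, ∀ k, n (j k) = m) ∨ Tendsto (n ∘ j) atTop atTop) := by
  by_cases h : ∀ N, ∃ᶠ k in atTop, N ≤ n k
  · obtain ⟨j, hj, hn⟩ := extraction_forall_of_frequently h
    exact ⟨j, hj, .inr (tendsto_atTop_mono hn tendsto_id)⟩
  · push Not at h
    obtain ⟨N, hN⟩ := h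
    have : ∃ m, ∃ᶠ k in atTop, n k = m := by
      by_contra! hm
      have h1 : ∀ᶠ k in atTop, ∀ m ∈ Finset.range N, n k ≠ m :=
        (Finset.eventually_all _).2 fun m _ => hm m
      obtain ⟨k, hk1, hk2⟩ := (h1.and hN).exists
      exact hk1 (n k) (Finset.mem_range.2 hk2) rfl
    obtain ⟨m, hm⟩ := this
    obtain ⟨j, hj, hn⟩ := extraction_of_frequently_atTop hm
    exact ⟨j, hj, .inl ⟨m, hn⟩⟩

theorem isPrecompactNegSobolevLoc_range {q : ℝ} (hq₁ : 1 < q) (hq₂ : q < 2)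
    {T F : ℕ → 𝓓'(halfPlane, ℝ)} {C : ℕ → ℝ}
    (hF : ∀ i k (φ : 𝓓(halfPlane, ℝ)) m, tsupport φ ⊆ exhaustion i → (∀ x, |φ x| ≤ m) →
      |F k φ| ≤ C i * m)
    (hB : ∀ i k, ∃ B, ∀ φ ∈ sobolevBall (q / (q - 1)) i, |T k φ - F k φ| ≤ B)
    (hTF : ∀ i, ∀ δ > 0, ∃ N, ∀ k ≥ N, ∀ φ ∈ sobolevBall (q / (q - 1)) i,
      |T k φ - F k φ| ≤ δ) :
    IsPrecompactNegSobolevLoc q (range T) := by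
  have hmem : ∀ k, MemNegSobolevLoc q (T k) := fun k => .of_bound fun i => by
    obtain ⟨M, hM⟩ := TestFunction.exists_bound_of_mem_sobolevBall (two_lt_conjExponent hq₁ hq₂) i
    obtain ⟨B, hB⟩ := hB i k
    refine ⟨C i * M + B, fun φ hφ => ?_⟩
    have h1 := hF i k φ M hφ.1 (hM φ hφ)
    have h2 := hB φ hφ
    rw [abs_le] at h1 h2 ⊢
    constructor <;> linarith [h1.1, h1.2, h2.1, h2.2]
  refine ⟨forall_mem_range.2 hmem, fun S hS => ?_⟩
  choose n hn using hS
  obtain ⟨j, hj, ⟨m, hm⟩ | hlim⟩ := exists_subseq_const_or_tendsto_atTop n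
  · refine ⟨j, hj, T m, hmem m, fun U hU => ?_⟩
    obtain ⟨i, hi⟩ := hU.exists_negSobolevNorm_le q
    have h0 : negSobolevNorm q U 0 = 0 := by
      have := hi 0 0 fun φ _ => abs_zero.le
      simpa using this
    refine tendsto_const_nhds.congr fun k => ?_
    rw [← hn, hm, sub_self, h0]
  · obtain ⟨l, hl, L, hL, hconv⟩ := exists_subseq_tendsto_negSobolevNorm hq₁ hq₂
      (T := fun k => T (n (j k))) (F := fun k => F (n (j k))) (C := C) (fun i k => hF i _)
      (fun i δ hδ => by
        obtain ⟨N, hN⟩ := hTF i δ hδ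
        obtain ⟨N', hN'⟩ := eventually_atTop.1 (hlim.eventually_ge_atTop N)
        exact ⟨N', fun k hk => hN _ (hN' k hk)⟩)
    refine ⟨j ∘ l, hj.comp hl, L, hL, fun U hU => (hconv U hU).congr fun k => ?_⟩
    rw [hn, Function.comp_apply]

/-! ### Bounded sources, vanishing fluxes and the conclusion. -/

theorem abs_integral_mul_le_of_abs_le {f D φ : ℝ × ℝ → ℝ} {K : Set (ℝ × ℝ)} {m : ℝ}
    (hK : MeasurableSet K) (h0 : ∀ z, z ∉ K → φ z = 0) (hm : ∀ z, |φ z| ≤ m)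
    (hf : ∀ z ∈ K, |f z| ≤ D z) (hD : IntegrableOn D K) :
    |∫ z, f z * φ z| ≤ (∫ z in K, D z) * m := by
  rw [← setIntegral_eq_integral_of_forall_compl_eq_zero (s := K) fun z hz => by
    rw [h0 z hz, mul_zero], ← integral_mul_const, ← Real.norm_eq_abs]
  refine norm_integral_le_of_norm_le (hD.mul_const m)
    ((ae_restrict_iff' hK).2 (.of_forall fun z hz => ?_))
  rw [norm_mul, Real.norm_eq_abs, Real.norm_eq_abs]
  exact mul_le_mul (hf z hz) (hm z) (abs_nonneg _) ((abs_nonneg _).trans (hf z hz))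

/-- Young's inequality with a free weight `c`, standing in for Cauchy-Schwarz: later `c` is fixed
large, and only then the bound on `g²` tends to zero. -/
theorem abs_integral_mul_le_of_sq_le {g D φ : ℝ × ℝ → ℝ} {K : Set (ℝ × ℝ)} {c : ℝ}
    (hK : MeasurableSet K) (h0 : ∀ z, z ∉ K → φ z = 0) (hg : ∀ z ∈ K, g z ^ 2 ≤ D z)
    (hD : IntegrableOn D K) (hφ : IntegrableOn (fun z => φ z ^ 2) K) (hc : 0 < c) :
    |∫ z, g z * φ z| ≤ c * (∫ z in K, D z) + (∫ z in K, φ z ^ 2) / c := by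
  rw [← setIntegral_eq_integral_of_forall_compl_eq_zero (s := K) fun z hz => by
    rw [h0 z hz, mul_zero], ← integral_const_mul, ← integral_div,
    ← integral_add (hD.const_mul c) (hφ.div_const c), ← Real.norm_eq_abs]
  refine norm_integral_le_of_norm_le ((hD.const_mul c).add (hφ.div_const c))
    ((ae_restrict_iff' hK).2 (.of_forall fun z hz => ?_))
  rw [norm_mul, Real.norm_eq_abs, Real.norm_eq_abs]
  change |g z| * |φ z| ≤ c * D z + φ z ^ 2 / c
  have h1 : |g z| * |φ z| ≤ c * |g z| ^ 2 + |φ z| ^ 2 / c := by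
    rw [← sub_nonneg]
    have : c * |g z| ^ 2 + |φ z| ^ 2 / c - |g z| * |φ z|
        = (c * |g z| - |φ z|) ^ 2 / c + |g z| * |φ z| := by
      field_simp
      ring
    rw [this]
    positivity
  rw [sq_abs, sq_abs] at h1
  have := mul_le_mul_of_nonneg_left (hg z hz) hc.le
  linarith

/-- The weight `√p'/ρ` in the bound of `β_ρ` is exactly the one accompanying `ρ_x` in the
dissipation, so the source is dominated by the dissipation. -/
theorem abs_source_le {C ε s R a b A B : ℝ} (hC : 0 ≤ C) (hε : 0 < ε) (hs : 0 ≤ s)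
    (hA : |A| ≤ C * (√s / R)) (hB : |B| ≤ C) :
    |-ε * (A * a + B * b) * b| ≤ 2 * C * (ε * (b ^ 2 + s * a ^ 2 / R ^ 2)) := by
  have e : s * a ^ 2 / R ^ 2 = (√s / R * |a|) ^ 2 := by
    rw [mul_pow, div_pow, Real.sq_sqrt hs, sq_abs]; ring
  rw [e, abs_mul, abs_mul, abs_neg, abs_of_pos hε]
  set y := √s / R * |a| with hy
  have h1 : |A * a + B * b| ≤ C * (y + |b|) := by
    refine (abs_add_le _ _).trans ?_
    rw [abs_mul, abs_mul]
    have h2 := mul_le_mul_of_nonneg_right hA (abs_nonneg a)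
    have h3 := mul_le_mul_of_nonneg_right hB (abs_nonneg b)
    rw [hy]
    linarith
  have h4 : (y + |b|) * |b| ≤ 2 * (b ^ 2 + y ^ 2) := by
    rw [← sq_abs b]
    linarith [sq_nonneg (y - |b|), sq_nonneg |b|, sq_nonneg y,
      show (y - |b|) ^ 2 = y ^ 2 - 2 * (y * |b|) + |b| ^ 2 by ring,
      show (y + |b|) * |b| = y * |b| + |b| ^ 2 by ring]
  calc ε * |A * a + B * b| * |b| ≤ ε * (C * (y + |b|)) * |b| := by gcongr
    _ = ε * C * ((y + |b|) * |b|) := by ring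
    _ ≤ ε * C * (2 * (b ^ 2 + y ^ 2)) := by gcongr
    _ = _ := by ring

/-- One of the two factors `ε` is left over after forming the dissipation; it makes the flux vanish
in `L²_loc`. -/
theorem sq_flux_le {C ε β b d : ℝ} (hε : 0 < ε) (hβ : |β| ≤ C) (hd : 0 ≤ d) :
    (-ε * β * b) ^ 2 ≤ C ^ 2 * ε * (ε * (b ^ 2 + d)) := by
  have h1 : β ^ 2 ≤ C ^ 2 := by
    rw [← sq_abs]
    exact pow_le_pow_left₀ (abs_nonneg _) hβ 2
  calc (-ε * β * b) ^ 2 = β ^ 2 * (ε ^ 2 * b ^ 2) := by ring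
    _ ≤ C ^ 2 * (ε ^ 2 * (b ^ 2 + d)) := by
        gcongr
        linarith
    _ = _ := by ring

theorem IsCompact.integrableOn_of_abs_le {f D : ℝ × ℝ → ℝ} {K : Set (ℝ × ℝ)} (hK : IsCompact K)
    (hKs : K ⊆ (halfPlane : Set (ℝ × ℝ)))
    (hf : AEStronglyMeasurable f (volume.restrict (halfPlane : Set (ℝ × ℝ))))
    (hD : ContinuousOn D (halfPlane : Set (ℝ × ℝ))) (h : ∀ z : ℝ × ℝ, 0 < z.1 → |f z| ≤ D z) :
    IntegrableOn f K :=
  ((hD.mono hKs).integrableOn_compact hK).mono' (hf.mono_measure (Measure.restrict_mono hKs le_rfl))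
    ((ae_restrict_iff' hK.measurableSet).2 (.of_forall fun z hz => h z (hKs hz)))

theorem entropyDissipation_apply {χ σ : ℝ → ℝ → ℝ → ℝ} {ψ : ℝ → ℝ} {ρ u : ℝ → ℝ → ℝ}
    (hη : LocallyIntegrableOn (fun z : ℝ × ℝ => generatedFunction χ ψ (ρ z.1 z.2) (u z.1 z.2))
      halfPlane volume)
    (hq : LocallyIntegrableOn (fun z : ℝ × ℝ => generatedFunction σ ψ (ρ z.1 z.2) (u z.1 z.2))
      halfPlane volume) (φ : 𝓓(halfPlane, ℝ)) :
    entropyDissipation χ σ ψ ρ u φ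
      = -(∫ z : ℝ × ℝ, generatedFunction χ ψ (ρ z.1 z.2) (u z.1 z.2)
          * (∂_{((1, 0) : ℝ × ℝ)} φ : 𝓓(halfPlane, ℝ)) z)
        - ∫ z : ℝ × ℝ, generatedFunction σ ψ (ρ z.1 z.2) (u z.1 z.2)
          * (∂_{((0, 1) : ℝ × ℝ)} φ : 𝓓(halfPlane, ℝ)) z := by
  rw [sub_eq_add_neg, ← lineDeriv_toDistribution_apply hη, ← lineDeriv_toDistribution_apply hq]
  rfl

/-- The source `f` plays the role of the bounded measures and the derivative of the flux `g` that of
the null sequence; both are controlled by the same locally bounded dissipation `D`. -/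
theorem isPrecompactNegSobolevLoc_of_source_flux {q : ℝ} (hq₁ : 1 < q) (hq₂ : q < 2)
    {T : ℕ → 𝓓'(halfPlane, ℝ)} {f g D : ℕ → ℝ × ℝ → ℝ} {ε : ℕ → ℝ} {C c : ℝ} (hC : 0 ≤ C)
    (hc : 0 ≤ c) (hε : ∀ n, 0 < ε n) (hε0 : Tendsto ε atTop (𝓝 0))
    (hT : ∀ n φ, T n φ = (∫ z, f n z * φ z)
      + ∫ z, g n z * (∂_{((0, 1) : ℝ × ℝ)} φ : 𝓓(halfPlane, ℝ)) z)
    (hfm : ∀ n, AEStronglyMeasurable (f n) (volume.restrict (halfPlane : Set (ℝ × ℝ))))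
    (hD : ∀ n, ContinuousOn (D n) (halfPlane : Set (ℝ × ℝ)))
    (hf : ∀ n (z : ℝ × ℝ), 0 < z.1 → |f n z| ≤ C * D n z)
    (hg : ∀ n (z : ℝ × ℝ), 0 < z.1 → g n z ^ 2 ≤ c * ε n * D n z)
    (hDb : ∀ i, ∃ W, ∀ n, ∫ z in exhaustion i, D n z ≤ W) :
    IsPrecompactNegSobolevLoc q (range T) := by
  have hr := two_lt_conjExponent hq₁ hq₂
  choose W hW using hDb
  have hloc : ∀ n, LocallyIntegrableOn (f n) halfPlane volume := fun n =>
    (locallyIntegrableOn_iff halfPlane.isOpen.isLocallyClosed).2 fun K hKs hK =>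
      hK.integrableOn_of_abs_le hKs (hfm n) (continuousOn_const.mul (hD n)) (hf n)
  have hDi : ∀ n i, IntegrableOn (D n) (exhaustion i) := fun n i =>
    ((hD n).mono (exhaustion_subset i)).integrableOn_compact (isCompact_exhaustion i)
  have hKm : ∀ i, MeasurableSet (exhaustion i) := fun i => (isCompact_exhaustion i).measurableSet
  have hrem : ∀ i n l, 0 < l → ∀ φ ∈ sobolevBall (q / (q - 1)) i,
      |T n φ - toDistribution (f n) φ| ≤ l * (c * ε n * W i)
        + (volume.real (exhaustion i) + (i : ℝ) ^ (q / (q - 1))) / l := by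
    intro i n l hl φ hφ
    rw [hT, toDistribution_apply (hloc n), add_sub_cancel_left]
    refine (abs_integral_mul_le_of_sq_le (hKm i) (fun z hz => ?_)
      (fun z hz => hg n z (exhaustion_subset i hz)) ((hDi n i).const_mul _)
      (((∂_{((0, 1) : ℝ × ℝ)} φ : 𝓓(halfPlane, ℝ)).continuous.pow 2).continuousOn
        |>.integrableOn_compact (isCompact_exhaustion i)) hl).trans ?_
    · rw [TestFunction.lineDerivOp_apply_eq_fderiv,
        image_eq_zero_of_notMem_tsupport fun hm => hz (hφ.1 (tsupport_fderiv_subset ℝ hm))]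
      rfl
    · rw [integral_const_mul]
      have h1 := hW i n
      have h2 := hε n
      have h3 := TestFunction.setIntegral_sq_derivX_le hr hφ
      gcongr
  refine isPrecompactNegSobolevLoc_range hq₁ hq₂ (F := fun n => toDistribution (f n))
    (C := fun i => C * W i) (fun i n φ m hs hm => ?_) (fun i n => ⟨_, hrem i n 1 one_pos⟩)
    fun i δ hδ => ?_
  · rw [toDistribution_apply (hloc n)]
    refine (abs_integral_mul_le_of_abs_le (hKm i)
      (fun z hz => image_eq_zero_of_notMem_tsupport fun h => hz (hs h)) hm
      (fun z hz => hf n z (exhaustion_subset i hz)) ((hDi n i).const_mul C)).trans ?_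
    rw [integral_const_mul]
    have h1 := hW i n
    have h2 := (abs_nonneg _).trans (hm 0)
    gcongr
  · set B := volume.real (exhaustion i) + (i : ℝ) ^ (q / (q - 1))
    have hB : 0 ≤ B := by positivity
    -- This weight makes the test-function part at most `δ/2` for all `n`; the flux part is below
    -- `δ/2` once `ε n` is small.
    set l := 2 * (B + 1) / δ with hl
    have hl0 : 0 < l := by positivity
    have hBl : B / l ≤ δ / 2 := by
      rw [hl, div_div_eq_mul_div, div_le_div_iff₀ (by positivity) two_pos]
      linarith
    have hlim : Tendsto (fun n => l * (c * ε n * W i)) atTop (𝓝 0) := by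
      simpa using ((hε0.const_mul c).mul_const (W i)).const_mul l
    obtain ⟨N, hN⟩ := eventually_atTop.1 (hlim.eventually_le_const (half_pos hδ))
    refine ⟨N, fun n hn φ hφ => (hrem i n l hl0 φ hφ).trans ?_⟩
    linarith [hN n hn]

theorem proposition3p7
    (p : ℝ → ℝ) (γ κ ρs cs M : ℝ) (hp : IsPressureLaw p γ κ ρs cs M)
    (ρl ul ρr ur : ℝ) (hρl : 0 < ρl) (hρr : 0 < ρr)
    (ρbar ubar : ℝ → ℝ) (hbar : IsReferencePair ρl ul ρr ur ρbar ubar)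
    (χ σ : ℝ → ℝ → ℝ → ℝ) (hχ : IsEntropyKernel p χ) (hσ : IsEntropyFluxKernel p χ σ)
    (ε : ℕ → ℝ) (hε : ∀ n, 0 < ε n) (hε0 : Tendsto ε atTop (𝓝 0))
    (ρ u : ℕ → ℝ → ℝ → ℝ)
    (hsol : ∀ n, IsNavierStokesSolution p (ε n) ρl ul ρr ur ρbar ubar (ρ n) (u n))
    (hE₀ : (⨆ n, relativeEnergy p ρbar ubar (ρ n 0) (u n 0)) < ⊤)
    (hE₁ : (⨆ n, ENNReal.ofReal (ε n ^ 2) *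
      ∫⁻ x, ENNReal.ofReal (deriv (ρ n 0) x ^ 2 / ρ n 0 x ^ 3)) < ⊤)
    (hM₀ : (⨆ n, ∫⁻ x, ENNReal.ofReal (ρ n 0 x * |u n 0 x - ubar x|)) < ⊤)
    (ψ : ℝ → ℝ) (hψ : ContDiff ℝ 2 ψ) (hψc : HasCompactSupport ψ)
    (q : ℝ) (hq₁ : 1 < q) (hq₂ : q < 2) :
    (∀ n,
      LocallyIntegrableOn (fun z : ℝ × ℝ => generatedFunction χ ψ (ρ n z.1 z.2) (u n z.1 z.2))
        halfPlane volume ∧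
      LocallyIntegrableOn (fun z : ℝ × ℝ => generatedFunction σ ψ (ρ n z.1 z.2) (u n z.1 z.2))
        halfPlane volume) ∧
    IsPrecompactNegSobolevLoc q
      (Set.range fun n => entropyDissipation χ σ ψ (ρ n) (u n)) := by

  obtain ⟨C, hC, β, A, B, hb, hrep⟩ := exists_dissipation_representation hp hχ hσ hψ hψc
  have hflow : ∀ n, IsSmoothFlow p (ε n) (fun z => ρ n z.1 z.2) (fun z => u n z.1 z.2) :=
    fun n => (hsol n).isSmoothFlow hp
  choose hη hq hfm hgm hfg using fun n => hrep _ _ _ (hflow n)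
  refine ⟨fun n => ⟨hη n, hq n⟩, ?_⟩
  have hpos : ∀ n, ∀ z ∈ closedHalfPlane, 0 < ρ n z.1 z.2 := fun n z hz => by
    have hz1 : 0 ≤ z.1 := hz.1
    obtain ⟨c, hc, h⟩ := (hsol n).no_vacuum (z.1 + 1) (by linarith)
    exact hc.trans_le (h z.1 ⟨hz1, by linarith⟩ z.2)
  have hsub : (halfPlane : Set (ℝ × ℝ)) ⊆ closedHalfPlane := fun z hz =>
    ⟨le_of_lt (show 0 < z.1 from hz), mem_univ _⟩
  have hDc : ∀ n, ContinuousOn (fun z => ε n * dissipationDensity p (fun z => ρ n z.1 z.2)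
      (fun z => u n z.1 z.2) z) closedHalfPlane := fun n =>
    continuousOn_const.mul (continuousOn_dissipationDensity (hsol n).contDiffOn_rho
      (hsol n).contDiffOn_u (hpos n) hp)
  have hDe : ∀ n (z : ℝ × ℝ), 0 < z.1 → dissipationDensity p (fun z => ρ n z.1 z.2)
      (fun z => u n z.1 z.2) z = derivX (fun z => u n z.1 z.2) z ^ 2 + deriv p (ρ n z.1 z.2)
        * derivX (fun z => ρ n z.1 z.2) z ^ 2 / ρ n z.1 z.2 ^ 2 := fun n z hz => by
    rw [dissipationDensity, derivXWithin_eq hz, derivXWithin_eq hz]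
  refine isPrecompactNegSobolevLoc_of_source_flux hq₁ hq₂ (C := 2 * C) (c := C ^ 2)
    (by positivity) (by positivity) hε hε0
    (fun n φ => (entropyDissipation_apply (hη n) (hq n) φ).trans (hfg n φ)) hfm
    (D := fun n z => ε n * dissipationDensity p (fun z => ρ n z.1 z.2) (fun z => u n z.1 z.2) z)
    (fun n => (hDc n).mono hsub) (fun n z hz => ?_) (fun n z hz => ?_) (fun i => ?_)
  · have h0 := (hflow n).pos z hz
    obtain ⟨-, h1, h2⟩ := hb (ρ n z.1 z.2) (u n z.1 z.2) h0
    rw [hDe n z hz]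
    exact abs_source_le hC (hε n) (hp.strictly_hyperbolic _ h0).le h1 h2
  · have h0 := (hflow n).pos z hz
    have h1 := hp.strictly_hyperbolic _ h0
    rw [hDe n z hz]
    exact sq_flux_le (hε n) (hb _ _ h0).1 (by positivity)
  · have hi : (0 : ℝ) < i + 1 := by positivity
    -- The energy bound is taken on `[0, i+1] × [-(i+1), i+1]`, which contains the `i`-th rectangle
    -- and starts at the initial time.
    obtain ⟨W, hW⟩ := exists_uniform_dissipation_bound hp hρl hρr hbar hε hε0 hsol hE₀ hE₁ hi hi
    refine ⟨W, fun n => le_trans ?_ (hW n)⟩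
    have hIcc := Icc_prod_subset_closedHalfPlane ((i : ℝ) + 1) (i + 1)
    refine setIntegral_mono_set ?_ ?_ (.of_forall ?_)
    · exact ((hDc n).mono hIcc).integrableOn_compact (by
        rw [← Icc_prod_Icc]; exact isCompact_Icc.prod isCompact_Icc)
    · refine (ae_restrict_iff' measurableSet_Icc).2 (.of_forall fun z hz => ?_)
      have h0 := hpos n z (hIcc hz)
      have h1 := hp.strictly_hyperbolic _ h0
      exact mul_nonneg (hε n).le (add_nonneg (sq_nonneg _)
        (div_nonneg (mul_nonneg h1.le (sq_nonneg _)) (sq_nonneg _)))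
    · intro z hz
      exact ⟨⟨le_of_lt (exhaustion_subset i hz), hz.1.2⟩, hz.2⟩
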